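/- **Setting.** Let $M$ be a smooth $d$-dimensional manifold and $E=\Pi TM$ its parity-inverted tangent bundle, so that $C^\infty(E)=\Gamma(\bigwedge^\bullet T^*M)$ is the algebra of (inhomogeneous) exterior forms, with Grassmann parity the form degree modulo 2. Let $H_{\rm odd}$ and $H_{\rm even}$ be closed forms that are sums of forms of odd, respectively even, degree. For a vector field $X$ let $i_X$ be the contraction and $\mathcal L_X=[i_X,d]=i_Xd+d\,i_X$. For a Lie superalgebra $(\mathcal A,[\cdot,\cdot])$ with bracket of parity $\epsilon\in\{0,1\}$ and $Q\in\mathcal A$, the derived brackets are $$\Phi_Q^n(a_1,\ldots,a_n)=\frac1{n!}\sum_{\pi\in S_n}(-1)^{\epsilon_{\pi,a}}\,[[\ldots[Q,a_{\pi(1)}],\ldots],a_{\pi(n)}],$$ for $a_i$ of definite parity $\epsilon_{a_i}$ (extended multilinearly), where $(-1)^{\epsilon_{\pi,a}}$ is the sign obtained by permuting $a_1,\ldots,a_n$ to $a_{\pi(1)},\ldots,a_{\pi(n)}$ when interchanging neighbours $a,b$ costs $(-1)^{(\epsilon_a+\epsilon)(\epsilon_b+\epsilon)}$. Three cases are considered.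 * $\Phi_D$: $\mathcal A={\rm End}(C^\infty(E))$ with the supercommutator ($\epsilon=0$) and $D=d+H_{\rm odd}$, where a form is identified with the operator of left multiplication by it. A vector field $X$ enters as $i_X$. * $\Phi_Q$: $\mathcal A=C^\infty(T^*E)$, with local coordinates $x^i,P_i$ (even) and $c^i=dx^i,b_i$ (odd), with the Poisson bracket ($\epsilon=0$) $\{P_i,x^j\}=\delta_i^j=-\{x^j,P_i\}$, $\{b_i,c^j\}=\delta_i^j=\{c^j,b_i\}$, all other brackets of coordinates being zero, and $Q=c^iP_i+H_{\rm odd}$. A vector field $X=X^i\partial_i$ enters as $\tilde X=X^ib_i$. * $\Phi_S$: $\mathcal A=C^\infty(\Pi T^*E)$, with local coordinates $x^i,p_i$ (even) and $c^i=dx^i,B_i$ (odd), with the antibracket ($\epsilon=1$) $(B_i,x^j)=\delta_i^j=-(x^j,B_i)$, $(p_i,c^j)=\delta_i^j=-(c^j,p_i)$, all other brackets of coordinates being zero, and $S=c^iB_i+H_{\rm even}$. A vector field $X$ enters as $X^ip_i$. In the last two cases a form is identified with a function of $x^i$ and $c^i$, and identities are understood in every coordinate chart of $M$. **Proposition.**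 Let $X,Y,X_{(1)},X_{(2)},\ldots$ be (ordinary, i.e. bosonic) smooth vector fields on $M$ and let $\eta\in\Gamma(\bigwedge^\bullet T^*M)$ be a form. 1. For all $n\ge3$, $$\Phi_S^n(X_{(1)},\ldots,X_{(n)})=i_{X_{(1)}}\cdots i_{X_{(n)}}H_{\rm even},$$ $$\Phi_Q^n(\tilde X_{(1)},\ldots,\tilde X_{(n)})=\Phi_D^n(i_{X_{(1)}},\ldots,i_{X_{(n)}})=i_{X_{(1)}}\cdots i_{X_{(n)}}H_{\rm odd}.$$ 2. For all $n\ge2$ the brackets $$\Phi_S^{n+1}(X_{(1)},\ldots,X_{(n)},\eta)=\Phi_Q^{n+1}(\tilde X_{(1)},\ldots,\tilde X_{(n)},\eta)=\Phi_D^{n+1}(i_{X_{(1)}},\ldots,i_{X_{(n)}},\eta)$$ are one and the same exterior form, denoted $\Phi^{n+1}(X_{(1)},\ldots,X_{(n)},\eta)$ below. 3. The three-bracket is $$\Phi^3(X,Y,\eta)=\tfrac13\left(i_{[X,Y]}+\tfrac12(i_X\mathcal L_Y-i_Y\mathcal L_X)+i_Xi_Yd\right)\eta=\left(\tfrac12(i_X\mathcal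 L_Y-i_Y\mathcal L_X)+\tfrac13\,d\,i_Xi_Y\right)\eta=\tfrac12\left(i_Xi_Yd-\tfrac13\,d\,i_Xi_Y+i_{[X,Y]}\right)\eta.$$ 4. For all $n\ge3$, $$\Phi^{n+1}(X_{(1)},\ldots,X_{(n)},\eta)=\frac1{n+1}\sum_{1\le i\le n}(-1)^{i-1}\,i_{X_{(i)}}\Phi^{n}(X_{(1)},\ldots,\widehat{X}_{(i)},\ldots,X_{(n)},\eta).$$ 5. For all $n\ge2$, $$\Phi^{n+1}(X_{(1)},\ldots,X_{(n)},\eta)=\frac{6}{(n+1)n(n-1)}\sum_{1\le i<j\le n}(-1)^{(n-1-i)+(n-j)}\,i_{X_{(1)}}\cdots\widehat{i}_{X_{(i)}}\cdots\widehat{i}_{X_{(j)}}\cdots i_{X_{(n)}}\,\Phi^3(X_{(i)},X_{(j)},\eta).$$ 6. In each of the three cases, every bracket whose arguments are vector fields and exterior forms, in any order, at least two of them being forms, vanishes. -/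

import Mathlib

open scoped Manifold ContDiff Topology
open Set Filter

noncomputable section
namespace CourantHierarchy

/-- Coordinate space `ℝ^d`. -/
abbrev Euc (d : ℕ) : Type := EuclideanSpace ℝ (Fin d)

theorem two_le_infty : (2 : WithTop ℕ∞) ≤ ∞ :=
  WithTop.coe_le_coe.2 (le_top : (2 : ℕ∞) ≤ ⊤)

section Alternating
variable {V : Type*} [AddCommGroup V] [Module ℝ V] [TopologicalSpace V]

/-- Contraction `i_X α = α(X, ·, …, ·)` of an alternating form with a vector. -/
def contract {k : ℕ} (X : V) (α : V [⋀^Fin (k + 1)]→L[ℝ] ℝ) : V [⋀^Fin k]→L[ℝ] ℝ where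
  __ := α.toAlternatingMap.curryLeft X
  cont := by
    change Continuous fun v : Fin k → V => α (Matrix.vecCons X v)
    refine α.cont.comp ?_
    exact continuous_pi fun i => by
      refine Fin.cases ?_ (fun j => ?_) i
      · simpa using continuous_const
      · simpa using continuous_apply j

theorem contract_apply {k : ℕ} (X : V) (α : V [⋀^Fin (k + 1)]→L[ℝ] ℝ) (v : Fin k → V) :
    contract X α v = α (Matrix.vecCons X v) := rfl

/-- The wedge product of alternating forms, the sum over `(p, q)`-shuffles of
`sign σ • α(v_{σ(1)}, …, v_{σ(p)}) β(v_{σ(p+1)}, …, v_{σ(n)})`, where `n = p + q`. -/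
def wedge {p q n : ℕ} (h : p + q = n)
    (α : V [⋀^Fin p]→L[ℝ] ℝ) (β : V [⋀^Fin q]→L[ℝ] ℝ) : V [⋀^Fin n]→L[ℝ] ℝ where
  __ := ((LinearMap.mul' ℝ ℝ).compAlternatingMap
      (α.toAlternatingMap.domCoprod β.toAlternatingMap)).domDomCongr
      (finSumFinEquiv.trans (finCongr h))
  cont := by
    change Continuous fun v : Fin n → V => LinearMap.mul' ℝ ℝ
      ((∑ σ : Equiv.Perm.ModSumCongr (Fin p) (Fin q),
        AlternatingMap.domCoprod.summand α.toAlternatingMap β.toAlternatingMap σ)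
          (fun i => v (finSumFinEquiv.trans (finCongr h) i)))
    simp only [sum_apply, map_sum]
    refine continuous_finsetSum _ fun σ _ => ?_
    induction σ using Quotient.inductionOn' with | _ σ
    rw [AlternatingMap.domCoprod.summand_mk'']
    have : Continuous fun v : Fin n → V => ((Equiv.Perm.sign σ : ℤ) : ℝ) *
       (α (fun i => v (finSumFinEquiv.trans (finCongr h) (σ (Sum.inl i)))) *
        β (fun i => v (finSumFinEquiv.trans (finCongr h) (σ (Sum.inr i))))) := by
      refine continuous_const.mul (.mul (α.cont.comp ?_) (β.cont.comp ?_)) <;> fun_prop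
    refine this.congr fun v => ?_
    rcases Int.units_eq_one_or (Equiv.Perm.sign σ) with hs | hs <;> simp [hs]

theorem wedge_apply {p q n : ℕ} (h : p + q = n)
    (α : V [⋀^Fin p]→L[ℝ] ℝ) (β : V [⋀^Fin q]→L[ℝ] ℝ) (v : Fin n → V) :
    wedge h α β v = ∑ σ : Equiv.Perm.ModSumCongr (Fin p) (Fin q), LinearMap.mul' ℝ ℝ
        (AlternatingMap.domCoprod.summand α.toAlternatingMap β.toAlternatingMap σ
          (fun i => v (finSumFinEquiv.trans (finCongr h) i))) := by
  change LinearMap.mul' ℝ ℝ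
      ((∑ σ : Equiv.Perm.ModSumCongr (Fin p) (Fin q),
        AlternatingMap.domCoprod.summand α.toAlternatingMap β.toAlternatingMap σ)
          (fun i => v (finSumFinEquiv.trans (finCongr h) i))) = _
  simp only [sum_apply, map_sum]

theorem summand_apply {p q : ℕ} (α : V [⋀^Fin p]→L[ℝ] ℝ) (β : V [⋀^Fin q]→L[ℝ] ℝ)
    (σ : Equiv.Perm (Fin p ⊕ Fin q)) (v : Fin p ⊕ Fin q → V) :
    LinearMap.mul' ℝ ℝ (AlternatingMap.domCoprod.summand α.toAlternatingMap β.toAlternatingMap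
      (Quotient.mk'' σ) v) = ((Equiv.Perm.sign σ : ℤ) : ℝ) *
        (α (fun i => v (σ (Sum.inl i))) * β (fun i => v (σ (Sum.inr i)))) := by
  rw [AlternatingMap.domCoprod.summand_mk'']
  rcases Int.units_eq_one_or (Equiv.Perm.sign σ) with hs | hs <;> simp [hs]

/-- `wedge` as a bilinear map. -/
def wedgeLin {p q n : ℕ} (h : p + q = n) :
    (V [⋀^Fin p]→L[ℝ] ℝ) →ₗ[ℝ] (V [⋀^Fin q]→L[ℝ] ℝ) →ₗ[ℝ] (V [⋀^Fin n]→L[ℝ] ℝ) := by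
  refine LinearMap.mk₂ ℝ (wedge h) ?_ ?_ ?_ ?_ <;> intros <;> ext v <;>
    simp only [ContinuousAlternatingMap.add_apply, ContinuousAlternatingMap.smul_apply,
      wedge_apply, ← Finset.sum_add_distrib, Finset.smul_sum] <;>
    refine Finset.sum_congr rfl fun σ _ => ?_ <;>
    induction σ using Quotient.inductionOn' <;>
    simp only [summand_apply, ContinuousAlternatingMap.add_apply,
      ContinuousAlternatingMap.smul_apply, smul_eq_mul] <;> ring

theorem wedge_comp {W : Type*} [AddCommGroup W] [Module ℝ W] [TopologicalSpace W] {p q n : ℕ} (h : p + q = n)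
    (α : V [⋀^Fin p]→L[ℝ] ℝ) (β : V [⋀^Fin q]→L[ℝ] ℝ) (f : W →L[ℝ] V) :
    (wedge h α β).compContinuousLinearMap f =
      wedge h (α.compContinuousLinearMap f) (β.compContinuousLinearMap f) := by
  ext w
  simp only [ContinuousAlternatingMap.compContinuousLinearMap_apply, wedge_apply]
  refine Finset.sum_congr rfl fun σ _ => ?_
  induction σ using Quotient.inductionOn'
  simp only [summand_apply]
  rfl

theorem contract_comp {W : Type*} [AddCommGroup W] [Module ℝ W] [TopologicalSpace W] {k : ℕ}
    (α : V [⋀^Fin (k + 1)]→L[ℝ] ℝ) (f : W →L[ℝ] V) (X : W) :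
    (contract (f X) α).compContinuousLinearMap f = contract X (α.compContinuousLinearMap f) := by
  ext w
  simp only [ContinuousAlternatingMap.compContinuousLinearMap_apply, contract_apply]
  congr 1
  funext i
  refine Fin.cases ?_ (fun j => ?_) i <;> simp

end Alternating

instance (d k : ℕ) : FiniteDimensional ℝ (Euc d [⋀^Fin k]→L[ℝ] ℝ) := by
  refine FiniteDimensional.of_injective (V₂ := MultilinearMap ℝ (fun _ : Fin k => Euc d) ℝ)
    { toFun := fun f => f.toMultilinearMap, map_add' := fun _ _ => rfl, map_smul' := fun _ _ => rfl } ?_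
  intro f g h
  ext v
  exact DFunLike.congr_fun h v

theorem contDiffOn_wedge {d p q n : ℕ} (h : p + q = n) {s : Set (Euc d)}
    {α : Euc d → Euc d [⋀^Fin p]→L[ℝ] ℝ} {β : Euc d → Euc d [⋀^Fin q]→L[ℝ] ℝ}
    (hα : ContDiffOn ℝ ∞ α s) (hβ : ContDiffOn ℝ ∞ β s) :
    ContDiffOn ℝ ∞ (fun y => wedge h (α y) (β y)) s := by
  exact ((wedgeLin (V := Euc d) h).toContinuousBilinearMap.contDiff.comp_contDiffOn hα).clm_apply hβ

/-- `contract` as a bilinear map. -/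
def contractLin {V : Type*} [AddCommGroup V] [Module ℝ V] [TopologicalSpace V] {k : ℕ} : V →ₗ[ℝ] (V [⋀^Fin (k + 1)]→L[ℝ] ℝ) →ₗ[ℝ] (V [⋀^Fin k]→L[ℝ] ℝ) :=
  LinearMap.mk₂ ℝ contract
    (fun X Y α => by
      apply ContinuousAlternatingMap.toAlternatingMap_injective
      exact map_add α.toAlternatingMap.curryLeft X Y)
    (fun c X α => by
      apply ContinuousAlternatingMap.toAlternatingMap_injective
      exact map_smul α.toAlternatingMap.curryLeft c X)
    (fun X α β => rfl) (fun c X α => rfl)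

theorem contDiffOn_contract {d k : ℕ} {s : Set (Euc d)}
    {α : Euc d → Euc d [⋀^Fin (k + 1)]→L[ℝ] ℝ} {X : Euc d → Euc d}
    (hX : ContDiffOn ℝ ∞ X s) (hα : ContDiffOn ℝ ∞ α s) :
    ContDiffOn ℝ ∞ (fun y => contract (X y) (α y)) s := by
  exact ((contractLin (V := Euc d)).toContinuousBilinearMap.contDiff.comp_contDiffOn hX).clm_apply hα

section Forms
variable {d : ℕ} {M : Type*} [TopologicalSpace M] [ChartedSpace (Euc d) M]

/-- Not necessarily smooth differential `k`-forms on `M`. -/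
abbrev RoughForm (d : ℕ) (M : Type*) [TopologicalSpace M] [ChartedSpace (Euc d) M] (k : ℕ) :=
  ∀ x : M, TangentSpace (𝓡 d) x [⋀^Fin k]→L[ℝ] ℝ

/-- The differential of the inverse chart at `y`: it sends the `i`-th basis vector of `ℝ^d` to the
coordinate vector `∂/∂x^i` of the chart `φ` at the point `φ⁻¹(y)`. -/
def frame (φ : OpenPartialHomeomorph M (Euc d)) (y : Euc d) :
    Euc d →L[ℝ] TangentSpace (𝓡 d) (φ.symm y) :=
  mfderiv (𝓡 d) (𝓡 d) φ.symm y

/-- The differential of the chart `φ` at `x`: it sends a tangent vector to its coordinates. -/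
def coframe (φ : OpenPartialHomeomorph M (Euc d)) (x : M) :
    TangentSpace (𝓡 d) x →L[ℝ] Euc d :=
  mfderiv (𝓡 d) (𝓡 d) φ x

/-- The local representative of a form in the chart `φ`, as a form on (the target of `φ` in) `ℝ^d`. -/
def localForm (φ : OpenPartialHomeomorph M (Euc d)) {k : ℕ} (η : RoughForm d M k) (y : Euc d) :
    Euc d [⋀^Fin k]→L[ℝ] ℝ :=
  (η (φ.symm y)).compContinuousLinearMap (frame φ y)

/-- The components `(X^1, …, X^d)` of a vector field in the chart `φ`, as functions of `y ∈ ℝ^d`. -/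
def localField (φ : OpenPartialHomeomorph M (Euc d)) (X : ∀ x : M, TangentSpace (𝓡 d) x)
    (y : Euc d) : Euc d :=
  coframe φ (φ.symm y) (X (φ.symm y))

/-- All smooth coordinate charts of `M`. -/
abbrev maxAtlas (d : ℕ) (M : Type*) [TopologicalSpace M] [ChartedSpace (Euc d) M] :
    Set (OpenPartialHomeomorph M (Euc d)) := IsManifold.maximalAtlas (𝓡 d) ∞ M

/-- The space of smooth differential `k`-forms on `M`: the local representative is smooth in every
chart. -/
def smoothForms (d : ℕ) (M : Type*) [TopologicalSpace M] [ChartedSpace (Euc d) M] (k : ℕ) :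
    Submodule ℝ (RoughForm d M k) where
  carrier := {η | ∀ φ ∈ maxAtlas d M, ContDiffOn ℝ ∞ (localForm φ η) φ.target}
  zero_mem' φ _ := by
    have : localForm φ (0 : RoughForm d M k) = fun _ => 0 := by
      funext y; ext v; simp [localForm]
    rw [this]; exact contDiffOn_const
  add_mem' {a b} ha hb φ hφ := by
    have : localForm φ (a + b) = localForm φ a + localForm φ b := by
      funext y; ext v; simp [localForm]
    rw [this]; exact (ha φ hφ).add (hb φ hφ)
  smul_mem' c a ha φ hφ := by
    have : localForm φ (c • a) = c • localForm φ a := by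
      funext y; ext v; simp [localForm]
    rw [this]; exact contDiffOn_const.smul (ha φ hφ)

/-- Smooth differential `k`-forms on `M`. -/
def DiffForm (d : ℕ) (M : Type*) [TopologicalSpace M] [ChartedSpace (Euc d) M] (k : ℕ) : Type _ :=
  ↥(smoothForms d M k)

instance (k : ℕ) : AddCommGroup (DiffForm d M k) :=
  inferInstanceAs (AddCommGroup (smoothForms d M k))

instance (k : ℕ) : Module ℝ (DiffForm d M k) := inferInstanceAs (Module ℝ (smoothForms d M k))

/-- The exterior derivative, computed at `x` in the preferred chart around `x`. -/
def roughExtDeriv {k : ℕ} (η : RoughForm d M k) : RoughForm d M (k + 1) := fun x =>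
  (extDeriv (localForm (chartAt (Euc d) x) η) (chartAt (Euc d) x x)).compContinuousLinearMap
    (coframe (chartAt (Euc d) x) x)

theorem form_congr {k : ℕ} (η : RoughForm d M k) {x x' : M} (h : x = x') (w w' : Fin k → Euc d)
    (hw : w = w') :
    (η x : (Fin k → Euc d) → ℝ) w = (η x' : (Fin k → Euc d) → ℝ) w' := by
  subst h; subst hw; rfl

theorem mdiff_chart {φ : OpenPartialHomeomorph M (Euc d)} (hφ : φ ∈ maxAtlas d M) {x : M}
    (hx : x ∈ φ.source) : MDifferentiableAt (𝓡 d) (𝓡 d) φ x :=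
  (contMDiffAt_of_mem_maximalAtlas hφ hx).mdifferentiableAt (by simp)

theorem mdiff_symm {φ : OpenPartialHomeomorph M (Euc d)} (hφ : φ ∈ maxAtlas d M) {y : Euc d}
    (hy : y ∈ φ.target) : MDifferentiableAt (𝓡 d) (𝓡 d) φ.symm y :=
  (contMDiffAt_symm_of_mem_maximalAtlas hφ hy).mdifferentiableAt (by simp)

theorem coframe_frame {φ ψ : OpenPartialHomeomorph M (Euc d)} (hφ : φ ∈ maxAtlas d M)
    (hψ : ψ ∈ maxAtlas d M) {y : Euc d} (hy : y ∈ φ.target) (hy' : φ.symm y ∈ ψ.source) :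
    (coframe ψ (φ.symm y)).comp (frame φ y) = fderiv ℝ (fun z => ψ (φ.symm z)) y := by
  have h := mfderiv_comp y (mdiff_chart hψ hy') (mdiff_symm hφ hy)
  rw [← mfderiv_eq_fderiv]
  exact h.symm

theorem frame_coframe {φ : OpenPartialHomeomorph M (Euc d)} (hφ : φ ∈ maxAtlas d M) {y : Euc d}
    (hy : y ∈ φ.target) (X : TangentSpace (𝓡 d) (φ.symm y)) :
    frame φ y (coframe φ (φ.symm y) X) = X := by
  have h := mfderiv_comp (φ.symm y) (g := φ.symm) (f := φ) (by
    rw [φ.right_inv hy]; exact mdiff_symm hφ hy) (mdiff_chart hφ (φ.map_target hy))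
  have h2 : φ.symm ∘ φ =ᶠ[𝓝 (φ.symm y)] id :=
    (φ.eventually_left_inverse (φ.map_target hy))
  rw [h2.mfderiv_eq, mfderiv_id] at h
  have h3 := DFunLike.congr_fun h X
  have h4 : (mfderiv (𝓡 d) (𝓡 d) φ.symm (φ (φ.symm y)) : Euc d → Euc d)
    = (mfderiv (𝓡 d) (𝓡 d) φ.symm y : Euc d → Euc d) := by rw [φ.right_inv hy]
  exact ((congrFun h4 _).symm.trans h3.symm)


theorem localForm_contDiffOn {k : ℕ} {φ : OpenPartialHomeomorph M (Euc d)} (hφ : φ ∈ maxAtlas d M)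
    {η : RoughForm d M k} (hη : η ∈ smoothForms d M k) : ContDiffOn ℝ ∞ (localForm φ η) φ.target :=
  hη φ hφ

theorem transition_contDiffAt {φ ψ : OpenPartialHomeomorph M (Euc d)} (hφ : φ ∈ maxAtlas d M)
    (hψ : ψ ∈ maxAtlas d M) {y : Euc d} (hy : y ∈ φ.target) (hy' : φ.symm y ∈ ψ.source) :
    ContDiffAt ℝ ∞ (fun z => ψ (φ.symm z)) y := by
  rw [← contMDiffAt_iff_contDiffAt]
  exact (contMDiffAt_of_mem_maximalAtlas hψ hy').comp y (contMDiffAt_symm_of_mem_maximalAtlas hφ hy)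

theorem frame_transition {φ ψ : OpenPartialHomeomorph M (Euc d)} (hφ : φ ∈ maxAtlas d M)
    (hψ : ψ ∈ maxAtlas d M) {y : Euc d} (hy : y ∈ φ.target) (hy' : φ.symm y ∈ ψ.source)
    (v : Euc d) :
    (frame ψ (ψ (φ.symm y)) (fderiv ℝ (fun z => ψ (φ.symm z)) y v) : Euc d) = frame φ y v := by
  rw [← coframe_frame hφ hψ hy hy']
  have h1 : ψ (φ.symm y) ∈ ψ.target := ψ.map_source hy'
  have key : ∀ x : M, ∀ _ : ψ.symm (ψ x) = x, ∀ _ : ψ x ∈ ψ.target, ∀ w : TangentSpace (𝓡 d) x,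
      (frame ψ (ψ x) (coframe ψ x w) : Euc d) = w := by
    intro x hx hxt w
    have := frame_coframe hψ hxt (w : Euc d)
    rw [show (coframe ψ x w : Euc d) = (coframe ψ (ψ.symm (ψ x)) (w : Euc d)) by
      have : ∀ x' : M, x = x' → ∀ w : Euc d, (coframe ψ x w : Euc d) = coframe ψ x' w := by
        rintro x' rfl w; rfl
      exact this _ hx.symm w]
    exact this
  exact key _ (ψ.left_inv hy') h1 (frame φ y v)

theorem localForm_transition {k : ℕ} {φ ψ : OpenPartialHomeomorph M (Euc d)}
    (hφ : φ ∈ maxAtlas d M) (hψ : ψ ∈ maxAtlas d M) (η : RoughForm d M k)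
    {y : Euc d} (hy : y ∈ φ.target) (hy' : φ.symm y ∈ ψ.source) :
    localForm φ η y = (localForm ψ η (ψ (φ.symm y))).compContinuousLinearMap
      (fderiv ℝ (fun z => ψ (φ.symm z)) y) := by
  ext v
  exact form_congr η (ψ.left_inv hy').symm _ _
    (funext fun i => (frame_transition hφ hψ hy hy' (v i)).symm)

/-- The exterior derivative can be computed in any chart. -/
theorem localForm_roughExtDeriv [IsManifold (𝓡 d) ∞ M] {k : ℕ}
    {φ : OpenPartialHomeomorph M (Euc d)}
    (hφ : φ ∈ maxAtlas d M) {η : RoughForm d M k} (hη : η ∈ smoothForms d M k)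
    {y : Euc d} (hy : y ∈ φ.target) :
    localForm φ (roughExtDeriv η) y = extDeriv (localForm φ η) y := by
  set ψ := chartAt (Euc d) (φ.symm y) with hψdef
  have hψ : ψ ∈ maxAtlas d M := IsManifold.chart_mem_maximalAtlas _
  have hy' : φ.symm y ∈ ψ.source := mem_chart_source _ _
  have hev : localForm φ η =ᶠ[𝓝 y] fun z => (localForm ψ η (ψ (φ.symm z))).compContinuousLinearMap
      (fderiv ℝ (fun z => ψ (φ.symm z)) z) := by
    have h1 : φ.target ∩ φ.symm ⁻¹' ψ.source ∈ 𝓝 y :=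
      (φ.symm.isOpen_inter_preimage ψ.open_source).mem_nhds ⟨hy, hy'⟩
    filter_upwards [h1] with z hz
    exact localForm_transition hφ hψ η hz.1 hz.2
  have hd : DifferentiableAt ℝ (localForm ψ η) (ψ (φ.symm y)) :=
    ((hη ψ hψ).contDiffAt (ψ.open_target.mem_nhds (ψ.map_source hy'))).differentiableAt (by simp)
  rw [hev.extDeriv_eq, extDeriv_pullback (f := fun z => ψ (φ.symm z)) hd
    (transition_contDiffAt hφ hψ hy hy') (r := ∞)
    (by rw [minSmoothness_of_isRCLikeNormedField]; exact two_le_infty), ← coframe_frame hφ hψ hy hy']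
  rfl

theorem roughExtDeriv_mem [IsManifold (𝓡 d) ∞ M] {k : ℕ} {η : RoughForm d M k}
    (hη : η ∈ smoothForms d M k) : roughExtDeriv η ∈ smoothForms d M (k + 1) := by
  intro φ hφ
  have h : ContDiffOn ℝ ∞ (fun y => extDeriv (localForm φ η) y) φ.target :=
    (ContinuousAlternatingMap.alternatizeUncurryFinCLM ℝ (Euc d) ℝ).contDiff.comp_contDiffOn
      ((hη φ hφ).fderiv_of_isOpen φ.open_target (by simp))
  exact h.congr fun y hy => localForm_roughExtDeriv hφ hη hy

/-- Smooth vector fields on `M`: smooth sections of the tangent bundle. -/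
abbrev VField (d : ℕ) (M : Type*) [TopologicalSpace M] [ChartedSpace (Euc d) M]
    [IsManifold (𝓡 d) ∞ M] :=
  Cₛ^∞⟮𝓡 d; Euc d, (TangentSpace (𝓡 d) : M → Type _)⟯

variable [IsManifold (𝓡 d) ∞ M]

theorem localField_contDiffOn {φ : OpenPartialHomeomorph M (Euc d)} (hφ : φ ∈ maxAtlas d M)
    (X : VField d M) : ContDiffOn ℝ ∞ (localField φ X) φ.target := by
  have h1 : ContMDiffOn (𝓡 d).tangent (𝓡 d).tangent ∞ (tangentMapWithin (𝓡 d) (𝓡 d) φ φ.source)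
      (Bundle.TotalSpace.proj ⁻¹' φ.source) :=
    (contMDiffOn_of_mem_maximalAtlas hφ).contMDiffOn_tangentMapWithin (by simp)
      φ.open_source.uniqueMDiffOn
  have h2 : ContMDiffOn (𝓡 d) (𝓡 d).tangent ∞ (fun y => (⟨φ.symm y, X (φ.symm y)⟩ :
      TangentBundle (𝓡 d) M)) φ.target :=
    X.contMDiff.comp_contMDiffOn (contMDiffOn_symm_of_mem_maximalAtlas hφ)
  have h3 := (contMDiff_snd_tangentBundle_modelSpace (n := ∞) (Euc d) (𝓡 d)).comp_contMDiffOn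
    (h1.comp h2 fun y hy => φ.map_target hy)
  refine (contMDiffOn_iff_contDiffOn.1 h3).congr fun y hy => ?_
  simp only [localField, coframe, Function.comp, tangentMapWithin]
  rw [mfderivWithin_of_isOpen φ.open_source (φ.map_target hy)]
  rfl

/-- The exterior derivative `d` on smooth `k`-forms. -/
def extD {k : ℕ} : DiffForm d M k →ₗ[ℝ] DiffForm d M (k + 1) where
  toFun η := ⟨roughExtDeriv η.1, roughExtDeriv_mem η.2⟩
  map_add' a b := by
    refine Subtype.ext ?_; funext x
    have hc : chartAt (Euc d) x ∈ maxAtlas d M := IsManifold.chart_mem_maximalAtlas x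
    have hd : ∀ c : DiffForm d M k, DifferentiableAt ℝ (localForm (chartAt (Euc d) x) c.1)
        (chartAt (Euc d) x x) := fun c =>
      ((c.2 _ hc).contDiffAt ((chartAt (Euc d) x).open_target.mem_nhds
        (mem_chart_target _ x))).differentiableAt (by simp)
    have h1 : localForm (chartAt (Euc d) x) (a.1 + b.1) =
        localForm (chartAt (Euc d) x) a.1 + localForm (chartAt (Euc d) x) b.1 := by
      funext y; ext v; simp [localForm]
    change (extDeriv (localForm (chartAt (Euc d) x) (a.1 + b.1)) _).compContinuousLinearMap _ =
      (extDeriv _ _).compContinuousLinearMap _ + (extDeriv _ _).compContinuousLinearMap _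
    rw [h1, extDeriv_add (hd a) (hd b)]
    rfl
  map_smul' c a := by
    refine Subtype.ext ?_; funext x
    have h1 : localForm (chartAt (Euc d) x) (c • a.1) = c • localForm (chartAt (Euc d) x) a.1 := by
      funext y; ext v; simp [localForm]
    change (extDeriv (localForm (chartAt (Euc d) x) (c • a.1)) _).compContinuousLinearMap _ =
      c • (extDeriv _ _).compContinuousLinearMap _
    rw [h1, extDeriv_smul]
    rfl

/-- The contraction `i_X` on smooth forms. -/
def contractForm (X : VField d M) {k : ℕ} : DiffForm d M (k + 1) →ₗ[ℝ] DiffForm d M k where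
  toFun η := ⟨fun x => contract (X x) (η.1 x), fun φ hφ => by
    refine (contDiffOn_contract (localField_contDiffOn hφ X) (η.2 φ hφ)).congr fun y hy => ?_
    rw [localForm, localForm, ← contract_comp, localField, frame_coframe hφ hy]⟩
  map_add' _ _ := rfl
  map_smul' _ _ := rfl

/-- Left wedge multiplication by the smooth `p`-form `η`. -/
def wedgeForm {p q n : ℕ} (h : p + q = n) (η : DiffForm d M p) :
    DiffForm d M q →ₗ[ℝ] DiffForm d M n where
  toFun ζ := ⟨fun x => wedge h (η.1 x) (ζ.1 x), fun φ hφ => by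
    refine (contDiffOn_wedge h (η.2 φ hφ) (ζ.2 φ hφ)).congr fun y hy => ?_
    rw [localForm, wedge_comp]; rfl⟩
  map_add' a b := by
    refine Subtype.ext ?_; funext x; exact map_add (wedgeLin h (η.1 x)) (a.1 x) (b.1 x)
  map_smul' c a := by
    refine Subtype.ext ?_; funext x; exact map_smul (wedgeLin h (η.1 x)) c (a.1 x)

/-- The Lie bracket `[X, Y]` of vector fields. -/
def vbracket (X Y : VField d M) : VField d M where
  toFun := VectorField.mlieBracket (𝓡 d) X Y
  contMDiff_toFun := fun x => by
    have : IsManifold (𝓡 d) (((⊤ : ℕ∞) : WithTop ℕ∞) + 1) M := by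
      simpa using (inferInstance : IsManifold (𝓡 d) ∞ M)
    have : IsManifold (𝓡 d) (minSmoothness ℝ 2) M := by
      rw [minSmoothness_of_isRCLikeNormedField]
      exact IsManifold.of_le (n := ∞) two_le_infty
    exact (X.contMDiff x).mlieBracket_vectorField (m := ⊤) (n := ⊤) (Y.contMDiff x)
      (by simp [minSmoothness_of_isRCLikeNormedField])

/-- The space `C^∞(E)`, `E = ΠTM`, of all (inhomogeneous) exterior forms on `M`; the component `η k`
is the part of `η` of form degree `k` (it vanishes for `k > d`). -/
abbrev Forms (d : ℕ) (M : Type*) [TopologicalSpace M] [ChartedSpace (Euc d) M] :=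
  ∀ k : ℕ, DiffForm d M k

/-- The de Rham differential `d` on inhomogeneous forms. -/
def deRham : Module.End ℝ (Forms d M) where
  toFun η
    | 0 => 0
    | k + 1 => extD (η k)
  map_add' a b := by
    funext k
    cases k with
    | zero => exact (add_zero 0).symm
    | succ k => exact map_add extD (a k) (b k)
  map_smul' c a := by
    funext k
    cases k with
    | zero => exact (smul_zero c).symm
    | succ k => exact map_smul extD c (a k)

/-- The contraction `i_X` on inhomogeneous forms. -/
def iota (X : VField d M) : Module.End ℝ (Forms d M) where
  toFun η k := contractForm X (η (k + 1))
  map_add' _ _ := rfl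
  map_smul' _ _ := rfl

/-- The Lie derivative `L_X = [i_X, d] = i_X d + d i_X` on inhomogeneous forms. -/
def lieD (X : VField d M) : Module.End ℝ (Forms d M) := iota X * deRham + deRham * iota X

/-- The operator of left multiplication by the inhomogeneous form `η`. -/
def leftMul (η : Forms d M) : Module.End ℝ (Forms d M) where
  toFun ζ n := ∑ p : Fin (n + 1),
    wedgeForm (Nat.add_sub_of_le (Nat.lt_succ_iff.1 p.2)) (η p) (ζ (n - p))
  map_add' a b := by
    funext n
    simp [Finset.sum_add_distrib]
  map_smul' c a := by
    funext n
    simp [Finset.smul_sum]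

end Forms

/-! ### Parities and derived brackets -/

/-- The sign `(-1)^e` of a Grassmann parity `e`. -/
def sgn (e : ZMod 2) : ℝ := (-1) ^ e.val

/-- The sign `(-1)^{ε_{π,a}}` defined by
`a_{π(1)} ⊙ ⋯ ⊙ a_{π(n)} = (-1)^{ε_{π,a}} a_1 ⊙ ⋯ ⊙ a_n`
where `a_i` has parity `s i` and where interchanging neighbours `a`, `b` costs
`(-1)^{(ε_a + ε)(ε_b + ε)}`: there is one such factor for every inversion of `π`. -/
def koszulSign (ε : ZMod 2) {n : ℕ} (s : Fin n → ZMod 2) (π : Equiv.Perm (Fin n)) : ℝ :=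
  ∏ i : Fin n, ∏ j : Fin n,
    if i < j ∧ π j < π i then sgn ((s (π i) + ε) * (s (π j) + ε)) else 1

/-- The nested bracket `[[…[[Q, a_1], a_2], …], a_n]`. -/
def nestedBracket {A : Type*} (br : A → A → A) (Q : A) : (n : ℕ) → (Fin n → A) → A
  | 0, _ => Q
  | n + 1, a => br (nestedBracket br Q n (fun i => a i.castSucc)) (a (Fin.last n))

/-- The derived `n`-bracket
`Φ_Q^n(a_1, …, a_n) = (1/n!) ∑_π (-1)^{ε_{π,a}} [[…[Q, a_{π(1)}], …], a_{π(n)}]`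
of an element `Q` in a super vector space `A` with a bracket `br` of parity `ε`, where `par e a` is
the component of parity `e` of `a`. The formula with signs is the one for arguments of definite
parity; other arguments are split into their components of definite parity. -/
def derivedBracket {A : Type*} [AddCommGroup A] [Module ℝ A] (par : ZMod 2 → A → A)
    (br : A → A → A) (ε : ZMod 2) (Q : A) (n : ℕ) (a : Fin n → A) : A :=
  ((n.factorial : ℝ)⁻¹) • ∑ s : Fin n → ZMod 2, ∑ π : Equiv.Perm (Fin n),
    koszulSign ε s π • nestedBracket br Q n (fun i => par (s (π i)) (a (π i)))

/-! ### The operator representation: the Lie superalgebra `End(C^∞(E))` -/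

section Operators
variable {d : ℕ} {M : Type*} [TopologicalSpace M] [ChartedSpace (Euc d) M]

/-- The projection of a form to its part of Grassmann parity `e` (= form degree modulo 2). -/
def formParity (e : ZMod 2) : Module.End ℝ (Forms d M) where
  toFun η k := if (k : ZMod 2) = e then η k else 0
  map_add' a b := by
    funext k
    by_cases h : (k : ZMod 2) = e <;> simp [h]
  map_smul' c a := by
    funext k
    by_cases h : (k : ZMod 2) = e <;> simp [h]

/-- The part of parity `e` of an operator on forms. -/
def opParity (e : ZMod 2) (T : Module.End ℝ (Forms d M)) : Module.End ℝ (Forms d M) :=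
  ∑ f : ZMod 2, formParity (f + e) * T * formParity f

/-- The (super)commutator bracket, `[S, T] = ST - (-1)^{ε_S ε_T} TS` if `S` and `T` have definite
parities. -/
def superCommutator (S T : Module.End ℝ (Forms d M)) : Module.End ℝ (Forms d M) :=
  ∑ e : ZMod 2, ∑ f : ZMod 2,
    (opParity e S * opParity f T - sgn (e * f) • (opParity f T * opParity e S))

variable [IsManifold (𝓡 d) ∞ M]

/-- The derived brackets `Φ_D^n` of `D = d + H` in the (even) Lie superalgebra `End(C^∞(E))`. -/
def PhiD (H : Forms d M) (n : ℕ) (a : Fin n → Module.End ℝ (Forms d M)) :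
    Module.End ℝ (Forms d M) :=
  derivedBracket opParity superCommutator 0 (deRham + leftMul H) n a

end Operators

/-! ### Local superfunctions on `T^*E` and `ΠT^*E`

Over a coordinate patch with coordinates `x^i`, both `T^*E` and `ΠT^*E` have `d` even base
coordinates `x^i`, `d` even fibre coordinates (`P_i` for `T^*E`, `p_i` for `ΠT^*E`), the odd base
coordinates `c^i = dx^i` and `d` odd fibre coordinates (`b_i` for `T^*E`, `B_i` for `ΠT^*E`). -/

section SuperFunctions
variable {d : ℕ}

/-- The odd coordinates: `c^i` and `b_i` (resp. `c^i` and `B_i`), ordered as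
`c^1 < ⋯ < c^d < b_1 < ⋯ < b_d`. -/
abbrev OddGen (d : ℕ) : Type := Fin d ⊕ₗ Fin d

/-- The odd coordinate `c^i`. -/
def oc (i : Fin d) : OddGen d := toLex (Sum.inl i)

/-- The odd fibre coordinate `b_i` of `T^*E`, resp. `B_i` of `ΠT^*E`. -/
def ob (i : Fin d) : OddGen d := toLex (Sum.inr i)

/-- Superfunctions `F = ∑_I F_I(x, P) θ_I` with smooth coefficients `F_I` on the open set `V` of
values `(x, P)` of the even coordinates, where `θ_I` is the product in increasing order of the odd
coordinates in `I`. (The coefficients are extended by zero outside of `V`.) -/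
def SuperFun (V : TopologicalSpace.Opens (Euc d × Euc d)) :
    Submodule ℝ (Finset (OddGen d) → Euc d × Euc d → ℝ) where
  carrier := {F | ∀ I, ContDiffOn ℝ ∞ (F I) V ∧ ∀ z, z ∉ V → F I z = 0}
  zero_mem' _ := ⟨contDiffOn_const, fun _ _ => rfl⟩
  add_mem' ha hb I := ⟨(ha I).1.add (hb I).1, fun z hz => by
    simp [(ha I).2 z hz, (hb I).2 z hz]⟩
  smul_mem' c _ ha I := ⟨(ha I).1.const_smul c, fun z hz => by simp [(ha I).2 z hz]⟩

variable {V : TopologicalSpace.Opens (Euc d × Euc d)}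

open Classical in
/-- The superfunction on `V` with the given coefficients, smooth on `V`. -/
def SuperFun.ofCoeff (f : Finset (OddGen d) → Euc d × Euc d → ℝ)
    (hf : ∀ I, ContDiffOn ℝ ∞ (f I) V) : SuperFun V :=
  ⟨fun I z => if z ∈ V then f I z else 0, fun I => show _ ∧ _ from
    ⟨(hf I).congr fun _ hz => if_pos hz, fun _ hz => if_neg hz⟩⟩

namespace SuperFun

/-- The sign in `θ_I θ_J = ± θ_{I ∪ J}`, for disjoint `I` and `J`. -/
def prodSign (I J : Finset (OddGen d)) : ℝ :=
  (-1) ^ ((I ×ˢ J).filter fun p => p.2 < p.1).card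

/-- The product of superfunctions. -/
def mul (F G : SuperFun V) : SuperFun V :=
  ofCoeff (fun K z => ∑ I ∈ K.powerset, prodSign I (K \ I) * F.1 I z * G.1 (K \ I) z)
    fun K => ContDiffOn.sum fun I _ =>
      (contDiffOn_const.mul (F.2 I).1).mul (G.2 (K \ I)).1

/-- The left derivative `∂^l F / ∂θ^a` with respect to the odd coordinate `θ^a`. -/
def leftDeriv (a : OddGen d) (F : SuperFun V) : SuperFun V :=
  ofCoeff (fun J z => if a ∈ J then 0 else (-1) ^ (J.filter fun i => i < a).card * F.1 (insert a J) z)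
    fun J => by
      by_cases h : a ∈ J
      · simpa [h] using contDiffOn_const
      · simpa [h] using contDiffOn_const.mul (F.2 (insert a J)).1

/-- The right derivative `F ∂^r / ∂θ^a` with respect to the odd coordinate `θ^a`. -/
def rightDeriv (F : SuperFun V) (a : OddGen d) : SuperFun V :=
  ofCoeff (fun J z => if a ∈ J then 0 else (-1) ^ (J.filter fun i => a < i).card * F.1 (insert a J) z)
    fun J => by
      by_cases h : a ∈ J
      · simpa [h] using contDiffOn_const
      · simpa [h] using contDiffOn_const.mul (F.2 (insert a J)).1

/-- The derivative of the coefficients in the direction `v` of the space of even coordinates. -/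
def evenDeriv (v : Euc d × Euc d) (F : SuperFun V) : SuperFun V :=
  ofCoeff (fun I z => fderiv ℝ (F.1 I) z v) fun I =>
    ((F.2 I).1.fderiv_of_isOpen V.isOpen (by simp)).clm_apply contDiffOn_const

/-- `∂F / ∂x^i`. -/
def dx (i : Fin d) : SuperFun V → SuperFun V := evenDeriv (EuclideanSpace.single i 1, 0)

/-- `∂F / ∂P_i` on `T^*E`, resp. `∂F / ∂p_i` on `ΠT^*E`. -/
def dp (i : Fin d) : SuperFun V → SuperFun V := evenDeriv (0, EuclideanSpace.single i 1)

/-- The part of Grassmann parity `e` of a superfunction. -/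
def parity (e : ZMod 2) (F : SuperFun V) : SuperFun V :=
  ofCoeff (fun I z => if (I.card : ZMod 2) = e then F.1 I z else 0) fun I => by
    by_cases h : (I.card : ZMod 2) = e
    · simpa [h] using (F.2 I).1
    · simpa [h] using contDiffOn_const

/-- The canonical even Poisson bracket on `T^*E`, with `{P_i, x^j} = δ_i^j = -{x^j, P_i}`,
`{b_i, c^j} = δ_i^j = {c^j, b_i}` and all other brackets of coordinates zero:
`{F, G} = ∑_{A,B} (F ∂^r/∂z^A) {z^A, z^B} (∂^l/∂z^B G)`. -/
def poisson (F G : SuperFun V) : SuperFun V :=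
  ∑ i : Fin d, (mul (dp i F) (dx i G) - mul (dx i F) (dp i G)
    + mul (rightDeriv F (ob i)) (leftDeriv (oc i) G)
    + mul (rightDeriv F (oc i)) (leftDeriv (ob i) G))

/-- The canonical odd Poisson bracket (antibracket) on `ΠT^*E`, with
`(B_i, x^j) = δ_i^j = -(x^j, B_i)`, `(p_i, c^j) = δ_i^j = -(c^j, p_i)` and all other brackets of
coordinates zero: `(F, G) = ∑_{A,B} (F ∂^r/∂z^A) (z^A, z^B) (∂^l/∂z^B G)`. -/
def antibracket (F G : SuperFun V) : SuperFun V :=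
  ∑ i : Fin d, (mul (rightDeriv F (ob i)) (dx i G) - mul (dx i F) (leftDeriv (ob i) G)
    + mul (dp i F) (leftDeriv (oc i) G)
    - mul (rightDeriv F (oc i)) (dp i G))

end SuperFun

end SuperFunctions

/-! ### Vector fields, forms and the generators `Q`, `S` in a coordinate chart -/

section Charts
variable {d : ℕ} {M : Type*} [TopologicalSpace M] [ChartedSpace (Euc d) M]

/-- Smooth coordinate charts of `M`. -/
abbrev Chart (d : ℕ) (M : Type*) [TopologicalSpace M] [ChartedSpace (Euc d) M] := maxAtlas d M

/-- The values `(x, P)` of the even coordinates over the chart `φ`: `x` in the target of `φ`, and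
an arbitrary momentum `P`. -/
def evenDomain (φ : Chart d M) : TopologicalSpace.Opens (Euc d × Euc d) :=
  ⟨φ.1.target ×ˢ Set.univ, φ.1.open_target.prod isOpen_univ⟩

/-- The superfunctions on the part of `T^*E` (or of `ΠT^*E`) over the chart `φ`. -/
abbrev LocalFun (φ : Chart d M) := SuperFun (evenDomain φ)

/-- The set of indices `i` of the coordinates `c^i` in `I`. -/
def cPart (I : Finset (OddGen d)) : Finset (Fin d) := Finset.univ.filter fun i => oc i ∈ I

/-- The form `η` as a function of `x` and `c`:
`η = ∑_k ∑_{i_1 < ⋯ < i_k} η(∂_{i_1}, …, ∂_{i_k}) c^{i_1} ⋯ c^{i_k}`. -/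
def formFun (φ : Chart d M) (η : Forms d M) : LocalFun φ :=
  SuperFun.ofCoeff (fun I z =>
      if I = (cPart I).image oc then
        localForm φ.1 (η (cPart I).card).1 z.1
          (fun j => EuclideanSpace.single ((cPart I).orderEmbOfFin rfl j) 1)
      else 0)
    fun I => by
      by_cases h : I = (cPart I).image oc
      · simp only [if_pos h]
        exact (ContinuousAlternatingMap.apply ℝ (Euc d) ℝ
          (fun j => (EuclideanSpace.single ((cPart I).orderEmbOfFin rfl j) 1 : Euc d))).contDiff.comp_contDiffOn
          (((η (cPart I).card).2 φ.1 φ.2).comp contDiffOn_fst fun z hz => hz.1)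
      · simp only [if_neg h]
        exact contDiffOn_const

variable [IsManifold (𝓡 d) ∞ M]

theorem component_contDiffOn (φ : Chart d M) (X : VField d M) (i : Fin d) :
    ContDiffOn ℝ ∞ (fun z : Euc d × Euc d => localField φ.1 X z.1 i) (evenDomain φ) :=
  (EuclideanSpace.proj (𝕜 := ℝ) i).contDiff.comp_contDiffOn
    ((localField_contDiffOn φ.2 X).comp contDiffOn_fst fun _ hz => hz.1)

/-- The parity-inverted vector field `X̃ = X^i b_i` on `T^*E`. -/
def oddField (φ : Chart d M) (X : VField d M) : LocalFun φ :=
  SuperFun.ofCoeff (fun I z => ∑ i, if I = {ob i} then localField φ.1 X z.1 i else 0)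
    fun I => ContDiffOn.sum fun i _ => by
      by_cases h : I = {ob i}
      · simpa only [if_pos h] using component_contDiffOn φ X i
      · simpa only [if_neg h] using contDiffOn_const

/-- The vector field `X = X^i p_i` on `ΠT^*E`. -/
def evenField (φ : Chart d M) (X : VField d M) : LocalFun φ :=
  SuperFun.ofCoeff (fun I z => if I = ∅ then ∑ i, localField φ.1 X z.1 i * z.2 i else 0)
    fun I => by
      by_cases h : I = ∅
      · simp only [if_pos h]
        exact ContDiffOn.sum fun i _ => (component_contDiffOn φ X i).mul
          ((EuclideanSpace.proj (𝕜 := ℝ) i).contDiff.comp contDiff_snd).contDiffOn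
      · simpa only [if_neg h] using contDiffOn_const

/-- The generator `Q = c^i P_i + H` on `T^*E`. -/
def genQ (φ : Chart d M) (H : Forms d M) : LocalFun φ :=
  SuperFun.ofCoeff (fun I z => ∑ i, if I = {oc i} then z.2 i else 0)
    (fun I => ContDiffOn.sum fun i _ => by
      by_cases h : I = {oc i}
      · simp only [if_pos h]
        exact ((EuclideanSpace.proj (𝕜 := ℝ) i).contDiff.comp contDiff_snd).contDiffOn
      · simpa only [if_neg h] using contDiffOn_const) + formFun φ H

/-- The generator `S = c^i B_i + H` on `ΠT^*E`. -/
def genS (φ : Chart d M) (H : Forms d M) : LocalFun φ :=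
  SuperFun.ofCoeff (fun I _ => ∑ i, if I = {oc i, ob i} then 1 else 0)
    (fun _ => contDiffOn_const) + formFun φ H

/-- The derived brackets `Φ_Q^n` of `Q = c^i P_i + H` for the Poisson bracket on `T^*E`. -/
def PhiQ (φ : Chart d M) (H : Forms d M) (n : ℕ) (a : Fin n → LocalFun φ) : LocalFun φ :=
  derivedBracket SuperFun.parity SuperFun.poisson 0 (genQ φ H) n a

/-- The derived brackets `Φ_S^n` of `S = c^i B_i + H` for the antibracket on `ΠT^*E`. -/
def PhiS (φ : Chart d M) (H : Forms d M) (n : ℕ) (a : Fin n → LocalFun φ) : LocalFun φ :=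
  derivedBracket SuperFun.parity SuperFun.antibracket 1 (genS φ H) n a

end Charts

end CourantHierarchy
end

noncomputable section
namespace CourantHierarchy

/-! All three constructions realize one and the same calculus, and the brackets depend only on that
calculus. The structure `IsCartanModel` records what is needed: vector fields and forms embed in a
superspace with a bilinear bracket of parity ε, forms have zero brackets with each other, bracketing
with the image of `X` contracts forms up to sign, `Q` acts on forms as `d`, and `[Q, X]` acts on
forms as `L_X` and on vector fields as the Lie bracket plus the twist `i_X i_Y H`. Everything about
the derived brackets is proved once, in such a model.

In the parity shifted by ε, every vector field is odd, in each of the three cases. Choosing which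
argument is bracketed last expresses a symmetrized bracket of n + 1 arguments as a signed sum of
brackets of symmetrized n-brackets with one argument (`IsBilin.symBracket_succ`). For vector fields
alone, two of them give a vector field plus a form. A third removes the vector part, and from then
on only contractions of `H` remain (`symV_eq`). With a form η added (`symF_succ`), the summands in
which a vector field is last contract lower brackets of η, while the summand in which η is last is
the action on η of the pure vector bracket. That action is `L_X` for one vector field, contraction
with a Lie bracket for two, and zero for three or more, where the vector bracket is itself a form.
Hence the three-bracket is the only new datum and the higher brackets follow by contraction. In the
sign of each recursive step the parity of η and ε occur twice and cancel, so the three cases agree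
(`symF_eq`, `derivedBracket_form`). The explicit formula solves the recursion: a pair of indices
survives the removal of each of the other indices (`pairSum_succ`). Two forms annihilate a nested
bracket because the first turns it into a form and forms have zero brackets with each other.

It remains to verify the model axioms. For operators this is the Cartan calculus. Contraction is an
antiderivation by splitting the permutations in a wedge product according to the slot that receives
the contracted vector (`extContract_extMul`). Associativity and graded commutativity then follow by
induction on degree, since a form of positive degree is determined by its contractions. The Leibniz
rule and `i_{[X,Y]} = [L_X, i_Y]` are checked on local representatives. For the two phase spaces,
superfunctions are evaluated at points with values in a Grassmann algebra, where `emb` turns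
contraction into ∂/∂c and the exterior derivative into c^i ∂_i. The Hamiltonians generated by `Q`
and `S` then act by the coordinate formula `loc_lieD` for the Lie derivative. -/

/-! ### Permutations split by one of their values -/

/-- The permutation of `Fin (n + 1)` that sends `l` to `i` and acts as `π` on the remaining
indices. -/
def insertPerm {n : ℕ} (l i : Fin (n + 1)) (π : Equiv.Perm (Fin n)) : Equiv.Perm (Fin (n + 1)) :=
  (finSuccEquiv' l).trans ((Equiv.optionCongr π).trans (finSuccEquiv' i).symm)

@[simp] theorem insertPerm_self {n : ℕ} (l i : Fin (n + 1)) (π : Equiv.Perm (Fin n)) :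
    insertPerm l i π l = i := by
  simp [insertPerm]

@[simp] theorem insertPerm_succAbove {n : ℕ} (l i : Fin (n + 1)) (π : Equiv.Perm (Fin n))
    (j : Fin n) : insertPerm l i π (l.succAbove j) = i.succAbove (π j) := by
  simp [insertPerm]

theorem insertPerm_bijective_image {n : ℕ} (l : Fin (n + 1)) :
    Function.Bijective fun p : Fin (n + 1) × Equiv.Perm (Fin n) => insertPerm l p.1 p.2 := by
  rw [Fintype.bijective_iff_injective_and_card]
  refine ⟨?_, by simp [Fintype.card_perm, Nat.factorial_succ]⟩
  rintro ⟨i, π⟩ ⟨i', π'⟩ h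
  have hi : i = i' := by simpa using congrArg (fun σ => σ l) h
  subst hi
  refine Prod.ext rfl (Equiv.ext fun j => ?_)
  simpa using congrArg (fun σ => σ (l.succAbove j)) h

theorem insertPerm_bijective_preimage {n : ℕ} (i : Fin (n + 1)) :
    Function.Bijective fun p : Fin (n + 1) × Equiv.Perm (Fin n) => insertPerm p.1 i p.2 := by
  rw [Fintype.bijective_iff_injective_and_card]
  refine ⟨?_, by simp [Fintype.card_perm, Nat.factorial_succ]⟩
  rintro ⟨l, π⟩ ⟨l', π'⟩ h
  have hi : l = l' := by
    have h1 : insertPerm l i π l = insertPerm l' i π' l := by rw [show insertPerm l i π = _ from h]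
    refine (insertPerm l' i π').injective (h1.symm.trans ?_)
    rw [insertPerm_self, insertPerm_self]
  subst hi
  refine Prod.ext rfl (Equiv.ext fun j => ?_)
  simpa using congrArg (fun σ => σ (l.succAbove j)) h

/-- Used with `l` the last position, where the value of the permutation is the index of the
outermost argument of a nested bracket. -/
theorem sum_perm_image {n : ℕ} {A : Type*} [AddCommMonoid A] (l : Fin (n + 1))
    (f : Equiv.Perm (Fin (n + 1)) → A) :
    ∑ σ, f σ = ∑ i, ∑ π, f (insertPerm l i π) := by
  rw [← Fintype.sum_prod_type']
  exact ((insertPerm_bijective_image l).sum_comp f).symm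

/-- Used with `i = 0` for wedge products: the preimage of 0 is the slot that receives the contracted
vector. -/
theorem sum_perm_preimage {n : ℕ} {A : Type*} [AddCommMonoid A] (i : Fin (n + 1))
    (f : Equiv.Perm (Fin (n + 1)) → A) :
    ∑ σ, f σ = ∑ l, ∑ π, f (insertPerm l i π) := by
  rw [← Fintype.sum_prod_type']
  exact ((insertPerm_bijective_preimage i).sum_comp f).symm

/-- The permutation factors as the cycle that brings `l` to 0, of length l + 1 and sign (-1)^l,
followed by `π` on the nonzero indices. -/
theorem sign_insertPerm_zero {n : ℕ} (l : Fin (n + 1)) (π : Equiv.Perm (Fin n)) :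
    ((insertPerm l 0 π).sign : ℤ) = (-1) ^ (l : ℕ) * (π.sign : ℤ) := by
  have h : insertPerm l 0 π = Equiv.Perm.decomposeFin.symm (0, π) * l.cycleRange := by
    ext x
    refine Fin.succAboveCases l ?_ (fun j => ?_) x
    · rw [insertPerm_self, Equiv.Perm.mul_apply, Fin.cycleRange_self,
        Equiv.Perm.decomposeFin_symm_apply_zero]
    · rw [insertPerm_succAbove, Equiv.Perm.mul_apply, Fin.cycleRange_succAbove,
        Equiv.Perm.decomposeFin_symm_apply_succ]
      simp
  rw [h, Equiv.Perm.sign_mul, Fin.sign_cycleRange, Equiv.Perm.decomposeFin.symm_sign]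
  simp [mul_comm]

/-! ### Signs -/

theorem zmod2_cases (e : ZMod 2) : e = 0 ∨ e = 1 := by revert e; decide

@[simp] theorem sgn_zero : sgn 0 = 1 := by simp [sgn]

@[simp] theorem sgn_one : sgn 1 = -1 := by simp [sgn, ZMod.val_one]

theorem sgn_add (e f : ZMod 2) : sgn (e + f) = sgn e * sgn f := by
  rcases zmod2_cases e with rfl | rfl <;> rcases zmod2_cases f with rfl | rfl <;>
    simp [show (1 + 1 : ZMod 2) = 0 from rfl]

theorem sgn_natCast (n : ℕ) : sgn (n : ZMod 2) = (-1) ^ n := by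
  induction n with
  | zero => simp
  | succ n ih => rw [Nat.cast_succ, sgn_add, ih, sgn_one, pow_succ]

theorem sgn_mul_self (e : ZMod 2) : sgn e * sgn e = 1 := by
  rcases zmod2_cases e with rfl | rfl <;> simp

/-- The sign obtained by moving the `i`-th argument to the last place. -/
def moveSign (ε : ZMod 2) {n : ℕ} (s : Fin (n + 1) → ZMod 2) (i : Fin (n + 1)) : ℝ :=
  ∏ j : Fin n, if i < i.succAbove j then sgn ((s (i.succAbove j) + ε) * (s i + ε)) else 1

/-- An inversion either lies among the first n positions, where it is an inversion of `π`, or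
involves the last position. The last position carries `i`, so the inversions of the second kind
correspond to the indices larger than `i`. -/
theorem koszulSign_insertPerm (ε : ZMod 2) {n : ℕ} (s : Fin (n + 1) → ZMod 2) (i : Fin (n + 1))
    (π : Equiv.Perm (Fin n)) :
    koszulSign ε s (insertPerm (Fin.last n) i π) =
      moveSign ε s i * koszulSign ε (fun j => s (i.succAbove j)) π := by
  have hc (j : Fin n) : insertPerm (Fin.last n) i π j.castSucc = i.succAbove (π j) := by
    rw [← Fin.succAbove_last_apply, insertPerm_succAbove]
  have hl : insertPerm (Fin.last n) i π (Fin.last n) = i := insertPerm_self _ _ _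
  simp only [koszulSign, Fin.prod_univ_castSucc, hc, hl, Fin.castSucc_lt_castSucc_iff,
    Fin.castSucc_lt_last, true_and, lt_irrefl, false_and, if_false, mul_one,
    (Fin.strictMono_succAbove i).lt_iff_lt]
  rw [Finset.prod_mul_distrib]
  have h1 : ∀ j : Fin n, ¬ Fin.last n < j.castSucc := fun j => (Fin.castSucc_lt_last j).not_gt
  simp only [h1, false_and, if_false, Finset.prod_const_one, mul_one]
  refine (mul_comm _ _).trans ?_
  congr 1
  exact Equiv.prod_comp π fun j =>
    if i < i.succAbove j then sgn ((s (i.succAbove j) + ε) * (s i + ε)) else 1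

theorem moveSign_last (ε : ZMod 2) {n : ℕ} (s : Fin (n + 1) → ZMod 2) :
    moveSign ε s (Fin.last n) = 1 := by
  refine Finset.prod_eq_one fun j _ => if_neg ?_
  exact (Fin.le_last _).not_gt

theorem prod_ite_lt_succAbove {n : ℕ} (i : Fin (n + 1)) (c : ℝ) :
    (∏ j : Fin n, if i < i.succAbove j then c else 1) = c ^ (n - (i : ℕ)) := by
  rw [Finset.prod_ite, Finset.prod_const, Finset.prod_const_one, mul_one]
  congr 1
  have : (Finset.univ.filter fun j : Fin n => i < i.succAbove j) =
      Finset.univ.filter fun j : Fin n => (i : ℕ) ≤ j := by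
    ext j
    simp [Fin.lt_succAbove_iff_le_castSucc, Fin.le_def]
  rw [this, ← Finset.card_map Fin.valEmbedding, ← Nat.card_Ico]
  congr 1
  ext k
  simp only [Finset.mem_map, Finset.mem_filter, Finset.mem_univ, true_and, Fin.valEmbedding_apply,
    Finset.mem_Ico]
  exact ⟨by rintro ⟨a, ha, rfl⟩; exact ⟨ha, a.2⟩, fun h => ⟨⟨k, h.2⟩, h.1, rfl⟩⟩

/-! ### Symmetrized nested brackets -/

section SymBracket
variable {A : Type*} [AddCommGroup A] [Module ℝ A] {par : ZMod 2 → A → A}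
  {br : A → A → A} {ε : ZMod 2} {Q : A}

/-- The sum over all permutations that defines the derived bracket, for the components of parities
`s i` of the arguments `a i`. -/
def symBracket (par : ZMod 2 → A → A) (br : A → A → A) (ε : ZMod 2) (Q : A) (n : ℕ)
    (s : Fin n → ZMod 2) (a : Fin n → A) : A :=
  ∑ π : Equiv.Perm (Fin n),
    koszulSign ε s π • nestedBracket br Q n (fun i => par (s (π i)) (a (π i)))

theorem derivedBracket_eq (n : ℕ) (a : Fin n → A) :
    derivedBracket par br ε Q n a =
      ((n.factorial : ℝ)⁻¹) • ∑ s : Fin n → ZMod 2, symBracket par br ε Q n s a := rfl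

/-- Bilinearity of a bracket. -/
structure IsBilin (br : A → A → A) : Prop where
  add_left : ∀ a b c, br (a + b) c = br a c + br b c
  smul_left : ∀ (r : ℝ) a c, br (r • a) c = r • br a c
  add_right : ∀ a b c, br a (b + c) = br a b + br a c
  smul_right : ∀ (r : ℝ) a c, br a (r • c) = r • br a c

namespace IsBilin

theorem zero_left (h : IsBilin br) (c : A) : br 0 c = 0 := by simpa using h.smul_left 0 0 c

theorem zero_right (h : IsBilin br) (c : A) : br c 0 = 0 := by simpa using h.smul_right 0 c 0

theorem sum_left (h : IsBilin br) {ι : Type*} (s : Finset ι) (f : ι → A) (c : A) :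
    br (∑ i ∈ s, f i) c = ∑ i ∈ s, br (f i) c := by
  classical
  induction s using Finset.induction_on with
  | empty => simpa using h.zero_left c
  | insert i s hi ih => rw [Finset.sum_insert hi, Finset.sum_insert hi, h.add_left, ih]

theorem neg_left (h : IsBilin br) (a c : A) : br (-a) c = -br a c := by
  simpa using h.smul_left (-1) a c

theorem sub_left (h : IsBilin br) (a b c : A) : br (a - b) c = br a c - br b c := by
  rw [sub_eq_add_neg, h.add_left, h.neg_left, sub_eq_add_neg]

theorem nestedBracket_eq_zero (h : IsBilin br) {n : ℕ} {a : Fin n → A} (i : Fin n) (hi : a i = 0) :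
    nestedBracket br Q n a = 0 := by
  induction n with
  | zero => exact i.elim0
  | succ n ih =>
    rw [nestedBracket]
    induction i using Fin.lastCases with
    | last => rw [hi, h.zero_right]
    | cast j => rw [ih j hi, h.zero_left]

/-- Discards the parity patterns in which a homogeneous argument is projected to the wrong parity.
-/
theorem symBracket_eq_zero (h : IsBilin br) {n : ℕ} {s : Fin n → ZMod 2} {a : Fin n → A} (i : Fin n)
    (hi : par (s i) (a i) = 0) : symBracket par br ε Q n s a = 0 := by
  refine Finset.sum_eq_zero fun π _ => ?_
  rw [h.nestedBracket_eq_zero (π.symm i) (by simpa using hi), smul_zero]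

/-- The permutations are grouped by the argument that is bracketed last. Every computation of a
derived bracket below is an induction along this recursion. -/
theorem symBracket_succ (h : IsBilin br) {n : ℕ} (s : Fin (n + 1) → ZMod 2) (a : Fin (n + 1) → A) :
    symBracket par br ε Q (n + 1) s a = ∑ i, moveSign ε s i •
      br (symBracket par br ε Q n (fun j => s (i.succAbove j)) fun j => a (i.succAbove j))
        (par (s i) (a i)) := by
  rw [symBracket, sum_perm_image (Fin.last n)]
  refine Finset.sum_congr rfl fun i _ => ?_
  rw [symBracket, h.sum_left, Finset.smul_sum]
  refine Finset.sum_congr rfl fun π _ => ?_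
  have hc (j : Fin n) : insertPerm (Fin.last n) i π j.castSucc = i.succAbove (π j) := by
    rw [← Fin.succAbove_last_apply, insertPerm_succAbove]
  rw [koszulSign_insertPerm, h.smul_left, nestedBracket, smul_smul]
  simp only [hc, insertPerm_self]

end IsBilin

@[simp] theorem symBracket_zero (s : Fin 0 → ZMod 2) (a : Fin 0 → A) :
    symBracket par br ε Q 0 s a = Q := by
  simp [symBracket, koszulSign, nestedBracket]

end SymBracket

/-! ### Parity of forms -/

section FormParity
variable {d : ℕ} {M : Type*} [TopologicalSpace M] [ChartedSpace (Euc d) M]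

theorem formParity_apply (e : ZMod 2) (η : Forms d M) (k : ℕ) :
    formParity e η k = if (k : ZMod 2) = e then η k else 0 := rfl

theorem sum_formParity (η : Forms d M) : ∑ e, formParity e η = η := by
  funext k
  rw [Finset.sum_apply]
  simp [formParity_apply]

theorem formParity_formParity (e f : ZMod 2) (η : Forms d M) :
    formParity e (formParity f η) = if e = f then formParity f η else 0 := by
  funext k
  split_ifs with h
  · subst h
    rw [formParity_apply]
    split_ifs with hk
    · rfl
    · rw [formParity_apply, if_neg hk]
  · by_cases hk : (k : ZMod 2) = f
    · simp [formParity_apply, hk, Ne.symm h]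
    · simp [formParity_apply, hk]

theorem formParity_self (e : ZMod 2) (η : Forms d M) :
    formParity e (formParity e η) = formParity e η := by
  rw [formParity_formParity, if_pos rfl]

variable [IsManifold (𝓡 d) ∞ M]

theorem zmod2_succ_eq_iff (k : ℕ) (e : ZMod 2) : ((k + 1 : ℕ) : ZMod 2) = e + 1 ↔ (k : ZMod 2) = e := by
  rw [Nat.cast_succ]; exact add_left_inj _

theorem zmod2_add_one_add_one (e : ZMod 2) : e + 1 + 1 = e := by revert e; decide

theorem formParity_iota (e : ZMod 2) (X : VField d M) (η : Forms d M) :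
    formParity e (iota X η) = iota X (formParity (e + 1) η) := by
  funext k
  change (if (k : ZMod 2) = e then contractForm X (η (k + 1)) else 0) =
    contractForm X (if ((k + 1 : ℕ) : ZMod 2) = e + 1 then η (k + 1) else 0)
  simp only [zmod2_succ_eq_iff]
  split_ifs <;> simp

theorem deRham_apply_succ (η : Forms d M) (k : ℕ) : deRham η (k + 1) = extD (η k) := rfl

theorem deRham_apply_zero (η : Forms d M) : deRham η 0 = 0 := rfl

theorem formParity_deRham (e : ZMod 2) (η : Forms d M) :
    formParity (e + 1) (deRham η) = deRham (formParity e η) := by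
  funext k
  cases k with
  | zero => simp [formParity_apply, deRham_apply_zero]
  | succ k =>
    rw [formParity_apply, deRham_apply_succ, deRham_apply_succ, formParity_apply]
    simp only [zmod2_succ_eq_iff]
    split_ifs <;> simp

theorem iota_formParity_fixed {e : ZMod 2} (X : VField d M) {η : Forms d M}
    (h : formParity e η = η) : formParity (e + 1) (iota X η) = iota X η := by
  rw [formParity_iota, zmod2_add_one_add_one, h]

theorem deRham_formParity_fixed {e : ZMod 2} {η : Forms d M}
    (h : formParity e η = η) : formParity (e + 1) (deRham η) = deRham η := by
  rw [formParity_deRham, h]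

theorem lieD_apply (X : VField d M) (η : Forms d M) :
    lieD X η = iota X (deRham η) + deRham (iota X η) := rfl

theorem lieD_formParity_fixed {e : ZMod 2} (X : VField d M) {η : Forms d M}
    (h : formParity e η = η) : formParity e (lieD X η) = lieD X η := by
  have h1 := iota_formParity_fixed X (deRham_formParity_fixed h)
  have h2 := deRham_formParity_fixed (iota_formParity_fixed X h)
  rw [zmod2_add_one_add_one] at h1 h2
  rw [lieD_apply, map_add, h1, h2]

end FormParity

/-! ### The brackets in terms of the Cartan calculus -/

section Model
variable {d : ℕ} {M : Type*} [TopologicalSpace M] [ChartedSpace (Euc d) M]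
  [IsManifold (𝓡 d) ∞ M]

/-- The unsymmetrized three-bracket
`i_X i_Y d η + i_X L_Y η + i_{[X,Y]} η`, antisymmetrized and divided by `6`. -/
def threeBracket (X Y : VField d M) : Module.End ℝ (Forms d M) :=
  (1 / 6 : ℝ) • (iota X * (iota Y * deRham + lieD Y) - iota Y * (iota X * deRham + lieD X)
    + (iota (vbracket X Y) - iota (vbracket Y X)))

/-- The bracket of `n` vector fields and a form, determined recursively by the bracket of two vector
fields and a form. -/
def hier : (n : ℕ) → (Fin n → VField d M) → Module.End ℝ (Forms d M)
  | 0, _ => 0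
  | 1, _ => 0
  | 2, X => threeBracket (X 0) (X 1)
  | n + 3, X => (1 / ((n : ℝ) + 4)) • ∑ i : Fin (n + 3), (-1 : ℝ) ^ (i : ℕ) •
      (iota (X i) * hier (n + 2) (fun k => X (i.succAbove k)))

variable {A : Type*} [AddCommGroup A] [Module ℝ A]

/-- A realization of the Cartan calculus, twisted by the form `H`, by the adjoint action of `Q` in a
super vector space with a bilinear bracket of parity `ε`: vector fields enter through `v` and forms
through `m`. -/
structure IsCartanModel (H : Forms d M) (ε : ZMod 2) (par : ZMod 2 → A → A) (br : A → A → A)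
    (Q : A) (v : VField d M → A) (m : Forms d M →ₗ[ℝ] A) : Prop where
  bilin : IsBilin br
  parity_H : formParity (1 + ε) H = H
  v_zero : v 0 = 0
  par_m : ∀ e η, par e (m η) = m (formParity e η)
  par_v : ∀ e X, par e (v X) = if e = 1 + ε then v X else 0
  br_m_m : ∀ η ζ, br (m η) (m ζ) = 0
  br_m_v : ∀ (e : ZMod 2) (η : Forms d M) (X : VField d M), formParity e η = η →
    br (m η) (v X) = -sgn (e + ε) • m (iota X η)
  br_Q_m : ∀ η, br Q (m η) = m (deRham η)
  br_Q_v_m : ∀ X η, br (br Q (v X)) (m η) = m (lieD X η)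
  br_Q_v_v : ∀ X Y, br (br Q (v X)) (v Y) = v (vbracket X Y) + m (iota X (iota Y H))
  br_v_m : ∀ X η, br (v X) (m η) = m (iota X η)
  br_v_v : ∀ X Y, br (v X) (v Y) = 0

end Model

/-! ### Ordered products of anticommuting elements. -/

section Contractions
variable {R : Type*} [Ring R] [Module ℝ R] [SMulCommClass ℝ R R]

/-- A factor of a product of anticommuting elements can be moved to the front. -/
theorem prod_map_eq_mul_prod_erase {n : ℕ} (f : Fin n → R)
    (hf : ∀ i j, f i * f j = -(f j * f i)) {L : List (Fin n)} (hL : L.Pairwise (· < ·))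
    {l : Fin n} (hl : l ∈ L) :
    (L.map f).prod = (-1 : ℝ) ^ (L.filter (· < l)).length • (f l * ((L.erase l).map f).prod) := by
  induction L with
  | nil => simp at hl
  | cons a L ih =>
    rw [List.pairwise_cons] at hL
    by_cases h : a = l
    · subst h
      have : (a :: L).filter (· < a) = [] := by
        rw [List.filter_eq_nil_iff]
        intro b hb
        rcases List.mem_cons.1 hb with rfl | hb
        · simp
        · simpa using (hL.1 b hb).le
      rw [this, List.erase_cons_head]
      simp
    · have hlL : l ∈ L := by simpa [Ne.symm h] using hl
      rw [List.erase_cons_tail (by simpa using h), List.filter_cons_of_pos (by simpa using hL.1 l hlL),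
        List.length_cons, List.map_cons, List.prod_cons, ih hL.2 hlL, List.map_cons, List.prod_cons,
        mul_smul_comm, ← mul_assoc, hf a l, pow_succ, mul_smul, neg_one_smul]
      simp [mul_assoc]

theorem pairwise_finRange_filter {n : ℕ} (p : Fin n → Bool) :
    ((List.finRange n).filter p).Pairwise (· < ·) :=
  (List.pairwise_lt_finRange n).sublist List.filter_sublist

/-- Both lists are strictly increasing and have the same members. Deleting an index becomes
reindexing by `succAbove`, the form in which the recursion omits a vector field. -/
theorem finRange_filter_erase {n : ℕ} (p : Fin (n + 1) → Bool) (l : Fin (n + 1)) :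
    ((List.finRange (n + 1)).filter p).erase l =
      ((List.finRange n).filter fun k => p (l.succAbove k)).map l.succAbove := by
  have h1 : (((List.finRange (n + 1)).filter p).erase l).Pairwise (· < ·) :=
    (pairwise_finRange_filter p).sublist List.erase_sublist
  have h2 : (((List.finRange n).filter fun k => p (l.succAbove k)).map l.succAbove).Pairwise
      (· < ·) := by
    rw [List.pairwise_map]
    exact (pairwise_finRange_filter _).imp fun h => (Fin.strictMono_succAbove l) h
  refine List.Pairwise.eq_of_mem_iff h1 h2 fun a => ?_
  rw [List.Nodup.mem_erase_iff ((List.nodup_finRange _).filter _)]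
  simp only [List.mem_filter, List.mem_finRange, true_and, List.mem_map]
  constructor
  · rintro ⟨h, hp⟩
    obtain ⟨k, rfl⟩ := Fin.exists_succAbove_eq h
    exact ⟨k, hp, rfl⟩
  · rintro ⟨k, hp, rfl⟩
    exact ⟨Fin.succAbove_ne _ _, hp⟩

theorem prod_finRange_filter_eq {n : ℕ} (f : Fin (n + 1) → R)
    (hf : ∀ i j, f i * f j = -(f j * f i)) (p : Fin (n + 1) → Bool) {l : Fin (n + 1)}
    (hl : p l = true) :
    (((List.finRange (n + 1)).filter p).map f).prod =
      (-1 : ℝ) ^ (Finset.univ.filter fun k => p k = true ∧ k < l).card •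
        (f l * (((List.finRange n).filter fun k => p (l.succAbove k)).map
          fun k => f (l.succAbove k)).prod) := by
  rw [prod_map_eq_mul_prod_erase f hf (pairwise_finRange_filter p) (l := l) (by simpa using hl),
    finRange_filter_erase, List.map_map, List.filter_filter]
  congr 2
  rw [← List.toFinset_card_of_nodup ((List.nodup_finRange _).filter _)]
  congr 1
  ext k
  simp [and_comm]

theorem prod_ofFn_eq {n : ℕ} (f : Fin (n + 1) → R) (hf : ∀ i j, f i * f j = -(f j * f i))
    (l : Fin (n + 1)) :
    (List.ofFn f).prod = (-1 : ℝ) ^ (l : ℕ) • (f l * (List.ofFn fun k => f (l.succAbove k)).prod) := by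
  have h := prod_finRange_filter_eq f hf (fun _ => true) (l := l) rfl
  simp only [List.filter_true, true_and] at h
  have hc : (Finset.univ.filter fun k => k < l).card = (l : ℕ) := by
    rw [← Fin.card_Iio l]
    congr 1
    ext k
    simp
  rw [List.ofFn_eq_map, h, List.ofFn_eq_map, hc]

end Contractions

/-! ### Koszul signs for vector fields, possibly followed by one form. -/

theorem zmod2_add_add_self (e f : ZMod 2) : e + f + f = e := by revert e f; decide

/-- A vector field has parity 1 + ε, hence shifted parity 1 whatever ε is. Each of the n - i
interchanges therefore costs -1. -/
theorem moveSign_const (ε : ZMod 2) {n : ℕ} (i : Fin (n + 1)) :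
    moveSign ε (fun _ => 1 + ε) i = (-1) ^ (n - (i : ℕ)) := by
  rw [← prod_ite_lt_succAbove, moveSign]
  simp [zmod2_add_add_self]

theorem snoc_castSucc_succAbove {n : ℕ} {B : Type*} (f : Fin (n + 1) → B) (b : B) (i : Fin (n + 1)) :
    (fun j => (Fin.snoc f b : Fin (n + 2) → B) (i.castSucc.succAbove j)) =
      (Fin.snoc (fun k => f (i.succAbove k)) b : Fin (n + 1) → B) := by
  funext j
  induction j using Fin.lastCases with
  | last => rw [Fin.succAbove_ne_last_last (Fin.castSucc_lt_last i).ne, Fin.snoc_last, Fin.snoc_last]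
  | cast j => rw [Fin.castSucc_succAbove_castSucc, Fin.snoc_castSucc, Fin.snoc_castSucc]

theorem snoc_last_succAbove {n : ℕ} {B : Type*} (f : Fin n → B) (b : B) :
    (fun j => (Fin.snoc f b : Fin (n + 1) → B) ((Fin.last n).succAbove j)) = f := by
  funext j
  rw [Fin.succAbove_last_apply, Fin.snoc_castSucc]

/-- Besides the n - i vector fields, the argument passes the form in the last slot, at the cost of
the shifted parity of that form. -/
theorem moveSign_snoc_const (ε e : ZMod 2) {n : ℕ} (i : Fin (n + 1)) :
    moveSign ε (Fin.snoc (fun _ => 1 + ε) e : Fin (n + 2) → ZMod 2) i.castSucc =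
      (-1) ^ (n - (i : ℕ)) * sgn (e + ε) := by
  have h (j : Fin (n + 1)) : (Fin.snoc (fun _ => 1 + ε) e : Fin (n + 2) → ZMod 2)
      (i.castSucc.succAbove j) = (Fin.snoc (fun _ => 1 + ε) e : Fin (n + 1) → ZMod 2) j :=
    congrFun (snoc_castSucc_succAbove (fun _ : Fin (n + 1) => 1 + ε) e i) j
  simp only [moveSign, h]
  rw [Fin.prod_univ_castSucc, ← prod_ite_lt_succAbove]
  have hl : i.castSucc.succAbove (Fin.last n) = Fin.last (n + 1) :=
    Fin.succAbove_ne_last_last (Fin.castSucc_lt_last i).ne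
  simp [hl, Fin.castSucc_lt_last, zmod2_add_add_self]

/-! ### Products of contractions of differential forms. -/

section Forms
variable {d : ℕ} {M : Type*} [TopologicalSpace M] [ChartedSpace (Euc d) M]
  [IsManifold (𝓡 d) ∞ M]

theorem contract_contract {V : Type*} [AddCommGroup V] [Module ℝ V] [TopologicalSpace V] {k : ℕ}
    (X Y : V) (α : V [⋀^Fin (k + 2)]→L[ℝ] ℝ) :
    contract X (contract Y α) = -contract Y (contract X α) := by
  ext v
  rw [ContinuousAlternatingMap.neg_apply, contract_apply, contract_apply, contract_apply,
    contract_apply]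
  have h := α.toAlternatingMap.map_swap (Matrix.vecCons X (Matrix.vecCons Y v))
    (i := 0) (j := 1) (by simp)
  refine Eq.trans (congrArg α ?_) h
  funext i
  refine Fin.cases ?_ (fun i => Fin.cases ?_ (fun i => ?_) i) i
  · simp
  · simp
  · simp only [Function.comp_apply, Matrix.cons_val_succ]
    rw [Equiv.swap_apply_of_ne_of_ne]
    · simp
    · exact Fin.succ_ne_zero _
    · intro h; exact Fin.succ_ne_zero _ (Fin.succ_injective _ h)

theorem iota_mul_iota (X Y : VField d M) : iota X * iota Y = -(iota Y * iota X) := by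
  refine LinearMap.ext fun η => funext fun k => Subtype.ext (funext fun x => ?_)
  exact contract_contract (X x) (Y x) ((η (k + 2)).1 x)

theorem iota_iota (X Y : VField d M) (η : Forms d M) :
    iota X (iota Y η) = -iota Y (iota X η) := LinearMap.congr_fun (iota_mul_iota X Y) η

theorem iota_zero : iota (0 : VField d M) = 0 := by
  refine LinearMap.ext fun η => funext fun k => Subtype.ext (funext fun x => ?_)
  exact map_zero (contractLin.flip ((η (k + 1)).1 x))

/-- The product `i_{X_1} ⋯ i_{X_n}`. -/
abbrev iotaProd {n : ℕ} (X : Fin n → VField d M) : Module.End ℝ (Forms d M) :=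
  (List.ofFn fun i => iota (X i)).prod

theorem iotaProd_eq {n : ℕ} (X : Fin (n + 1) → VField d M) (i : Fin (n + 1)) (η : Forms d M) :
    iota (X i) (iotaProd (fun k => X (i.succAbove k)) η) = (-1 : ℝ) ^ (i : ℕ) • iotaProd X η := by
  have h : iotaProd X = _ :=
    prod_ofFn_eq (fun i => iota (X i)) (fun i j => iota_mul_iota _ _) i
  rw [h, LinearMap.smul_apply, smul_smul, ← mul_pow]
  simp

theorem iotaProd_formParity_fixed {n : ℕ} (X : Fin n → VField d M) {e : ZMod 2} {η : Forms d M}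
    (h : formParity e η = η) : formParity (e + n) (iotaProd X η) = iotaProd X η := by
  induction n with
  | zero => rw [Nat.cast_zero, add_zero, iotaProd, List.ofFn_zero, List.prod_nil, Module.End.one_apply, h]
  | succ n ih =>
    rw [iotaProd, List.ofFn_succ, List.prod_cons, Module.End.mul_apply, Nat.cast_succ, ← add_assoc]
    exact iota_formParity_fixed _ (ih _)

end Forms

/-! ### Symmetrized brackets in a Cartan model. -/

namespace IsCartanModel
variable {d : ℕ} {M : Type*} [TopologicalSpace M] [ChartedSpace (Euc d) M]
  [IsManifold (𝓡 d) ∞ M] {A : Type*} [AddCommGroup A] [Module ℝ A]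
  {H : Forms d M} {ε : ZMod 2} {par : ZMod 2 → A → A} {br : A → A → A}
  {Q : A} {v : VField d M → A} {m : Forms d M →ₗ[ℝ] A}

theorem par_v_self (h : IsCartanModel H ε par br Q v m) (X : VField d M) :
    par (1 + ε) (v X) = v X := by rw [h.par_v, if_pos rfl]

/-- The symmetrized bracket of vector fields only. -/
abbrev symV (ε : ZMod 2) (par : ZMod 2 → A → A) (br : A → A → A)
    (Q : A) (v : VField d M → A) (n : ℕ) (X : Fin n → VField d M) : A :=
  symBracket par br ε Q n (fun _ => 1 + ε) (fun i => v (X i))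

theorem symV_succ (h : IsCartanModel H ε par br Q v m) {n : ℕ} (X : Fin (n + 1) → VField d M) :
    symV ε par br Q v (n + 1) X = ∑ i : Fin (n + 1), (-1 : ℝ) ^ (n - (i : ℕ)) •
      br (symV ε par br Q v n fun k => X (i.succAbove k)) (v (X i)) := by
  rw [symV, h.bilin.symBracket_succ]
  simp only [moveSign_const, h.par_v_self]

theorem symV_one (h : IsCartanModel H ε par br Q v m) (X : Fin 1 → VField d M) :
    symV ε par br Q v 1 X = br Q (v (X 0)) := by
  rw [h.symV_succ]
  simp [symV]

/-- The two orders enter with opposite signs. Contractions anticommute, so the twist terms add up to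
the factor 2, while the two Lie brackets are kept without using their antisymmetry. -/
theorem symV_two (h : IsCartanModel H ε par br Q v m) (X : Fin 2 → VField d M) :
    symV ε par br Q v 2 X = v (vbracket (X 0) (X 1)) - v (vbracket (X 1) (X 0)) +
      (2 : ℝ) • m (iota (X 0) (iota (X 1) H)) := by
  rw [h.symV_succ, Fin.sum_univ_two, h.symV_one, h.symV_one]
  have h1 : (0 : Fin 2).succAbove 0 = 1 := rfl
  have h2 : (1 : Fin 2).succAbove 0 = 0 := rfl
  rw [h1, h2, h.br_Q_v_v, h.br_Q_v_v, iota_iota (X 1) (X 0), map_neg]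
  simp only [Fin.val_zero, Fin.val_one, tsub_zero, pow_one, tsub_self, pow_zero, two_smul]
  module

/-- The twist by `H` is a form and has zero bracket with η, so the result does not depend on `H`. -/
theorem br_symV_two_m (h : IsCartanModel H ε par br Q v m) (X : Fin 2 → VField d M)
    (η : Forms d M) :
    br (symV ε par br Q v 2 X) (m η) =
      m (iota (vbracket (X 0) (X 1)) η - iota (vbracket (X 1) (X 0)) η) := by
  rw [h.symV_two, h.bilin.add_left, h.bilin.sub_left, h.bilin.smul_left, h.br_v_m, h.br_v_m,
    h.br_m_m, smul_zero, add_zero, map_sub]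

/-- The symmetrized bracket of at least three vector fields. -/
theorem symV_eq (h : IsCartanModel H ε par br Q v m) {n : ℕ} (hn : 3 ≤ n)
    (X : Fin n → VField d M) :
    symV ε par br Q v n X = (n.factorial : ℝ) • m (iotaProd X H) := by
  induction n, hn using Nat.le_induction with
  | base =>
    -- The vector parts vanish because vector fields have zero brackets with each other. The form
    -- `i_a i_b H` has the parity 1 + ε of `H`, hence odd shifted parity, so the sign in `br_m_v` is
    -- +1.
    have hp (a b c : VField d M) : br (v (vbracket a b) - v (vbracket b a) +
        (2 : ℝ) • m (iota a (iota b H))) (v c) = (2 : ℝ) • m (iota c (iota a (iota b H))) := by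
      rw [h.bilin.add_left, h.bilin.sub_left, h.bilin.smul_left, h.br_v_v, h.br_v_v,
        h.br_m_v (1 + ε + 1 + 1) _ _
          (iota_formParity_fixed a (iota_formParity_fixed b h.parity_H)),
        zmod2_add_one_add_one, zmod2_add_add_self]
      simp
    rw [h.symV_succ]
    simp only [h.symV_two, hp]
    have hi (i : Fin 3) : iota (X i) (iota (X (i.succAbove 0)) (iota (X (i.succAbove 1)) H)) =
        (-1 : ℝ) ^ (i : ℕ) • iotaProd X H := by
      rw [← iotaProd_eq X i H]
      simp [iotaProd, List.ofFn_succ]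
    simp only [hi, map_smul, smul_smul]
    rw [← Finset.sum_smul]
    congr 1
    simp [Fin.sum_univ_three, Nat.factorial]
    norm_num
  | succ n hn ih =>
    rw [h.symV_succ]
    -- All n + 1 summands coincide. The signs (-1)^(n-i) from moving the argument, (-1)^n from the
    -- bracket and (-1)^i from reordering the contractions multiply to 1, and the number of summands
    -- turns n! into (n + 1)!.
    have hb (i : Fin (n + 1)) : (-1 : ℝ) ^ (n - (i : ℕ)) •
        br (symV ε par br Q v n fun k => X (i.succAbove k)) (v (X i)) =
        (n.factorial : ℝ) • m (iotaProd X H) := by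
      rw [ih, h.bilin.smul_left, h.br_m_v _ _ _ (iotaProd_formParity_fixed _ h.parity_H),
        iotaProd_eq, map_smul, smul_smul, smul_smul, smul_smul]
      congr 1
      rw [show 1 + ε + (n : ZMod 2) + ε = ((n + 1 : ℕ) : ZMod 2) by
        push_cast; rw [← zmod2_add_add_self ((n : ZMod 2) + 1) ε]; ring, sgn_natCast]
      have h3 : (-1 : ℝ) ^ (n - (i : ℕ)) * (-1) ^ (i : ℕ) = (-1) ^ n := by
        rw [← pow_add, Nat.sub_add_cancel (Nat.lt_succ_iff.1 i.2)]
      have h4 : (-1 : ℝ) ^ n * (-1) ^ n = 1 := by rw [← mul_pow]; simp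
      calc _ = ((-1 : ℝ) ^ (n - (i : ℕ)) * (-1) ^ (i : ℕ)) * (-1) ^ n * n.factorial := by ring
        _ = _ := by rw [h3, h4, one_mul]
    rw [Finset.sum_congr rfl fun i _ => hb i, Finset.sum_const, Finset.card_univ, Fintype.card_fin,
      ← Nat.cast_smul_eq_nsmul ℝ, smul_smul, Nat.factorial_succ, Nat.cast_mul]

/-- Vector fields are homogeneous of parity 1 + ε, so a single parity pattern contributes, and the
factorial in `symV_eq` cancels the normalization. -/
theorem derivedBracket_vectors (h : IsCartanModel H ε par br Q v m) {n : ℕ} (hn : 3 ≤ n)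
    (X : Fin n → VField d M) :
    derivedBracket par br ε Q n (fun i => v (X i)) = m (iotaProd X H) := by
  rw [derivedBracket_eq, Finset.sum_eq_single fun _ => 1 + ε]
  · have := h.symV_eq hn X
    rw [symV] at this
    rw [this, smul_smul, inv_mul_cancel₀ (by exact_mod_cast n.factorial_ne_zero), one_smul]
  · intro s _ hs
    obtain ⟨i, hi⟩ := Function.ne_iff.1 hs
    exact h.bilin.symBracket_eq_zero i (by rw [h.par_v, if_neg hi])
  · simp

/-- The symmetrized bracket of vector fields and a form of parity `e`. -/
abbrev symF (ε : ZMod 2) (par : ZMod 2 → A → A) (br : A → A → A)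
    (Q : A) (v : VField d M → A) (m : Forms d M →ₗ[ℝ] A) (n : ℕ) (X : Fin n → VField d M)
    (e : ZMod 2) (η : Forms d M) : A :=
  symBracket par br ε Q (n + 1) (Fin.snoc (fun _ => 1 + ε) e : Fin (n + 1) → ZMod 2)
    (Fin.snoc (fun i => v (X i)) (m η) : Fin (n + 1) → A)

theorem symF_zero (h : IsCartanModel H ε par br Q v m) (X : Fin 0 → VField d M)
    {e : ZMod 2} {η : Forms d M} (hη : formParity e η = η) :
    symF ε par br Q v m 0 X e η = m (deRham η) := by
  rw [symF, h.bilin.symBracket_succ]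
  simp only [symBracket_zero]
  rw [Fin.sum_univ_castSucc, Finset.univ_eq_empty, Finset.sum_empty, zero_add, moveSign_last, Fin.snoc_last, Fin.snoc_last,
    h.par_m, hη, h.br_Q_m, one_smul]

/-- Either a vector field is bracketed last, which contracts the lower bracket `ζ i`, or η is
bracketed last, which gives the second summand. In the first case the shifted parity of η occurs
once in the Koszul sign and once in the sign of `br_m_v`. Only (-1)^i remains, independent of η and
of ε. -/
theorem symF_succ (h : IsCartanModel H ε par br Q v m) {n : ℕ} (X : Fin (n + 1) → VField d M)
    {e : ZMod 2} {η : Forms d M} (hη : formParity e η = η) (ζ : Fin (n + 1) → Forms d M)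
    (hζ : ∀ i, symF ε par br Q v m n (fun k => X (i.succAbove k)) e η = m (ζ i))
    (hζp : ∀ i, formParity (e + n + 1) (ζ i) = ζ i) :
    symF ε par br Q v m (n + 1) X e η =
      m (∑ i : Fin (n + 1), (-1 : ℝ) ^ (i : ℕ) • iota (X i) (ζ i)) +
        br (symV ε par br Q v (n + 1) X) (m η) := by
  rw [symF, h.bilin.symBracket_succ, Fin.sum_univ_castSucc, map_sum]
  refine congrArg₂ _ (Finset.sum_congr rfl fun i _ => ?_) ?_
  · rw [snoc_castSucc_succAbove, snoc_castSucc_succAbove (fun i => v (X i)), Fin.snoc_castSucc,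
      Fin.snoc_castSucc, h.par_v_self, moveSign_snoc_const]
    have := hζ i
    rw [symF] at this
    rw [this, h.br_m_v _ _ _ (hζp i), map_smul, smul_smul]
    congr 1
    -- Separating the shifted parity e + ε of η isolates the factor that will occur squared.
    rw [show e + n + 1 + ε = (e + ε) + ((n + 1 : ℕ) : ZMod 2) by push_cast; ring,
      sgn_add (e + ε) ((n + 1 : ℕ) : ZMod 2), sgn_natCast]
    have h3 : (-1 : ℝ) ^ (n - (i : ℕ)) * (-1) ^ (i : ℕ) = (-1) ^ n := by
      rw [← pow_add, Nat.sub_add_cancel (Nat.lt_succ_iff.1 i.2)]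
    have h4 : (-1 : ℝ) ^ (i : ℕ) * (-1) ^ (i : ℕ) = 1 := by rw [← mul_pow]; simp
    have h5 : (-1 : ℝ) ^ (n - (i : ℕ)) * (-1) ^ (n - (i : ℕ)) = 1 := by rw [← mul_pow]; simp
    calc _ = (sgn (e + ε) * sgn (e + ε)) * (-1 : ℝ) ^ (n - (i : ℕ)) * (-1) ^ n := by ring
      _ = ((-1 : ℝ) ^ (n - (i : ℕ)) * (-1) ^ (n - (i : ℕ))) * (-1) ^ (i : ℕ) := by
        rw [sgn_mul_self, ← h3]; ring
      _ = _ := by rw [h5, one_mul]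
  · rw [snoc_last_succAbove, snoc_last_succAbove, Fin.snoc_last, Fin.snoc_last, moveSign_last,
      one_smul, h.par_m, hη]

theorem symF_one (h : IsCartanModel H ε par br Q v m) (X : Fin 1 → VField d M)
    {e : ZMod 2} {η : Forms d M} (hη : formParity e η = η) :
    symF ε par br Q v m 1 X e η = m (iota (X 0) (deRham η) + lieD (X 0) η) := by
  rw [h.symF_succ X hη (fun _ => deRham η) (fun i => h.symF_zero _ hη)
    (fun i => by simpa using deRham_formParity_fixed hη), h.symV_one, h.br_Q_v_m]
  simp

/-- The factor 6 = 3! is the normalization of a bracket with three arguments, which `threeBracket`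
already contains. -/
theorem symF_two (h : IsCartanModel H ε par br Q v m) (X : Fin 2 → VField d M)
    {e : ZMod 2} {η : Forms d M} (hη : formParity e η = η) :
    symF ε par br Q v m 2 X e η = (6 : ℝ) • m (threeBracket (X 0) (X 1) η) := by
  rw [h.symF_succ X hη (fun i => _) (fun i => h.symF_one _ hη) (fun i => ?_), h.br_symV_two_m,
    ← map_add, ← map_smul]
  · congr 1
    have h1 : (0 : Fin 2).succAbove 0 = 1 := rfl
    have h2 : (1 : Fin 2).succAbove 0 = 0 := rfl
    refine (congrArg₂ _ (Fin.sum_univ_two _) rfl).trans ?_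
    simp only [h1, h2, threeBracket, LinearMap.smul_apply, LinearMap.add_apply,
      LinearMap.sub_apply, Module.End.mul_apply, smul_smul]
    norm_num
    abel
  · have h1 := iota_formParity_fixed (X (i.succAbove 0)) (deRham_formParity_fixed hη)
    rw [zmod2_add_one_add_one] at h1
    rw [Nat.cast_one, zmod2_add_one_add_one, map_add, h1, lieD_formParity_fixed _ hη]

end IsCartanModel

/-! ### Recursion and parity of the bracket hierarchy. -/

section Hier
variable {d : ℕ} {M : Type*} [TopologicalSpace M] [ChartedSpace (Euc d) M]
  [IsManifold (𝓡 d) ∞ M]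

theorem threeBracket_apply (X Y : VField d M) (η : Forms d M) :
    threeBracket X Y η = (1 / 6 : ℝ) • (iota X (iota Y (deRham η) + lieD Y η) -
      iota Y (iota X (deRham η) + lieD X η) +
      (iota (vbracket X Y) η - iota (vbracket Y X) η)) := rfl

theorem hier_succ {n : ℕ} (hn : 2 ≤ n) (X : Fin (n + 1) → VField d M) :
    hier (n + 1) X = (1 / ((n : ℝ) + 2)) • ∑ i : Fin (n + 1), (-1 : ℝ) ^ (i : ℕ) •
      (iota (X i) * hier n (fun k => X (i.succAbove k))) := by
  obtain ⟨n, rfl⟩ := Nat.exists_eq_add_of_le' hn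
  rw [hier]
  congr 1
  push_cast
  ring

/-- Supplies the parity hypothesis of `symF_succ`: `Q` and each of the vector fields shift the
parity of η by one, up to shifts by ε that do not show in the resulting form. -/
theorem hier_formParity_fixed {n : ℕ} (X : Fin (n + 2) → VField d M)
    {e : ZMod 2} {η : Forms d M} (hη : formParity e η = η) :
    formParity (e + (n + 2 : ℕ) + 1) (hier (n + 2) X η) = hier (n + 2) X η := by
  induction n with
  | zero =>
    have h0 : (e + ((0 + 2 : ℕ) : ZMod 2) + 1) = e + 1 := by
      rw [show ((0 + 2 : ℕ) : ZMod 2) = 0 from rfl, add_zero]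
    have hd := deRham_formParity_fixed hη
    have hA (a b : VField d M) := iota_formParity_fixed a (iota_formParity_fixed b hd)
    have hB (a b : VField d M) := iota_formParity_fixed a (lieD_formParity_fixed b hη)
    have hC (a : VField d M) := iota_formParity_fixed a hη
    simp only [zmod2_add_one_add_one] at hA hB hC
    change formParity _ (threeBracket (X 0) (X 1) η) = threeBracket (X 0) (X 1) η
    rw [h0, threeBracket_apply]
    simp only [map_smul, map_add, map_sub, hA, hB, hC]
  | succ n ih =>
    rw [hier_succ (by omega)]
    simp only [LinearMap.smul_apply, LinearMap.sum_apply, Module.End.mul_apply, map_smul, map_sum]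
    congr 1
    refine Finset.sum_congr rfl fun i _ => ?_
    congr 1
    have := iota_formParity_fixed (X i) (ih fun k => X (i.succAbove k))
    rw [← this]
    rw [formParity_formParity, if_pos]
    push_cast
    ring

end Hier

namespace IsCartanModel
variable {d : ℕ} {M : Type*} [TopologicalSpace M] [ChartedSpace (Euc d) M]
  [IsManifold (𝓡 d) ∞ M] {A : Type*} [AddCommGroup A] [Module ℝ A]
  {H : Forms d M} {ε : ZMod 2} {par : ZMod 2 → A → A} {br : A → A → A}
  {Q : A} {v : VField d M → A} {m : Forms d M →ₗ[ℝ] A}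

/-- From three vector fields on, the pure vector bracket is a form and has zero bracket with η, so
only contractions of lower brackets remain. The factor in the recursion for `hier` is the ratio of
consecutive factorial normalizations, 1/(n + 4) = (n + 3)!/(n + 4)! in the inductive step. -/
theorem symF_eq (h : IsCartanModel H ε par br Q v m) {n : ℕ} (X : Fin (n + 2) → VField d M)
    {e : ZMod 2} {η : Forms d M} (hη : formParity e η = η) :
    symF ε par br Q v m (n + 2) X e η = ((n + 3).factorial : ℝ) • m (hier (n + 2) X η) := by
  induction n with
  | zero => rw [h.symF_two X hη]; simp [hier, Nat.factorial]
  | succ n ih =>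
    rw [h.symF_succ X hη (fun i => _) (fun i => by rw [ih, ← map_smul])
      (fun i => by rw [map_smul, hier_formParity_fixed _ hη]), h.symV_eq (by omega),
      h.bilin.smul_left, h.br_m_m, smul_zero, add_zero, ← map_smul, hier_succ (by omega)]
    congr 1
    simp only [LinearMap.smul_apply, LinearMap.sum_apply, Module.End.mul_apply, map_smul,
      Finset.smul_sum, smul_smul]
    refine Finset.sum_congr rfl fun i _ => ?_
    congr 1
    rw [Nat.factorial_succ (n + 3)]
    push_cast
    have : (n : ℝ) + 2 + 2 ≠ 0 := by positivity
    field_simp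
    ring

/-- The form η need not be homogeneous. The sum over parity patterns reduces to a sum over the
parity of the last slot, and linearity reassembles η from its components. -/
theorem derivedBracket_form (h : IsCartanModel H ε par br Q v m) {n : ℕ} (hn : 2 ≤ n)
    (X : Fin n → VField d M) (η : Forms d M) :
    derivedBracket par br ε Q (n + 1) (Fin.snoc (α := fun _ => A) (fun i => v (X i)) (m η)) =
      m (hier n X η) := by
  obtain ⟨n, rfl⟩ := Nat.exists_eq_add_of_le' hn
  -- A wrong parity in a vector slot annihilates the summand. In the remaining pattern η may be
  -- replaced by its component of parity `e`, since projecting a second time has no effect.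
  have hs (e : ZMod 2) (s : Fin (n + 2) → ZMod 2) :
      symBracket par br ε Q (n + 2 + 1) (Fin.snoc s e : Fin (n + 2 + 1) → ZMod 2)
        (Fin.snoc (fun i => v (X i)) (m η) : Fin (n + 2 + 1) → A) =
      if s = fun _ => 1 + ε then ((n + 3).factorial : ℝ) • m (hier (n + 2) X (formParity e η))
      else 0 := by
    split_ifs with hs
    · subst hs
      rw [← h.symF_eq X (formParity_self e η)]
      refine Finset.sum_congr rfl fun π _ => ?_
      congr 2
      funext i
      induction π i using Fin.lastCases with
      | last => simp only [Fin.snoc_last, h.par_m, formParity_self]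
      | cast j => simp only [Fin.snoc_castSucc]
    · obtain ⟨i, hi⟩ := Function.ne_iff.1 hs
      exact h.bilin.symBracket_eq_zero i.castSucc (by
        rw [Fin.snoc_castSucc, Fin.snoc_castSucc, h.par_v, if_neg hi])
  rw [derivedBracket_eq, ← (Fin.snocEquiv fun _ : Fin (n + 2 + 1) => ZMod 2).sum_comp,
    Fintype.sum_prod_type]
  have hs' (e : ZMod 2) (s : Fin (n + 2) → ZMod 2) := hs e s
  simp only [Fin.snocEquiv, Equiv.coe_fn_mk]
  rw [Finset.sum_congr rfl fun e _ => Finset.sum_congr rfl fun s _ => hs e s]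
  simp only [Finset.sum_ite_eq', Finset.mem_univ, if_true]
  rw [← Finset.smul_sum, smul_smul, inv_mul_cancel₀ (by exact_mod_cast Nat.factorial_ne_zero _),
    one_smul, ← map_sum, ← map_sum, sum_formParity]

end IsCartanModel

/-! ### The explicit formula for the brackets -/

/-- The exponent is 2n - 3 - a - b, and `a < b < n` keeps both truncated subtractions exact. The
shifts by one translate indices starting at 0 into indices starting at 1. -/
theorem neg_one_pow_pair {n a b : ℕ} (hab : a < b) (hb : b < n) :
    (-1 : ℝ) ^ ((n - 1 - (a + 1)) + (n - (b + 1))) = -(-1) ^ (a + b) := by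
  rw [← neg_one_mul ((-1 : ℝ) ^ _), ← pow_succ']
  rw [neg_one_pow_eq_pow_mod_two, neg_one_pow_eq_pow_mod_two (n := a + b + 1)]
  congr 1
  omega

theorem card_lt_ne_ne {n : ℕ} {i j l : Fin n} (hij : i ≠ j) :
    (Finset.univ.filter fun k : Fin n => (k ≠ i ∧ k ≠ j) ∧ k < l).card +
      (if i < l then 1 else 0) + (if j < l then 1 else 0) = (l : ℕ) := by
  have hl : (Finset.univ.filter fun k : Fin n => k < l).card = (l : ℕ) := by
    rw [← Fin.card_Iio l]
    congr 1
    ext k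
    simp
  have h1 : ∀ i : Fin n, (if i < l then 1 else 0) = ∑ k, if k = i then (if i < l then 1 else 0) else 0 :=
    fun i => by simp
  rw [← hl, Finset.card_filter, Finset.card_filter, h1 i, h1 j, ← Finset.sum_add_distrib,
    ← Finset.sum_add_distrib]
  refine Finset.sum_congr rfl fun k _ => ?_
  by_cases hi : k = i
  · subst hi; simp [hij]
  · by_cases hj : k = j
    · subst hj; simp [hi]
    · simp [hi, hj]

theorem val_succAbove {n : ℕ} (l : Fin (n + 1)) (a : Fin n) :
    (l.succAbove a : ℕ) + (if l.succAbove a < l then 1 else 0) = (a : ℕ) + 1 := by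
  rcases lt_or_ge a.castSucc l with h | h
  · rw [Fin.succAbove_of_castSucc_lt _ _ h]; simp [h]
  · rw [Fin.succAbove_of_le_castSucc _ _ h]
    have : ¬ a.succ < l := not_lt.2 (h.trans a.castSucc_lt_succ.le)
    simp [this]

/-- Removing `l` lowers by one each of the two paired indices that lies above `l`. Moving the factor
with index `l` to the front of the product passes only the unpaired indices below `l`. The counts
`card_lt_ne_ne` and `val_succAbove` show that the two effects agree modulo 2. -/
theorem neg_one_pow_succAbove_pair {n : ℕ} (l : Fin (n + 1)) {a b : Fin n} (hab : a < b) :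
    (-1 : ℝ) ^ (l : ℕ) * (-1) ^ ((n - 1 - ((a : ℕ) + 1)) + (n - ((b : ℕ) + 1))) =
      (-1) ^ (((n + 1) - 1 - ((l.succAbove a : ℕ) + 1)) + ((n + 1) - ((l.succAbove b : ℕ) + 1))) *
      (-1) ^ (Finset.univ.filter fun k : Fin (n + 1) =>
        (k ≠ l.succAbove a ∧ k ≠ l.succAbove b) ∧ k < l).card := by
  have hlt : l.succAbove a < l.succAbove b := Fin.strictMono_succAbove l hab
  rw [neg_one_pow_pair hab b.2, neg_one_pow_pair hlt (l.succAbove b).2]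
  have h1 := card_lt_ne_ne (l := l) hlt.ne
  have h2 := val_succAbove l a
  have h3 := val_succAbove l b
  rw [mul_neg, neg_mul, ← pow_add, ← pow_add, neg_inj, neg_one_pow_eq_pow_mod_two,
    neg_one_pow_eq_pow_mod_two (n := (l.succAbove a : ℕ) + _ + _)]
  congr 1
  split_ifs at h1 h2 h3 <;> omega

section PairSum
variable {R : Type*} [Ring R] [Module ℝ R]

/-- The sum over `i < j` of the ordered products of all `f k` with `k ≠ i, j`, times `g i j`, with
the sign of the permutation that moves `i` and `j` to the end. -/
def pairSum (n : ℕ) (f : Fin n → R) (g : Fin n → Fin n → R) : R :=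
  ∑ p ∈ (Finset.univ : Finset (Fin n × Fin n)).filter (fun p => p.1 < p.2),
    (-1 : ℝ) ^ ((n - 1 - ((p.1 : ℕ) + 1)) + (n - ((p.2 : ℕ) + 1))) •
      ((((List.finRange n).filter (fun k => k ≠ p.1 ∧ k ≠ p.2)).map f).prod * g p.1 p.2)

theorem pairSum_eq (n : ℕ) (f : Fin n → R) (g : Fin n → Fin n → R) :
    pairSum n f g = ∑ i : Fin n, ∑ j : Fin n, if i < j then
      (-1 : ℝ) ^ ((n - 1 - ((i : ℕ) + 1)) + (n - ((j : ℕ) + 1))) •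
      ((((List.finRange n).filter (fun k => k ≠ i ∧ k ≠ j)).map f).prod * g i j) else 0 := by
  rw [pairSum, Finset.sum_filter, Fintype.sum_prod_type]

variable [IsScalarTower ℝ R R] [SMulCommClass ℝ R R]

/-- For a fixed pair, each index `l` outside it contributes the same term, because moving `f l` back
to its place absorbs exactly the sign (-1)^l. There are n + 1 - 2 such indices, whence the factor n
- 1. -/
theorem pairSum_succ {n : ℕ} (hn : 1 ≤ n) (f : Fin (n + 1) → R) (g : Fin (n + 1) → Fin (n + 1) → R)
    (hf : ∀ i j, f i * f j = -(f j * f i)) :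
    ∑ l : Fin (n + 1), (-1 : ℝ) ^ (l : ℕ) • (f l * pairSum n (fun k => f (l.succAbove k))
      fun a b => g (l.succAbove a) (l.succAbove b)) = ((n : ℝ) - 1) • pairSum (n + 1) f g := by
  set T : Fin (n + 1) → Fin (n + 1) → R := fun i j =>
    (-1 : ℝ) ^ (((n + 1) - 1 - ((i : ℕ) + 1)) + ((n + 1) - ((j : ℕ) + 1))) •
      ((((List.finRange (n + 1)).filter (fun k => k ≠ i ∧ k ≠ j)).map f).prod * g i j) with hT
  have key (l : Fin (n + 1)) (a b : Fin n) (hab : a < b) :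
      (-1 : ℝ) ^ (l : ℕ) • (f l * ((-1 : ℝ) ^ ((n - 1 - ((a : ℕ) + 1)) + (n - ((b : ℕ) + 1))) •
        ((((List.finRange n).filter (fun k => k ≠ a ∧ k ≠ b)).map fun k => f (l.succAbove k)).prod *
          g (l.succAbove a) (l.succAbove b)))) = T (l.succAbove a) (l.succAbove b) := by
    have h := prod_finRange_filter_eq f hf
      (fun k => decide (k ≠ l.succAbove a ∧ k ≠ l.succAbove b)) (l := l)
      (by simp [Fin.ne_succAbove])
    simp only [ne_eq, decide_eq_true_eq, (Fin.succAbove_right_injective).eq_iff] at h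
    simp only [hT, ne_eq]
    rw [h, mul_smul_comm, smul_smul, neg_one_pow_succAbove_pair l hab, smul_mul_assoc, smul_smul,
      mul_assoc]
  -- Pairs that contain `l` do not arise through `succAbove`. Padding them with zeros makes the
  -- range of pairs independent of `l`, so that the sums can be exchanged.
  have hL (l : Fin (n + 1)) : (-1 : ℝ) ^ (l : ℕ) • (f l * pairSum n (fun k => f (l.succAbove k))
      fun a b => g (l.succAbove a) (l.succAbove b)) =
      ∑ i, ∑ j, if i < j then (if l = i ∨ l = j then 0 else T i j) else 0 := by
    rw [Fin.sum_univ_succAbove _ l]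
    simp only [Fin.sum_univ_succAbove _ l, true_or, or_true, if_true, ite_self, zero_add,
      Finset.sum_const_zero, Fin.ne_succAbove, or_false, if_false,
      (Fin.strictMono_succAbove l).lt_iff_lt]
    rw [pairSum_eq, Finset.mul_sum, Finset.smul_sum]
    refine Finset.sum_congr rfl fun a _ => ?_
    rw [Finset.mul_sum, Finset.smul_sum]
    refine Finset.sum_congr rfl fun b _ => ?_
    split_ifs with hab
    · exact key l a b hab
    · simp
  rw [Finset.sum_congr rfl fun l _ => hL l, Finset.sum_comm, pairSum_eq, Finset.smul_sum]
  refine Finset.sum_congr rfl fun i _ => ?_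
  rw [Finset.sum_comm, Finset.smul_sum]
  refine Finset.sum_congr rfl fun j _ => ?_
  split_ifs with hij
  · have hc : (Finset.univ.filter fun l : Fin (n + 1) => ¬ (l = i ∨ l = j)).card = n - 1 := by
      have : (Finset.univ.filter fun l : Fin (n + 1) => ¬ (l = i ∨ l = j)) = {i, j}ᶜ := by
        ext l; simp
      rw [this, Finset.card_compl, Finset.card_pair hij.ne, Fintype.card_fin]
      omega
    have : ∀ l : Fin (n + 1), (if l = i ∨ l = j then 0 else T i j) =
        if ¬ (l = i ∨ l = j) then T i j else 0 := fun l => by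
      by_cases h : l = i ∨ l = j <;> simp [h]
    rw [Finset.sum_congr rfl fun l _ => this l, ← Finset.sum_filter, Finset.sum_const, hc,
      ← Nat.cast_smul_eq_nsmul ℝ, Nat.cast_sub hn, Nat.cast_one]
  · simp

end PairSum

section Hier
variable {d : ℕ} {M : Type*} [TopologicalSpace M] [ChartedSpace (Euc d) M]
  [IsManifold (𝓡 d) ∞ M]

/-- For n = 2 the coefficient is 6/(3·2·1) = 1. In the step, the factor 1/(n + 2) of the recursion
and the multiplicity n - 1 replace the denominator (n + 1)n(n - 1) by (n + 2)(n + 1)n. -/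
theorem hier_eq_pairSum {n : ℕ} (hn : 2 ≤ n) (X : Fin n → VField d M) :
    hier n X = (6 / (((n : ℝ) + 1) * n * (n - 1))) •
      pairSum n (fun k => iota (X k)) fun i j => threeBracket (X i) (X j) := by
  induction n, hn using Nat.le_induction with
  | base =>
    have h0 : (List.finRange 2).filter (fun k => k ≠ 0 ∧ k ≠ 1) = [] := by decide
    rw [pairSum_eq]
    simp [Fin.sum_univ_two, hier, List.finRange_succ]
    norm_num
  | succ n hn ih =>
    rw [hier_succ hn]
    have h (i : Fin (n + 1)) : (-1 : ℝ) ^ (i : ℕ) •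
        (iota (X i) * hier n (fun k => X (i.succAbove k))) =
        (6 / (((n : ℝ) + 1) * n * (n - 1))) • ((-1 : ℝ) ^ (i : ℕ) • (iota (X i) *
          pairSum n (fun k => iota (X (i.succAbove k)))
            fun a b => threeBracket (X (i.succAbove a)) (X (i.succAbove b)))) := by
      rw [ih, mul_smul_comm, smul_comm]
    rw [Finset.sum_congr rfl fun i _ => h i, ← Finset.smul_sum,
      pairSum_succ (by omega) (fun k => iota (X k)) (fun i j => threeBracket (X i) (X j))
        (fun i j => iota_mul_iota _ _), smul_smul, smul_smul]
    congr 1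
    have h1 : (n : ℝ) - 1 ≠ 0 := by
      have : (2 : ℝ) ≤ n := by exact_mod_cast hn
      linarith
    have h2 : (n : ℝ) ≠ 0 := by positivity
    push_cast
    rw [add_sub_cancel_right]
    field_simp
    ring

end Hier

/-! ### Brackets with at least two forms -/

namespace IsCartanModel
variable {d : ℕ} {M : Type*} [TopologicalSpace M] [ChartedSpace (Euc d) M]
  [IsManifold (𝓡 d) ∞ M] {A : Type*} [AddCommGroup A] [Module ℝ A]
  {H : Forms d M} {ε : ZMod 2} {par : ZMod 2 → A → A} {br : A → A → A}
  {Q : A} {v : VField d M → A} {m : Forms d M →ₗ[ℝ] A}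

theorem br_m_v_mem (h : IsCartanModel H ε par br Q v m) (η : Forms d M) (X : VField d M) :
    br (m η) (v X) ∈ LinearMap.range m := by
  rw [← sum_formParity η, map_sum, h.bilin.sum_left]
  refine Submodule.sum_mem _ fun e _ => ?_
  rw [h.br_m_v e _ _ (formParity_self e η)]
  exact Submodule.smul_mem _ _ ⟨_, rfl⟩

/-- The possible values of iterated brackets of `Q` with `n` vector fields. -/
theorem nestedBracket_vectors (h : IsCartanModel H ε par br Q v m) (n : ℕ)
    (X : Fin n → VField d M) :
    (nestedBracket br Q n (fun i => v (X i)) = Q ∨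
      (∃ Y, nestedBracket br Q n (fun i => v (X i)) = br Q (v Y)) ∨
      ∃ Y ζ, nestedBracket br Q n (fun i => v (X i)) = v Y + m ζ) := by
  induction n with
  | zero => exact Or.inl rfl
  | succ n ih =>
    rw [nestedBracket]
    rcases ih fun i => X i.castSucc with h1 | ⟨Y, h1⟩ | ⟨Y, ζ, h1⟩
    · exact Or.inr (Or.inl ⟨_, by rw [h1]⟩)
    · exact Or.inr (Or.inr ⟨_, _, by rw [h1, h.br_Q_v_v]⟩)
    · obtain ⟨ζ', h2⟩ := h.br_m_v_mem ζ (X (Fin.last n))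
      -- A pure form is recorded as having vector part 0, so that the three alternatives remain
      -- closed under bracketing with a vector field.
      exact Or.inr (Or.inr ⟨0, ζ', by rw [h1, h.bilin.add_left, h.br_v_v, ← h2, h.v_zero]⟩)

theorem br_nestedBracket_vectors_m_mem (h : IsCartanModel H ε par br Q v m) (n : ℕ)
    (X : Fin n → VField d M) (η : Forms d M) :
    br (nestedBracket br Q n fun i => v (X i)) (m η) ∈ LinearMap.range m := by
  rcases h.nestedBracket_vectors n X with h1 | ⟨Y, h1⟩ | ⟨Y, ζ, h1⟩
  · rw [h1, h.br_Q_m]; exact ⟨_, rfl⟩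
  · rw [h1, h.br_Q_v_m]; exact ⟨_, rfl⟩
  · rw [h1, h.bilin.add_left, h.br_m_m, h.br_v_m, add_zero]; exact ⟨_, rfl⟩

/-- At the place of the form, each possible value of the preceding bracket of `Q` with vector fields
sends it to a form. Later brackets with vector fields only contract that form. -/
theorem nestedBracket_one_form (h : IsCartanModel H ε par br Q v m) (n : ℕ)
    (z : Fin n → VField d M ⊕ Forms d M) (i : Fin n) (hi : (z i).isRight = true)
    (hne : ∀ j, j ≠ i → (z j).isRight = false) :
    nestedBracket br Q n (fun k => Sum.elim v m (z k)) ∈ LinearMap.range m := by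
  induction n with
  | zero => exact i.elim0
  | succ n ih =>
    rw [nestedBracket]
    induction i using Fin.lastCases with
    | last =>
      obtain ⟨η, hη⟩ := Sum.isRight_iff.1 hi
      have hX (j : Fin n) : ∃ X, z j.castSucc = Sum.inl X := by
        rw [← Sum.isLeft_iff]
        simpa using hne j.castSucc (Fin.castSucc_lt_last j).ne
      choose X hX using hX
      simp only [hX, hη, Sum.elim_inl, Sum.elim_inr]
      exact h.br_nestedBracket_vectors_m_mem n X η
    | cast i =>
      obtain ⟨ζ, hζ⟩ := ih (fun j => z j.castSucc) i hi fun j hj =>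
        hne j.castSucc (by simpa using hj)
      obtain ⟨X, hX⟩ := Sum.isLeft_iff.1 (by simpa using hne (Fin.last n) (Fin.castSucc_lt_last i).ne')
      rw [← hζ, hX]
      exact h.br_m_v_mem ζ X

/-- By induction on the length, it suffices to treat the case where the second form is the outermost
argument. The inner bracket then contains exactly one form, hence is itself a form. -/
theorem nestedBracket_two_forms (h : IsCartanModel H ε par br Q v m) (n : ℕ)
    (z : Fin n → VField d M ⊕ Forms d M) {i j : Fin n} (hij : i ≠ j) (hi : (z i).isRight = true)
    (hj : (z j).isRight = true) :
    nestedBracket br Q n (fun k => Sum.elim v m (z k)) = 0 := by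
  induction n with
  | zero => exact i.elim0
  | succ n ih =>
    rw [nestedBracket]
    by_cases hex : ∃ a b : Fin n, a ≠ b ∧ (z a.castSucc).isRight = true ∧
        (z b.castSucc).isRight = true
    · obtain ⟨a, b, hab, ha, hb⟩ := hex
      rw [ih (fun k => z k.castSucc) hab ha hb, h.bilin.zero_left]
    · push Not at hex
      have hl : (z (Fin.last n)).isRight = true ∧ ∃ a : Fin n, (z a.castSucc).isRight = true := by
        induction i using Fin.lastCases with
        | last =>
          induction j using Fin.lastCases with
          | last => exact absurd rfl hij
          | cast b => exact ⟨hi, b, hj⟩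
        | cast a =>
          induction j using Fin.lastCases with
          | last => exact ⟨hj, a, hi⟩
          | cast b => exact absurd hj (hex a b (by simpa using hij) hi)
      obtain ⟨hl, a, ha⟩ := hl
      obtain ⟨η, hη⟩ := Sum.isRight_iff.1 hl
      obtain ⟨ζ, hζ⟩ := h.nestedBracket_one_form n (fun k => z k.castSucc) a ha fun b hb => by
        simpa using hex a b hb.symm ha
      rw [← hζ, hη]
      exact h.br_m_m ζ η

theorem derivedBracket_two_forms (h : IsCartanModel H ε par br Q v m) (n : ℕ)
    (z : Fin n → VField d M ⊕ Forms d M) {i j : Fin n} (hij : i ≠ j) (hi : (z i).isRight = true)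
    (hj : (z j).isRight = true) :
    derivedBracket par br ε Q n (fun k => Sum.elim v m (z k)) = 0 := by
  rw [derivedBracket_eq]
  refine smul_eq_zero_of_right _ (Finset.sum_eq_zero fun s _ => Finset.sum_eq_zero fun π _ => ?_)
  refine smul_eq_zero_of_right _ ?_
  -- Parity components of admissible arguments are again admissible: a form gives a form, and a
  -- vector field gives itself or the zero field. No slot changes its type, so the two forms persist
  -- in every summand.
  set z' : Fin n → VField d M ⊕ Forms d M := fun k =>
    Sum.map (fun X => if s (π k) = 1 + ε then X else 0) (formParity (s (π k))) (z (π k)) with hz'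
  have hz : (fun k => par (s (π k)) (Sum.elim v m (z (π k)))) = fun k => Sum.elim v m (z' k) := by
    funext k
    simp only [hz']
    rcases z (π k) with X | η
    · simp only [Sum.elim_inl, Sum.map_inl, h.par_v]
      split_ifs
      · rfl
      · exact h.v_zero.symm
    · exact h.par_m _ _
  rw [hz]
  refine h.nestedBracket_two_forms n z' (i := π.symm i) (j := π.symm j) ?_ ?_ ?_
  · simpa using hij
  · simpa [hz'] using hi
  · simpa [hz'] using hj

end IsCartanModel

/-! ### The wedge product as a sum over all permutations -/

section Wedge
variable {V : Type*} [AddCommGroup V] [Module ℝ V] [TopologicalSpace V]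

/-- The product `α(v_1, …, v_p) β(v_{p+1}, …, v_{p+q})`. -/
def splitProd {p q n : ℕ} (h : p + q = n) (α : V [⋀^Fin p]→L[ℝ] ℝ) (β : V [⋀^Fin q]→L[ℝ] ℝ)
    (v : Fin n → V) : ℝ :=
  α (fun i => v (Fin.cast h (Fin.castAdd q i))) * β (fun i => v (Fin.cast h (Fin.natAdd p i)))

/-- The wedge product sums over cosets of block permutations. Each coset has p!q! elements with
equal contributions, so multiplying by p!q! gives a sum over all permutations, which can be split by
one of their values. -/
theorem factorial_mul_wedge_apply {p q n : ℕ} (h : p + q = n) (α : V [⋀^Fin p]→L[ℝ] ℝ)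
    (β : V [⋀^Fin q]→L[ℝ] ℝ) (v : Fin n → V) :
    ((p.factorial * q.factorial : ℕ) : ℝ) * wedge h α β v =
      ∑ σ : Equiv.Perm (Fin n), ((Equiv.Perm.sign σ : ℤ) : ℝ) * splitProd h α β (v ∘ σ) := by
  subst h
  have h1 := DFunLike.congr_fun
    (MultilinearMap.domCoprod_alternization_eq α.toAlternatingMap β.toAlternatingMap)
    (fun i => v (finSumFinEquiv i))
  have h2 := congrArg (LinearMap.mul' ℝ ℝ) h1
  rw [MultilinearMap.alternatization_apply, map_sum, Fintype.card_fin, Fintype.card_fin] at h2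
  have h3 : LinearMap.mul' ℝ ℝ (((p.factorial * q.factorial) •
      (α.toAlternatingMap.domCoprod β.toAlternatingMap)) fun i => v (finSumFinEquiv i)) =
      ((p.factorial * q.factorial : ℕ) : ℝ) * wedge rfl α β v := by
    rw [AlternatingMap.smul_apply, map_nsmul, nsmul_eq_mul]
    rfl
  rw [← h3, ← h2, ← (finSumFinEquiv.permCongr).sum_comp]
  refine Finset.sum_congr rfl fun σ _ => ?_
  rw [Equiv.Perm.sign_permCongr]
  rcases Int.units_eq_one_or (Equiv.Perm.sign σ) with hs | hs <;> simp [hs, splitProd, Equiv.permCongr_apply]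

theorem continuousAlternating_insertNth {k : ℕ} (α : V [⋀^Fin (k + 1)]→L[ℝ] ℝ) (l : Fin (k + 1))
    (X : V) (w : Fin k → V) :
    (-1 : ℝ) ^ (l : ℕ) * α (l.insertNth (α := fun _ => V) X w) = contract X α w := by
  have h := α.toAlternatingMap.neg_one_pow_smul_map_insertNth l X w
  rw [contract_apply]
  refine Eq.trans ?_ h
  rcases neg_one_pow_eq_or ℤ (l : ℕ) with hs | hs
  · rw [hs, one_smul]
    have : (-1 : ℝ) ^ (l : ℕ) = 1 := by exact_mod_cast congrArg (Int.cast (R := ℝ)) hs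
    rw [this, one_mul]; rfl
  · rw [hs, neg_one_smul]
    have : (-1 : ℝ) ^ (l : ℕ) = -1 := by exact_mod_cast congrArg (Int.cast (R := ℝ)) hs
    rw [this, neg_one_mul]; rfl

/-- Moving `X` from slot `l` to the front of the first block costs (-1)^l, so the contribution does
not depend on the slot. -/
theorem splitProd_insertNth_left {p q n : ℕ} (h : p + 1 + q = n + 1) (h' : p + q = n)
    (α : V [⋀^Fin (p + 1)]→L[ℝ] ℝ) (β : V [⋀^Fin q]→L[ℝ] ℝ) (X : V) (w : Fin n → V)
    (l : Fin (p + 1)) :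
    (-1 : ℝ) ^ (l : ℕ) * splitProd h α β
      ((Fin.cast h (Fin.castAdd q l)).insertNth (α := fun _ => V) X w) =
        splitProd h' (contract X α) β w := by
  have h1 : (fun i => (Fin.cast h (Fin.castAdd q l)).insertNth (α := fun _ => V) X w
      (Fin.cast h (Fin.castAdd q i))) =
      l.insertNth (α := fun _ => V) X fun i => w (Fin.cast h' (Fin.castAdd q i)) := by
    funext i
    refine Fin.succAboveCases l ?_ (fun j => ?_) i
    · simp
    · rw [Fin.insertNth_apply_succAbove, show Fin.cast h (Fin.castAdd q (l.succAbove j)) =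
        (Fin.cast h (Fin.castAdd q l)).succAbove (Fin.cast h' (Fin.castAdd q j)) by
          ext; simp only [Fin.succAbove, Fin.lt_def]; simp; split_ifs <;> simp,
        Fin.insertNth_apply_succAbove]
  have h2 : (fun i => (Fin.cast h (Fin.castAdd q l)).insertNth (α := fun _ => V) X w
      (Fin.cast h (Fin.natAdd (p + 1) i))) = fun i => w (Fin.cast h' (Fin.natAdd p i)) := by
    funext i
    rw [show Fin.cast h (Fin.natAdd (p + 1) i) =
        (Fin.cast h (Fin.castAdd q l)).succAbove (Fin.cast h' (Fin.natAdd p i)) by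
          ext; simp only [Fin.succAbove, Fin.lt_def]; simp; split_ifs <;> simp <;> omega,
        Fin.insertNth_apply_succAbove]
  rw [splitProd, h1, h2, ← mul_assoc, continuousAlternating_insertNth, splitProd]

/-- The slot number in the whole tuple is p + l, but moving `X` to the front of the second block
costs only (-1)^l. The remaining (-1)^p is the sign of the antiderivation rule. -/
theorem splitProd_insertNth_right {p q n : ℕ} (h : p + (q + 1) = n + 1) (h' : p + q = n)
    (α : V [⋀^Fin p]→L[ℝ] ℝ) (β : V [⋀^Fin (q + 1)]→L[ℝ] ℝ) (X : V) (w : Fin n → V)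
    (l : Fin (q + 1)) :
    (-1 : ℝ) ^ (p + (l : ℕ)) * splitProd h α β
      ((Fin.cast h (Fin.natAdd p l)).insertNth (α := fun _ => V) X w) =
        (-1) ^ p * splitProd h' α (contract X β) w := by
  have h1 : (fun i => (Fin.cast h (Fin.natAdd p l)).insertNth (α := fun _ => V) X w
      (Fin.cast h (Fin.natAdd p i))) =
      l.insertNth (α := fun _ => V) X fun i => w (Fin.cast h' (Fin.natAdd p i)) := by
    funext i
    refine Fin.succAboveCases l ?_ (fun j => ?_) i
    · simp
    · rw [Fin.insertNth_apply_succAbove, show Fin.cast h (Fin.natAdd p (l.succAbove j)) =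
        (Fin.cast h (Fin.natAdd p l)).succAbove (Fin.cast h' (Fin.natAdd p j)) by
          ext; simp only [Fin.succAbove, Fin.lt_def]; simp; split_ifs <;> simp <;> omega,
        Fin.insertNth_apply_succAbove]
  have h2 : (fun i => (Fin.cast h (Fin.natAdd p l)).insertNth (α := fun _ => V) X w
      (Fin.cast h (Fin.castAdd (q + 1) i))) = fun i => w (Fin.cast h' (Fin.castAdd q i)) := by
    funext i
    rw [show Fin.cast h (Fin.castAdd (q + 1) i) =
        (Fin.cast h (Fin.natAdd p l)).succAbove (Fin.cast h' (Fin.castAdd q i)) by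
          ext; simp only [Fin.succAbove, Fin.lt_def]; simp; split_ifs <;> simp <;> omega,
        Fin.insertNth_apply_succAbove]
  rw [splitProd, h1, h2, pow_add, splitProd, ← continuousAlternating_insertNth β l]
  ring

/-- The value of a wedge product at a tuple of vectors that starts with `X`. -/
theorem factorial_mul_wedge_vecCons {p q n : ℕ} (h : p + q = n + 1) (α : V [⋀^Fin p]→L[ℝ] ℝ)
    (β : V [⋀^Fin q]→L[ℝ] ℝ) (X : V) (v : Fin n → V) :
    ((p.factorial * q.factorial : ℕ) : ℝ) * wedge h α β (Matrix.vecCons X v) =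
      ∑ σ : Equiv.Perm (Fin n), ((Equiv.Perm.sign σ : ℤ) : ℝ) *
        (∑ l : Fin p, (-1 : ℝ) ^ (l : ℕ) * splitProd h α β
          ((Fin.cast h (Fin.castAdd q l)).insertNth (α := fun _ => V) X (v ∘ σ)) +
        ∑ l : Fin q, (-1 : ℝ) ^ (p + (l : ℕ)) * splitProd h α β
          ((Fin.cast h (Fin.natAdd p l)).insertNth (α := fun _ => V) X (v ∘ σ))) := by
  have hc (l : Fin (n + 1)) (σ : Equiv.Perm (Fin n)) :
      Matrix.vecCons X v ∘ insertPerm l 0 σ = l.insertNth (α := fun _ => V) X (v ∘ σ) := by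
    funext i
    refine Fin.succAboveCases l ?_ (fun j => ?_) i <;> simp
  rw [factorial_mul_wedge_apply, sum_perm_preimage 0, Finset.sum_comm]
  refine Finset.sum_congr rfl fun σ _ => ?_
  rw [← (finCongr h).sum_comp, Fin.sum_univ_add, mul_add, Finset.mul_sum, Finset.mul_sum]
  simp only [hc, sign_insertPerm_zero, finCongr_apply]
  push_cast
  simp only [Fin.val_cast, Fin.val_castAdd, Fin.val_natAdd]
  congr 1 <;> exact Finset.sum_congr rfl fun l _ => by ring

/-- The p + 1 slots of the first block contribute equally, which matches (p + 1)! = (p + 1) p!, and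
likewise for the second block. The cases in which one factor has degree zero are treated separately,
since that factor has no contraction. -/
theorem contract_wedge_succ_succ {p q n : ℕ} (h : p + 1 + (q + 1) = n + 1)
    (h1 : p + (q + 1) = n) (h2 : p + 1 + q = n) (α : V [⋀^Fin (p + 1)]→L[ℝ] ℝ)
    (β : V [⋀^Fin (q + 1)]→L[ℝ] ℝ) (X : V) :
    contract X (wedge h α β) =
      wedge h1 (contract X α) β + (-1 : ℝ) ^ (p + 1) • wedge h2 α (contract X β) := by
  ext v
  have hne : (((p + 1).factorial * (q + 1).factorial : ℕ) : ℝ) ≠ 0 := by positivity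
  refine mul_left_cancel₀ hne ?_
  rw [contract_apply, factorial_mul_wedge_vecCons]
  simp only [splitProd_insertNth_left h h1, splitProd_insertNth_right h h2]
  simp only [Finset.sum_const, Finset.card_univ, Fintype.card_fin, nsmul_eq_mul, mul_add,
    Finset.sum_add_distrib, ContinuousAlternatingMap.add_apply, ContinuousAlternatingMap.smul_apply,
    smul_eq_mul]
  have e1 := factorial_mul_wedge_apply h1 (contract X α) β v
  have e2 := factorial_mul_wedge_apply h2 α (contract X β) v
  have f1 : (((p + 1).factorial * (q + 1).factorial : ℕ) : ℝ) =
      (p + 1 : ℕ) * ((p.factorial * (q + 1).factorial : ℕ) : ℝ) := by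
    rw [Nat.factorial_succ p]; push_cast; ring
  have f2 : (((p + 1).factorial * (q + 1).factorial : ℕ) : ℝ) =
      (q + 1 : ℕ) * (((p + 1).factorial * q.factorial : ℕ) : ℝ) := by
    rw [Nat.factorial_succ q]; push_cast; ring
  congr 1
  · rw [f1, mul_assoc, e1, Finset.mul_sum]
    exact Finset.sum_congr rfl fun σ _ => by ring
  · rw [f2, mul_left_comm, mul_assoc, e2, Finset.mul_sum, Finset.mul_sum]
    exact Finset.sum_congr rfl fun σ _ => by ring

theorem contract_wedge_zero_succ {q n : ℕ} (h : 0 + (q + 1) = n + 1)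
    (h2 : 0 + q = n) (α : V [⋀^Fin 0]→L[ℝ] ℝ) (β : V [⋀^Fin (q + 1)]→L[ℝ] ℝ) (X : V) :
    contract X (wedge h α β) = wedge h2 α (contract X β) := by
  ext v
  have hne : ((Nat.factorial 0 * (q + 1).factorial : ℕ) : ℝ) ≠ 0 := by positivity
  refine mul_left_cancel₀ hne ?_
  rw [contract_apply, factorial_mul_wedge_vecCons]
  simp only [splitProd_insertNth_right h h2]
  simp only [Finset.univ_eq_empty, Finset.sum_empty, Finset.sum_const, Finset.card_univ,
    Fintype.card_fin, nsmul_eq_mul, zero_add, pow_zero, one_mul]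
  have e2 := factorial_mul_wedge_apply h2 α (contract X β) v
  have f2 : ((Nat.factorial 0 * (q + 1).factorial : ℕ) : ℝ) =
      (q + 1 : ℕ) * ((Nat.factorial 0 * q.factorial : ℕ) : ℝ) := by
    rw [Nat.factorial_succ q]; push_cast; ring
  rw [f2, mul_assoc, e2, Finset.mul_sum]
  exact Finset.sum_congr rfl fun σ _ => by ring

theorem contract_wedge_succ_zero {p n : ℕ} (h : p + 1 + 0 = n + 1)
    (h1 : p + 0 = n) (α : V [⋀^Fin (p + 1)]→L[ℝ] ℝ) (β : V [⋀^Fin 0]→L[ℝ] ℝ) (X : V) :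
    contract X (wedge h α β) = wedge h1 (contract X α) β := by
  ext v
  have hne : (((p + 1).factorial * Nat.factorial 0 : ℕ) : ℝ) ≠ 0 := by positivity
  refine mul_left_cancel₀ hne ?_
  rw [contract_apply, factorial_mul_wedge_vecCons]
  simp only [splitProd_insertNth_left h h1]
  simp only [Finset.univ_eq_empty, Finset.sum_empty, Finset.sum_const, Finset.card_univ,
    Fintype.card_fin, nsmul_eq_mul, add_zero]
  have e1 := factorial_mul_wedge_apply h1 (contract X α) β v
  have f1 : (((p + 1).factorial * Nat.factorial 0 : ℕ) : ℝ) =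
      (p + 1 : ℕ) * ((p.factorial * Nat.factorial 0 : ℕ) : ℝ) := by
    rw [Nat.factorial_succ p]; push_cast; ring
  rw [f1, mul_assoc, e1, Finset.mul_sum]
  exact Finset.sum_congr rfl fun σ _ => by ring

theorem wedge_zero_zero (h : 0 + 0 = 0) (α β : V [⋀^Fin 0]→L[ℝ] ℝ) (v : Fin 0 → V) :
    wedge h α β v = α v * β v := by
  have := factorial_mul_wedge_apply h α β v
  rw [Fintype.sum_unique] at this
  simp only [Nat.factorial_zero, mul_one, Nat.cast_one, one_mul] at this
  rw [this]
  simp only [splitProd, Subsingleton.elim _ v]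
  simp

end Wedge

/-! ### The exterior algebra of inhomogeneous alternating forms -/

section Ext
variable {V : Type*} [AddCommGroup V] [Module ℝ V] [TopologicalSpace V]

/-- Inhomogeneous alternating forms on `V`. -/
abbrev Ext (V : Type*) [AddCommGroup V] [Module ℝ V] [TopologicalSpace V] :=
  ∀ k : ℕ, V [⋀^Fin k]→L[ℝ] ℝ

/-- The wedge product of inhomogeneous forms. -/
def extMul : Ext V →ₗ[ℝ] Ext V →ₗ[ℝ] Ext V :=
  LinearMap.mk₂ ℝ (fun α β n => ∑ p : Fin (n + 1),
      wedgeLin (Nat.add_sub_of_le (Nat.lt_succ_iff.1 p.2)) (α p) (β (n - p)))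
    (fun α α' β => by funext n; simp [Finset.sum_add_distrib])
    (fun c α β => by funext n; simp [Finset.smul_sum])
    (fun α β β' => by funext n; simp [Finset.sum_add_distrib])
    (fun c α β => by funext n; simp [Finset.smul_sum])

theorem extMul_apply (α β : Ext V) (n : ℕ) : extMul α β n = ∑ p : Fin (n + 1),
    wedge (Nat.add_sub_of_le (Nat.lt_succ_iff.1 p.2)) (α p) (β (n - p)) := rfl

/-- The contraction of inhomogeneous forms with a vector. -/
def extContract : V →ₗ[ℝ] Ext V →ₗ[ℝ] Ext V :=
  LinearMap.mk₂ ℝ (fun X α k => contractLin X (α (k + 1)))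
    (fun X Y α => by funext n; simp) (fun c X α => by funext n; simp)
    (fun X α β => by funext n; simp) (fun c X α => by funext n; simp)

theorem extContract_apply (X : V) (α : Ext V) (k : ℕ) :
    extContract X α k = contract X (α (k + 1)) := rfl

/-- The grading automorphism of inhomogeneous forms. -/
def extPar : Ext V →ₗ[ℝ] Ext V where
  toFun α k := (-1 : ℝ) ^ k • α k
  map_add' α β := by funext k; simp
  map_smul' c α := by funext k; exact smul_comm ((-1 : ℝ) ^ k) c (α k)

theorem extPar_apply (α : Ext V) (k : ℕ) : extPar α k = (-1 : ℝ) ^ k • α k := rfl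

theorem extPar_extPar (α : Ext V) : extPar (extPar α) = α := by
  funext k
  rw [extPar_apply, extPar_apply, smul_smul, ← mul_pow]
  simp

theorem extContract_extPar (X : V) (α : Ext V) :
    extContract X (extPar α) = -extPar (extContract X α) := by
  funext k
  change contractLin X ((-1 : ℝ) ^ (k + 1) • α (k + 1)) = -((-1 : ℝ) ^ k • contractLin X (α (k + 1)))
  rw [map_smul, pow_succ, mul_neg_one]
  exact neg_smul ((-1 : ℝ) ^ k) (contractLin X (α (k + 1)))

theorem extContract_extContract (X Y : V) (α : Ext V) :
    extContract X (extContract Y α) = -extContract Y (extContract X α) := by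
  funext k
  exact contract_contract X Y (α (k + 2))

/-- Transports a wedge product along equalities of degrees, needed because expressions such as n + 1
- (p + 1) do not reduce definitionally to the required form. -/
theorem wedge_congr {p p' q q' n : ℕ} (h : p + q = n) (h' : p' + q' = n) (hp : p = p')
    (hq : q = q') (α β : Ext V) : wedge h (α p) (β q) = wedge h' (α p') (β q') := by
  subst hp hq; rfl

theorem extPar_extMul (α β : Ext V) : extPar (extMul α β) = extMul (extPar α) (extPar β) := by
  funext n
  rw [extPar_apply, extMul_apply, extMul_apply, Finset.smul_sum]
  refine Finset.sum_congr rfl fun p _ => ?_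
  have h : (p : ℕ) + (n - p) = n := Nat.add_sub_of_le (Nat.lt_succ_iff.1 p.2)
  change _ = wedgeLin _ ((-1 : ℝ) ^ (p : ℕ) • α p) ((-1 : ℝ) ^ (n - (p : ℕ)) • β (n - p))
  rw [map_smul, map_smul, LinearMap.smul_apply, smul_smul, ← pow_add, add_comm (n - (p : ℕ)), h]
  rfl

/-- Contractions are antiderivations of the wedge product. -/
theorem extContract_extMul (X : V) (α β : Ext V) :
    extContract X (extMul α β) =
      extMul (extContract X α) β + extMul (extPar α) (extContract X β) := by
  funext n
  -- Here `L` and `R` list the terms in which the first and the second factor is contracted. Padding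
  -- with a zero at the first and last index respectively, where the factor to be contracted has
  -- degree zero, lets both run over the n + 2 degrees of the first factor before contraction.
  set L : Fin (n + 2) → V [⋀^Fin n]→L[ℝ] ℝ := Fin.cons 0 fun p : Fin (n + 1) =>
    wedge (Nat.add_sub_of_le (Nat.lt_succ_iff.1 p.2)) (extContract X α p) (β (n - p)) with hL
  set R : Fin (n + 2) → V [⋀^Fin n]→L[ℝ] ℝ := Fin.snoc (fun p : Fin (n + 1) =>
    wedge (Nat.add_sub_of_le (Nat.lt_succ_iff.1 p.2)) (extPar α p) (extContract X β (n - p))) 0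
    with hR
  have hw {p q : ℕ} (h : p + q = n) (γ : V [⋀^Fin q]→L[ℝ] ℝ) :
      wedge h (extPar α p) γ = (-1 : ℝ) ^ p • wedge h (α p) γ := by
    change wedgeLin h ((-1 : ℝ) ^ p • α p) γ = (-1 : ℝ) ^ p • wedgeLin h (α p) γ
    rw [map_smul, LinearMap.smul_apply]
  have hRc (p : Fin (n + 1)) : R p.castSucc =
      wedge (Nat.add_sub_of_le (Nat.lt_succ_iff.1 p.2)) (extPar α p) (extContract X β (n - p)) := by
    rw [hR, Fin.snoc_castSucc]
  have key (p : Fin (n + 2)) :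
      contract X (wedge (Nat.add_sub_of_le (Nat.lt_succ_iff.1 p.2)) (α p) (β (n + 1 - p))) =
        L p + R p := by
    induction p using Fin.cases with
    | zero =>
      have hR0 := hRc 0
      rw [Fin.castSucc_zero] at hR0
      rw [hR0, hL, Fin.cons_zero, zero_add, hw]
      exact (contract_wedge_zero_succ (q := n) (by omega) (by omega) (α 0) (β (n + 1)) X).trans
        (by simp [extContract_apply])
    | succ p =>
      rw [hL, Fin.cons_succ]
      induction p using Fin.lastCases with
      | last =>
        have hR0 : R (Fin.last n).succ = 0 := by rw [Fin.succ_last, hR, Fin.snoc_last]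
        rw [hR0, add_zero]
        refine (congrArg (contract X) (wedge_congr (p' := n + 1) (q' := 0) _ (by omega) (by simp)
          (by simp) α β)).trans ?_
        refine (contract_wedge_succ_zero _ (by omega) _ _ X).trans ?_
        exact wedge_congr _ _ (by simp) (by simp) (extContract X α) β
      | cast p =>
        rw [Fin.succ_castSucc, hRc, hw]
        have hp := p.2
        obtain ⟨q, hq⟩ : ∃ q, n = p + (q + 1) := ⟨n - p - 1, by omega⟩
        refine (congrArg (contract X) (wedge_congr (p' := p + 1) (q' := q + 1) _ (by omega) (by simp)
          (by simp; omega) α β)).trans ?_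
        refine (contract_wedge_succ_succ _ (by omega) (by omega) _ _ X).trans ?_
        refine congrArg₂ _ (wedge_congr _ _ (by simp) (by simp; omega) (extContract X α) β) ?_
        refine congrArg₂ _ (by simp) ?_
        exact wedge_congr _ _ (by simp) (by simp; omega) α (extContract X β)
  have h1 : extContract X (extMul α β) n = ∑ p : Fin (n + 2), (L p + R p) := by
    rw [← Finset.sum_congr rfl fun p _ => key p]
    change contractLin X (∑ p : Fin (n + 2), wedge _ (α p) (β (n + 1 - p))) = _
    rw [map_sum]
    rfl
  rw [h1, Finset.sum_add_distrib]
  refine congrArg₂ _ ((Fin.sum_univ_succ L).trans ?_) ((Fin.sum_univ_castSucc R).trans ?_)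
  · simp only [hL, Fin.cons_zero, Fin.cons_succ, zero_add]
    rfl
  · simp only [hR, Fin.snoc_last, Fin.snoc_castSucc, add_zero]
    rfl

/-- Evaluation on a tuple is contraction with its first vector followed by evaluation on the rest.
Together with the antiderivation rule this allows identities between wedge products to be proved by
induction on degree. -/
theorem eq_of_contract_eq {k : ℕ} {α β : V [⋀^Fin (k + 1)]→L[ℝ] ℝ}
    (h : ∀ X, contract X α = contract X β) : α = β := by
  ext v
  have := DFunLike.congr_fun (h (v 0)) (fun i => v i.succ)
  rw [contract_apply, contract_apply] at this
  have hv : Matrix.vecCons (v 0) (fun i => v i.succ) = v := by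
    funext i
    refine Fin.cases ?_ (fun j => ?_) i <;> simp
  rwa [hv] at this

theorem extMul_apply_zero (α β : Ext V) (v : Fin 0 → V) :
    extMul α β 0 v = α 0 v * β 0 v := by
  rw [extMul_apply, Fin.sum_univ_succ, Finset.univ_eq_empty, Finset.sum_empty, add_zero]
  exact wedge_zero_zero _ _ _ _

/-- Contracting either side with a vector gives sums of triple products of total degree one lower,
to which the induction applies. In degree zero the claim is associativity of multiplication in ℝ. -/
theorem extMul_assoc (α β γ : Ext V) :
    extMul (extMul α β) γ = extMul α (extMul β γ) := by
  funext n
  induction n generalizing α β γ with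
  | zero =>
    ext v
    simp only [extMul_apply_zero, mul_assoc]
  | succ n ih =>
    refine eq_of_contract_eq fun X => ?_
    have h := fun δ : Ext V => (extContract_apply X δ n).symm
    rw [h, h]
    simp only [extContract_extMul, map_add, LinearMap.add_apply, extPar_extMul, Pi.add_apply, ih]
    abel

/-- Contraction turns an even form into an odd one and conversely, so the two statements must be
carried through the induction together. -/
theorem extMul_comm_aux (n : ℕ) (α β : Ext V) :
    (extPar α = α → extMul α β n = extMul β α n) ∧
      (extPar α = -α → extMul α β n = extMul (extPar β) α n) := by
  induction n generalizing α β with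
  | zero =>
    constructor
    · intro _
      ext v
      rw [extMul_apply_zero, extMul_apply_zero, mul_comm]
    · intro _
      ext v
      rw [extMul_apply_zero, extMul_apply_zero, mul_comm, extPar_apply, pow_zero, one_smul]
  | succ n ih =>
    constructor
    · intro h
      refine eq_of_contract_eq fun X => ?_
      have h' : extPar (extContract X α) = -extContract X α := by
        rw [eq_neg_iff_add_eq_zero, ← neg_eq_zero, neg_add, ← extContract_extPar, h]
        abel
      rw [← extContract_apply, ← extContract_apply, extContract_extMul, extContract_extMul, h,
        Pi.add_apply, Pi.add_apply, (ih _ _).2 h', (ih _ _).1 h, add_comm]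
    · intro h
      refine eq_of_contract_eq fun X => ?_
      have h' : extPar (extContract X α) = extContract X α := by
        rw [← neg_inj, ← extContract_extPar, h, map_neg]
      rw [← extContract_apply, ← extContract_apply, extContract_extMul, extContract_extMul, h,
        Pi.add_apply, Pi.add_apply, (ih _ _).1 h', map_neg, LinearMap.neg_apply, Pi.neg_apply,
        (ih _ _).2 h, extContract_extPar, map_neg, LinearMap.neg_apply, Pi.neg_apply,
        extPar_extPar, add_comm]

theorem extMul_comm_of_even {α : Ext V} (h : extPar α = α) (β : Ext V) :
    extMul α β = extMul β α := funext fun n => (extMul_comm_aux n α β).1 h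

theorem extMul_comm_of_odd {α : Ext V} (h : extPar α = -α) (β : Ext V) :
    extMul α β = extMul (extPar β) α := funext fun n => (extMul_comm_aux n α β).2 h

end Ext

/-! ### Antisymmetrization of derivatives. -/

section ExtAlt
variable {d : ℕ}

/-- The antisymmetrization `∑_i e^i ∧ F(e_i)` of a linear family of inhomogeneous forms. -/
def extAlt : (Euc d →ₗ[ℝ] Ext (Euc d)) →ₗ[ℝ] Ext (Euc d) where
  toFun F
    | 0 => 0
    | k + 1 => ContinuousAlternatingMap.alternatizeUncurryFin
        (LinearMap.toContinuousLinearMap ((LinearMap.proj k).comp F))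
  map_add' F G := by
    funext k
    cases k with
    | zero => exact (add_zero 0).symm
    | succ k =>
      exact (congrArg ContinuousAlternatingMap.alternatizeUncurryFin (by ext; rfl)).trans
        (ContinuousAlternatingMap.alternatizeUncurryFin_add
          (LinearMap.toContinuousLinearMap ((LinearMap.proj k).comp F))
          (LinearMap.toContinuousLinearMap ((LinearMap.proj k).comp G)))
  map_smul' c F := by
    funext k
    cases k with
    | zero => exact (smul_zero c).symm
    | succ k =>
      exact (congrArg ContinuousAlternatingMap.alternatizeUncurryFin (by ext; rfl)).trans
        (ContinuousAlternatingMap.alternatizeUncurryFin_smul c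
          (LinearMap.toContinuousLinearMap ((LinearMap.proj k).comp F)))

theorem extAlt_apply_zero (F : Euc d →ₗ[ℝ] Ext (Euc d)) : extAlt F 0 = 0 := rfl

theorem extAlt_apply_succ (F : Euc d →ₗ[ℝ] Ext (Euc d)) (k : ℕ) (v : Fin (k + 1) → Euc d) :
    extAlt F (k + 1) v = ∑ i : Fin (k + 1), (-1 : ℝ) ^ (i : ℕ) * F (v i) k (i.removeNth v) := by
  refine (ContinuousAlternatingMap.alternatizeUncurryFin_apply _ _).trans ?_
  refine Finset.sum_congr rfl fun i _ => ?_
  rcases neg_one_pow_eq_or ℤ (i : ℕ) with hs | hs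
  · rw [hs, one_smul]
    have : (-1 : ℝ) ^ (i : ℕ) = 1 := by exact_mod_cast congrArg (Int.cast (R := ℝ)) hs
    rw [this, one_mul]; rfl
  · rw [hs, neg_one_smul]
    have : (-1 : ℝ) ^ (i : ℕ) = -1 := by exact_mod_cast congrArg (Int.cast (R := ℝ)) hs
    rw [this, neg_one_mul]; rfl

/-- This is the antiderivation rule for ∑ e^i ∧ F(e_i): contracting the one-forms e^i gives `F X`,
and passing them costs a sign. -/
theorem extContract_extAlt (X : Euc d) (F : Euc d →ₗ[ℝ] Ext (Euc d)) :
    extContract X (extAlt F) = F X - extAlt ((extContract X).comp F) := by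
  funext k
  ext v
  rw [extContract_apply, contract_apply, extAlt_apply_succ, Fin.sum_univ_succ]
  rw [Pi.sub_apply, ContinuousAlternatingMap.sub_apply, sub_eq_add_neg]
  refine congrArg₂ _ ?_ ?_
  · simp only [Fin.val_zero, pow_zero, one_mul, Matrix.cons_val_zero]
    rfl
  · cases k with
    | zero => simp [extAlt_apply_zero]
    | succ k =>
      rw [extAlt_apply_succ, ← Finset.sum_neg_distrib]
      refine Finset.sum_congr rfl fun i _ => ?_
      rw [LinearMap.comp_apply, extContract_apply, contract_apply, Matrix.cons_val_succ,
        Fin.val_succ, pow_succ, mul_neg_one, neg_mul]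
      congr 3
      funext j
      refine Fin.cases ?_ (fun j => ?_) j
      · simp [Fin.removeNth]
      · simp [Fin.removeNth]

theorem extPar_extAlt (F : Euc d →ₗ[ℝ] Ext (Euc d)) :
    extPar (extAlt F) = -extAlt (extPar.comp F) := by
  funext k
  cases k with
  | zero => rw [extPar_apply, Pi.neg_apply, extAlt_apply_zero, extAlt_apply_zero]; simp
  | succ k =>
    ext v
    rw [extPar_apply, ContinuousAlternatingMap.smul_apply, Pi.neg_apply,
      ContinuousAlternatingMap.neg_apply, extAlt_apply_succ, extAlt_apply_succ, smul_eq_mul,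
      Finset.mul_sum, ← Finset.sum_neg_distrib]
    refine Finset.sum_congr rfl fun i _ => ?_
    rw [LinearMap.comp_apply, extPar_apply, ContinuousAlternatingMap.smul_apply, smul_eq_mul,
      pow_succ]
    ring

/-- Associativity for ∑ e^i ∧ F(e_i). As the one-forms e^i do not occur explicitly in `extAlt`, the
proof is again by contraction and induction on degree. -/
theorem extMul_extAlt_left (F : Euc d →ₗ[ℝ] Ext (Euc d)) (β : Ext (Euc d)) :
    extMul (extAlt F) β = extAlt ((extMul.flip β).comp F) := by
  funext n
  induction n generalizing F β with
  | zero =>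
    ext v
    rw [extMul_apply_zero, extAlt_apply_zero, extAlt_apply_zero]
    simp
  | succ n ih =>
    refine eq_of_contract_eq fun X => ?_
    rw [← extContract_apply, ← extContract_apply, extContract_extMul, extContract_extAlt,
      extContract_extAlt, extPar_extAlt]
    have hsplit : (extContract X).comp ((extMul.flip β).comp F) =
        (extMul.flip β).comp ((extContract X).comp F) +
          (extMul.flip (extContract X β)).comp (extPar.comp F) := by
      refine LinearMap.ext fun v => ?_
      exact extContract_extMul X (F v) β
    rw [hsplit, map_add, map_sub, map_neg, LinearMap.sub_apply, LinearMap.neg_apply]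
    simp only [Pi.add_apply, Pi.sub_apply, Pi.neg_apply, ih]
    rw [LinearMap.comp_apply, LinearMap.flip_apply]
    abel

/-- Moving the one-form e^i in front of α costs the grading automorphism. This is the origin of the
sign in the Leibniz rule for `d`. -/
theorem extMul_extAlt_right (α : Ext (Euc d)) (F : Euc d →ₗ[ℝ] Ext (Euc d)) :
    extMul (extPar α) (extAlt F) = extAlt ((extMul α).comp F) := by
  funext n
  induction n generalizing F α with
  | zero =>
    ext v
    rw [extMul_apply_zero, extAlt_apply_zero, extAlt_apply_zero]
    simp
  | succ n ih =>
    refine eq_of_contract_eq fun X => ?_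
    rw [← extContract_apply, ← extContract_apply, extContract_extMul, extContract_extAlt,
      extContract_extAlt, extPar_extPar, extContract_extPar]
    have hsplit : (extContract X).comp ((extMul α).comp F) =
        (extMul (extContract X α)).comp F +
          (extMul (extPar α)).comp ((extContract X).comp F) := by
      refine LinearMap.ext fun v => ?_
      exact extContract_extMul X α (F v)
    rw [hsplit, map_add, map_sub, map_neg, LinearMap.neg_apply]
    have h1 := ih (extPar α) ((extContract X).comp F)
    rw [extPar_extPar] at h1
    simp only [Pi.add_apply, Pi.sub_apply, Pi.neg_apply, ih, h1]
    rw [LinearMap.comp_apply]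
    abel

end ExtAlt

/-! ### Local representatives of forms and vector fields -/

section Local
variable {d : ℕ} {M : Type*} [TopologicalSpace M] [ChartedSpace (Euc d) M]

/-- The local representative of a homogeneous form, as a linear map. -/
def locLin (φ : OpenPartialHomeomorph M (Euc d)) (y : Euc d) (k : ℕ) :
    DiffForm d M k →ₗ[ℝ] Euc d [⋀^Fin k]→L[ℝ] ℝ where
  toFun η := localForm φ η.1 y
  map_add' _ _ := rfl
  map_smul' _ _ := rfl

/-- The local representative of an inhomogeneous form. -/
def loc (φ : OpenPartialHomeomorph M (Euc d)) (y : Euc d) : Forms d M →ₗ[ℝ] Ext (Euc d) where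
  toFun η k := localForm φ (η k).1 y
  map_add' _ _ := rfl
  map_smul' _ _ := rfl

theorem loc_apply (φ : OpenPartialHomeomorph M (Euc d)) (y : Euc d) (η : Forms d M) (k : ℕ) :
    loc φ y η k = localForm φ (η k).1 y := rfl

/-- The derivative of the local representative of an inhomogeneous form. -/
def locD (φ : OpenPartialHomeomorph M (Euc d)) (y : Euc d) (η : Forms d M) :
    Euc d →ₗ[ℝ] Ext (Euc d) :=
  LinearMap.pi fun k => (fderiv ℝ (localForm φ (η k).1) y).toLinearMap

theorem locD_apply (φ : OpenPartialHomeomorph M (Euc d)) (y : Euc d) (η : Forms d M) (v : Euc d)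
    (k : ℕ) : locD φ y η v k = fderiv ℝ (localForm φ (η k).1) y v := rfl

theorem differentiableAt_localForm {φ : OpenPartialHomeomorph M (Euc d)} (hφ : φ ∈ maxAtlas d M)
    {y : Euc d} (hy : y ∈ φ.target) {k : ℕ} (η : DiffForm d M k) :
    DifferentiableAt ℝ (localForm φ η.1) y :=
  ((η.2 φ hφ).contDiffAt (φ.open_target.mem_nhds hy)).differentiableAt (by simp)

theorem loc_leftMul (φ : OpenPartialHomeomorph M (Euc d)) (y : Euc d) (η ζ : Forms d M) :
    loc φ y (leftMul η ζ) = extMul (loc φ y η) (loc φ y ζ) := by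
  funext n
  change locLin φ y n (∑ p : Fin (n + 1), _) = _
  rw [map_sum, extMul_apply]
  refine Finset.sum_congr rfl fun p _ => ?_
  change localForm φ _ y = _
  rw [loc_apply, loc_apply, localForm, localForm, localForm, ← wedge_comp]
  rfl

theorem locD_leftMul {φ : OpenPartialHomeomorph M (Euc d)} (hφ : φ ∈ maxAtlas d M) {y : Euc d}
    (hy : y ∈ φ.target) (η ζ : Forms d M) (v : Euc d) :
    locD φ y (leftMul η ζ) v =
      extMul (locD φ y η v) (loc φ y ζ) + extMul (loc φ y η) (locD φ y ζ v) := by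
  funext n
  rw [locD_apply, Pi.add_apply]
  have h1 : localForm φ (leftMul η ζ n).1 = fun z => ∑ p : Fin (n + 1),
      (wedgeLin (V := Euc d) (Nat.add_sub_of_le (Nat.lt_succ_iff.1 p.2))).toContinuousBilinearMap
        (localForm φ (η p).1 z) (localForm φ (ζ (n - p)).1 z) := by
    funext z
    exact congrFun (loc_leftMul φ z η ζ) n
  have h2 (p : Fin (n + 1)) := ContinuousLinearMap.hasFDerivAt_of_bilinear
    (wedgeLin (V := Euc d) (Nat.add_sub_of_le (Nat.lt_succ_iff.1 p.2))).toContinuousBilinearMap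
    (differentiableAt_localForm hφ hy (η p)).hasFDerivAt
    (differentiableAt_localForm hφ hy (ζ (n - p))).hasFDerivAt
  rw [h1, (HasFDerivAt.fun_sum fun p _ => h2 p).fderiv, extMul_apply, extMul_apply,
    ← Finset.sum_add_distrib, sum_apply]
  refine Finset.sum_congr rfl fun p _ => ?_
  exact add_comm _ _

/-- Pullback along the inverse chart applies the inverse of `frame`, and `coframe` is that inverse
on both sides. Lie brackets of vector fields can thereby be computed in coordinates. -/
theorem mpullback_symm {φ : OpenPartialHomeomorph M (Euc d)} (hφ : φ ∈ maxAtlas d M) {y : Euc d}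
    (hy : y ∈ φ.target) (X : ∀ x : M, TangentSpace (𝓡 d) x) :
    VectorField.mpullback (𝓡 d) (𝓡 d) φ.symm X y = localField φ X y := by
  have h1 : (frame φ y).comp (coframe φ (φ.symm y)) = ContinuousLinearMap.id ℝ _ :=
    ContinuousLinearMap.ext fun v => frame_coframe hφ hy v
  have h2 : (coframe φ (φ.symm y)).comp (frame φ y) = ContinuousLinearMap.id ℝ _ := by
    rw [coframe_frame hφ hφ hy (φ.map_target hy)]
    have : (fun z => φ (φ.symm z)) =ᶠ[𝓝 y] id := φ.eventually_right_inverse hy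
    rw [this.fderiv_eq, fderiv_id]
  have h3 : (frame φ y).inverse = coframe φ (φ.symm y) :=
    ContinuousLinearMap.inverse_eq h1 h2
  exact DFunLike.congr_fun h3 (X (φ.symm y))

variable [IsManifold (𝓡 d) ∞ M]

/-- At the centre of the preferred chart, every tangent vector is the `frame` image of its
coordinates, so the local representative determines the form there. -/
theorem forms_ext {η ζ : Forms d M}
    (h : ∀ φ ∈ maxAtlas d M, ∀ y ∈ φ.target, loc φ y η = loc φ y ζ) : η = ζ := by
  funext k
  refine Subtype.ext (funext fun x => ?_)
  set φ := chartAt (Euc d) x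
  have hφ : φ ∈ maxAtlas d M := IsManifold.chart_mem_maximalAtlas x
  have hy : φ x ∈ φ.target := mem_chart_target _ x
  have key : (η k).1 (φ.symm (φ x)) = (ζ k).1 (φ.symm (φ x)) := by
    ext v
    have h1 := DFunLike.congr_fun (congrFun (h φ hφ _ hy) k)
      fun i => coframe φ (φ.symm (φ x)) (v i)
    rw [loc_apply, loc_apply, localForm, localForm,
      ContinuousAlternatingMap.compContinuousLinearMap_apply,
      ContinuousAlternatingMap.compContinuousLinearMap_apply] at h1
    have h3 : (⇑(frame φ (φ x)) ∘ fun i => coframe φ (φ.symm (φ x)) (v i)) = v :=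
      funext fun i => frame_coframe hφ hy (v i)
    rwa [h3] at h1
  rwa [φ.left_inv (mem_chart_source _ x)] at key

theorem loc_iota {φ : OpenPartialHomeomorph M (Euc d)} (hφ : φ ∈ maxAtlas d M) {y : Euc d}
    (hy : y ∈ φ.target) (X : VField d M) (η : Forms d M) :
    loc φ y (iota X η) = extContract (localField φ X y) (loc φ y η) := by
  funext k
  rw [extContract_apply, loc_apply, loc_apply]
  rw [localForm, localForm, localField]
  refine Eq.trans ?_ (contract_comp ((η (k + 1)).1 (φ.symm y)) (frame φ y)
    (coframe φ (φ.symm y) (X (φ.symm y))))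
  rw [frame_coframe hφ hy]
  rfl

theorem loc_deRham {φ : OpenPartialHomeomorph M (Euc d)} (hφ : φ ∈ maxAtlas d M) {y : Euc d}
    (hy : y ∈ φ.target) (η : Forms d M) :
    loc φ y (deRham η) = extAlt (locD φ y η) := by
  funext k
  cases k with
  | zero => exact map_zero (locLin φ y 0)
  | succ k =>
    refine (localForm_roughExtDeriv hφ (η k).2 hy).trans ?_
    exact congrArg ContinuousAlternatingMap.alternatizeUncurryFin (by ext; rfl)

theorem differentiableAt_localField {φ : OpenPartialHomeomorph M (Euc d)} (hφ : φ ∈ maxAtlas d M)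
    {y : Euc d} (hy : y ∈ φ.target) (X : VField d M) :
    DifferentiableAt ℝ (localField φ X) y :=
  ((localField_contDiffOn hφ X).contDiffAt (φ.open_target.mem_nhds hy)).differentiableAt (by simp)

theorem locD_iota {φ : OpenPartialHomeomorph M (Euc d)} (hφ : φ ∈ maxAtlas d M) {y : Euc d}
    (hy : y ∈ φ.target) (X : VField d M) (η : Forms d M) (v : Euc d) :
    locD φ y (iota X η) v = extContract (fderiv ℝ (localField φ X) y v) (loc φ y η) +
      extContract (localField φ X y) (locD φ y η v) := by
  funext k
  rw [locD_apply, Pi.add_apply]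
  have h1 : localForm φ (iota X η k).1 =ᶠ[𝓝 y] fun z =>
      (contractLin (V := Euc d)).toContinuousBilinearMap
        (localField φ X z) (localForm φ (η (k + 1)).1 z) := by
    filter_upwards [φ.open_target.mem_nhds hy] with z hz
    exact congrFun (loc_iota hφ hz X η) k
  have h2 := ContinuousLinearMap.hasFDerivAt_of_bilinear
    (contractLin (V := Euc d)).toContinuousBilinearMap
    (differentiableAt_localField hφ hy X).hasFDerivAt
    (differentiableAt_localForm hφ hy (η (k + 1))).hasFDerivAt
  rw [h1.fderiv_eq, h2.fderiv]
  exact add_comm _ _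

/-- The Lie bracket is natural under pullback by the inverse chart, and on the model space it is the
coordinate bracket of vector-valued functions. -/
theorem localField_vbracket {φ : OpenPartialHomeomorph M (Euc d)} (hφ : φ ∈ maxAtlas d M)
    {y : Euc d} (hy : y ∈ φ.target) (X Y : VField d M) :
    localField φ (vbracket X Y) y =
      fderiv ℝ (localField φ Y) y (localField φ X y) -
        fderiv ℝ (localField φ X) y (localField φ Y y) := by
  have hM : IsManifold (𝓡 d) (minSmoothness ℝ 3) M := by
    rw [minSmoothness_of_isRCLikeNormedField]
    exact IsManifold.of_le (n := ∞) (WithTop.coe_le_coe.2 (le_top : (3 : ℕ∞) ≤ ⊤))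
  rw [← mpullback_symm hφ hy]
  have hX (Z : VField d M) : MDifferentiableAt (𝓡 d) (𝓡 d).tangent
      (fun x => (⟨x, Z x⟩ : TangentBundle (𝓡 d) M)) (φ.symm y) :=
    (Z.contMDiff _).mdifferentiableAt (by simp)
  have h := VectorField.mpullback_mlieBracket (I := 𝓡 d) (I' := 𝓡 d) (n := ∞) (hX X) (hX Y)
    (contMDiffAt_symm_of_mem_maximalAtlas hφ hy)
    (by rw [minSmoothness_of_isRCLikeNormedField]; exact two_le_infty)
  refine h.trans ?_
  have hZ (Z : VField d M) : VectorField.mpullback (𝓡 d) (𝓡 d) φ.symm Z =ᶠ[𝓝 y]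
      localField φ Z := by
    filter_upwards [φ.open_target.mem_nhds hy] with z hz
    exact mpullback_symm hφ hz Z
  refine (Filter.EventuallyEq.mlieBracket_vectorField_eq (hZ X) (hZ Y)).trans ?_
  have h4 := congrFun (VectorField.mlieBracketWithin_eq_lieBracketWithin (𝕜 := ℝ)
    (V := localField φ X) (W := localField φ Y) (s := Set.univ)) y
  rw [VectorField.lieBracketWithin_univ] at h4
  exact h4

end Local

/-! ### The Cartan calculus -/

section Cartan
variable {d : ℕ} {M : Type*} [TopologicalSpace M] [ChartedSpace (Euc d) M]
  [IsManifold (𝓡 d) ∞ M]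

/-- The local expression of the Lie derivative. -/
theorem loc_lieD {φ : OpenPartialHomeomorph M (Euc d)} (hφ : φ ∈ maxAtlas d M) {y : Euc d}
    (hy : y ∈ φ.target) (X : VField d M) (η : Forms d M) :
    loc φ y (lieD X η) = locD φ y η (localField φ X y) +
      extAlt ((extContract.flip (loc φ y η)).comp (fderiv ℝ (localField φ X) y).toLinearMap) := by
  have h : locD φ y (iota X η) =
      (extContract.flip (loc φ y η)).comp (fderiv ℝ (localField φ X) y).toLinearMap +
        (extContract (localField φ X y)).comp (locD φ y η) :=
    LinearMap.ext fun v => locD_iota hφ hy X η v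
  -- The terms `extAlt (i_X ∘ Dη)` come with opposite signs from i_X d and d i_X and cancel.
  rw [lieD_apply, map_add, loc_iota hφ hy, loc_deRham hφ hy, loc_deRham hφ hy, h, map_add,
    extContract_extAlt]
  abel

/-- Cartan's formula `i_{[X,Y]} = [L_X, i_Y]`. -/
theorem iota_vbracket (X Y : VField d M) (η : Forms d M) :
    iota (vbracket X Y) η = lieD X (iota Y η) - iota Y (lieD X η) := by
  refine forms_ext fun φ hφ y hy => ?_
  rw [map_sub, loc_iota hφ hy, loc_lieD hφ hy, loc_iota hφ hy, loc_iota hφ hy, loc_lieD hφ hy,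
    locD_iota hφ hy, map_add (extContract (localField φ Y y)), extContract_extAlt,
    localField_vbracket hφ hy, map_sub, LinearMap.sub_apply]
  -- Contractions with Y and with the derivatives of X anticommute, so the antisymmetrized terms
  -- cancel. What is left is contraction with DY(X) - DX(Y), the coordinate bracket.
  have h : (extContract.flip (extContract (localField φ Y y) (loc φ y η))).comp
        (fderiv ℝ (localField φ X) y).toLinearMap =
      -((extContract (localField φ Y y)).comp ((extContract.flip (loc φ y η)).comp
        (fderiv ℝ (localField φ X) y).toLinearMap)) :=
    LinearMap.ext fun v => extContract_extContract _ _ _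
  have h' := congrArg extAlt h
  rw [show extAlt (-_) = -extAlt _ from map_neg extAlt _] at h'
  rw [h', LinearMap.comp_apply, LinearMap.flip_apply]
  change _ = _ + _ + _ - (_ + (extContract (fderiv ℝ (localField φ X) y (localField φ Y y)) _ - _))
  abel

end Cartan

/-! ### The operator realization -/

section Operators
variable {d : ℕ} {M : Type*} [TopologicalSpace M] [ChartedSpace (Euc d) M]

/-- Operators of parity `f`. -/
def HomOp (f : ZMod 2) (T : Module.End ℝ (Forms d M)) : Prop :=
  ∀ e η, formParity (e + f) (T η) = T (formParity e η)

theorem neg_smul_operator (r : ℝ) (T : Module.End ℝ (Forms d M)) : -r • T = -(r • T) :=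
  LinearMap.ext fun η => funext fun k => neg_smul r (T η k)

theorem neg_one_smul_operator (T : Module.End ℝ (Forms d M)) : (-1 : ℝ) • T = -T :=
  LinearMap.ext fun η => funext fun k => neg_one_smul ℝ (T η k)

theorem operator_mul_neg (S T : Module.End ℝ (Forms d M)) : S * -T = -(S * T) :=
  LinearMap.ext fun η => map_neg S (T η)

theorem operator_neg_mul (S T : Module.End ℝ (Forms d M)) : -S * T = -(S * T) := rfl

theorem HomOp.mul {e f : ZMod 2} {S T : Module.End ℝ (Forms d M)} (hS : HomOp e S)
    (hT : HomOp f T) : HomOp (f + e) (S * T) := fun g η => by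
  rw [Module.End.mul_apply, ← add_assoc, hS, hT, Module.End.mul_apply]

theorem HomOp.add {f : ZMod 2} {S T : Module.End ℝ (Forms d M)} (hS : HomOp f S)
    (hT : HomOp f T) : HomOp f (S + T) := fun g η => by
  rw [LinearMap.add_apply, map_add, hS, hT, LinearMap.add_apply]

theorem opParity_eq {f : ZMod 2} {T : Module.End ℝ (Forms d M)} (hT : HomOp f T) (e : ZMod 2) :
    opParity e T = if e = f then T else 0 := by
  refine LinearMap.ext fun η => ?_
  rw [opParity, LinearMap.sum_apply]
  have h (g : ZMod 2) : (formParity (g + e) * T * formParity g : Module.End ℝ (Forms d M)) η =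
      if e = f then T (formParity g η) else 0 := by
    rw [Module.End.mul_apply, Module.End.mul_apply, ← hT, formParity_formParity]
    simp only [add_right_inj]
  rw [Finset.sum_congr rfl fun g _ => h g]
  split_ifs
  · rw [← map_sum, sum_formParity]
  · simp

theorem opParity_add (e : ZMod 2) (S T : Module.End ℝ (Forms d M)) :
    opParity e (S + T) = opParity e S + opParity e T := by
  simp [opParity, mul_add, add_mul, Finset.sum_add_distrib]

theorem opParity_smul (e : ZMod 2) (c : ℝ) (T : Module.End ℝ (Forms d M)) :
    opParity e (c • T) = c • opParity e T := by
  simp [opParity, Finset.smul_sum]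

theorem superCommutator_eq {e f : ZMod 2} {S T : Module.End ℝ (Forms d M)} (hS : HomOp e S)
    (hT : HomOp f T) : superCommutator S T = S * T - sgn (e * f) • (T * S) := by
  rw [superCommutator, Finset.sum_eq_single e, Finset.sum_eq_single f]
  · rw [opParity_eq hS, opParity_eq hT, if_pos rfl, if_pos rfl]
  · intro g _ hg
    rw [opParity_eq hT, if_neg hg]
    simp
  · simp
  · intro g _ hg
    rw [opParity_eq hS, if_neg hg]
    simp
  · simp

theorem superCommutator_isBilin :
    IsBilin (superCommutator : Module.End ℝ (Forms d M) → _ → Module.End ℝ (Forms d M)) where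
  add_left a b c := by
    simp only [superCommutator, opParity_add, ← Finset.sum_add_distrib]
    refine Finset.sum_congr rfl fun e _ => Finset.sum_congr rfl fun f _ => ?_
    rw [add_mul, mul_add, smul_add]
    abel
  smul_left r a c := by
    simp only [superCommutator, opParity_smul, Finset.smul_sum]
    refine Finset.sum_congr rfl fun e _ => Finset.sum_congr rfl fun f _ => ?_
    rw [smul_mul_assoc, mul_smul_comm, smul_sub, smul_comm r]
  add_right a b c := by
    simp only [superCommutator, opParity_add, ← Finset.sum_add_distrib]
    refine Finset.sum_congr rfl fun e _ => Finset.sum_congr rfl fun f _ => ?_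
    rw [add_mul, mul_add, smul_add]
    abel
  smul_right r a c := by
    simp only [superCommutator, opParity_smul, Finset.smul_sum]
    refine Finset.sum_congr rfl fun e _ => Finset.sum_congr rfl fun f _ => ?_
    rw [smul_mul_assoc, mul_smul_comm, smul_sub, smul_comm r]

theorem wedgeForm_zero_left {p q n : ℕ} (h : p + q = n) (ζ : DiffForm d M q) :
    wedgeForm h (0 : DiffForm d M p) ζ = 0 := by
  refine Subtype.ext (funext fun x => ?_)
  exact LinearMap.congr_fun (map_zero (wedgeLin (V := TangentSpace (𝓡 d) x) h)) (ζ.1 x)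

theorem leftMul_apply (η ζ : Forms d M) (n : ℕ) : leftMul η ζ n = ∑ p : Fin (n + 1),
    wedgeForm (Nat.add_sub_of_le (Nat.lt_succ_iff.1 p.2)) (η p) (ζ (n - p)) := rfl

theorem homOp_leftMul {f : ZMod 2} {η : Forms d M} (h : formParity f η = η) :
    HomOp f (leftMul η) := fun e ζ => by
  funext n
  have key (p : Fin (n + 1)) :
      (if (n : ZMod 2) = e + f then
        wedgeForm (Nat.add_sub_of_le (Nat.lt_succ_iff.1 p.2)) (η p) (ζ (n - p)) else 0) =
      wedgeForm (Nat.add_sub_of_le (Nat.lt_succ_iff.1 p.2)) (η p) (formParity e ζ (n - p)) := by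
    by_cases hp : ((p : ℕ) : ZMod 2) = f
    · have hn : (n : ZMod 2) = ((n - p : ℕ) : ZMod 2) + f := by
        rw [← hp, ← Nat.cast_add, Nat.sub_add_cancel (Nat.lt_succ_iff.1 p.2)]
      rw [hn, formParity_apply]
      simp only [add_left_inj]
      split_ifs <;> simp
    · have h0 : η p = 0 := by rw [← h, formParity_apply, if_neg hp]
      rw [h0, wedgeForm_zero_left, wedgeForm_zero_left, ite_self]
  rw [leftMul_apply, ← Finset.sum_congr rfl fun p _ => key p, formParity_apply, leftMul_apply]
  split_ifs <;> simp

theorem extPar_loc {e : ZMod 2} {η : Forms d M} (h : formParity e η = η)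
    (φ : OpenPartialHomeomorph M (Euc d)) (y : Euc d) :
    extPar (loc φ y η) = sgn e • loc φ y η := by
  funext k
  rw [extPar_apply, Pi.smul_apply, loc_apply]
  by_cases hk : (k : ZMod 2) = e
  · rw [← hk, sgn_natCast]
  · have : η k = 0 := by rw [← h, formParity_apply, if_neg hk]
    rw [this]
    have h0 : localForm φ (0 : DiffForm d M k).1 y = 0 := map_zero (locLin φ y k)
    rw [h0, smul_zero, smul_zero]

/-- Supercommutators have a closed formula only for homogeneous operators. This extends identities
from homogeneous forms to all forms. -/
theorem linearMap_ext_of_parity {A : Type*} [AddCommGroup A] [Module ℝ A]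
    {K L : Forms d M →ₗ[ℝ] A} (h : ∀ e η, formParity e η = η → K η = L η) (η : Forms d M) :
    K η = L η := by
  rw [← sum_formParity η, map_sum, map_sum]
  exact Finset.sum_congr rfl fun e _ => h e _ (formParity_self e η)

variable [IsManifold (𝓡 d) ∞ M]

theorem homOp_iota (X : VField d M) : HomOp 1 (iota X) := fun e η => by
  rw [formParity_iota, zmod2_add_one_add_one]

theorem homOp_deRham : HomOp 1 (deRham : Module.End ℝ (Forms d M)) := fun e η =>
  formParity_deRham e η

/-- Left multiplication as a linear map. -/
def leftMulLin : Forms d M →ₗ[ℝ] Module.End ℝ (Forms d M) where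
  toFun := leftMul
  map_add' η ζ := LinearMap.ext fun ξ => forms_ext fun φ hφ y hy => by
    rw [LinearMap.add_apply, map_add, loc_leftMul, loc_leftMul, loc_leftMul, map_add, map_add,
      LinearMap.add_apply]
  map_smul' c η := LinearMap.ext fun ξ => forms_ext fun φ hφ y hy => by
    rw [RingHom.id_apply, LinearMap.smul_apply, map_smul, loc_leftMul, loc_leftMul, map_smul,
      map_smul, LinearMap.smul_apply]

theorem leftMulLin_apply (η : Forms d M) : leftMulLin η = leftMul η := rfl

theorem opParity_leftMul (e : ZMod 2) (η : Forms d M) :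
    opParity e (leftMul η) = leftMul (formParity e η) := by
  have h : leftMul η = ∑ f, leftMul (formParity f η) := by
    simp only [← leftMulLin_apply]
    rw [← map_sum, sum_formParity]
  let L : Module.End ℝ (Forms d M) →ₗ[ℝ] Module.End ℝ (Forms d M) :=
    { toFun := opParity e, map_add' := opParity_add e, map_smul' := opParity_smul e }
  change L (leftMul η) = _
  rw [h, map_sum, Finset.sum_eq_single e]
  · exact (opParity_eq (homOp_leftMul (formParity_self e η)) e).trans (if_pos rfl)
  · intro f _ hf
    exact (opParity_eq (homOp_leftMul (formParity_self f η)) e).trans (if_neg (Ne.symm hf))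
  · simp

/-- Graded commutativity of the wedge product, transferred to operators through local
representatives. -/
theorem leftMul_mul_leftMul {e f : ZMod 2} {η ζ : Forms d M} (hη : formParity e η = η)
    (hζ : formParity f ζ = ζ) :
    leftMul η * leftMul ζ = sgn (e * f) • (leftMul ζ * leftMul η) := by
  refine LinearMap.ext fun ξ => forms_ext fun φ hφ y hy => ?_
  rw [LinearMap.smul_apply, map_smul, Module.End.mul_apply, Module.End.mul_apply, loc_leftMul,
    loc_leftMul, loc_leftMul, loc_leftMul, ← extMul_assoc, ← extMul_assoc,
    ← LinearMap.smul_apply, ← map_smul]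
  congr 2
  have h := extPar_loc hη φ y
  rcases zmod2_cases e with rfl | rfl
  · rw [extMul_comm_of_even (by simpa using h)]
    simp
  · rw [extMul_comm_of_odd (by rw [h, sgn_one]; exact funext fun k => neg_one_smul ℝ (loc φ y η k)), extPar_loc hζ φ y, one_mul, map_smul,
      LinearMap.smul_apply]

theorem iota_mul_leftMul {e : ZMod 2} (X : VField d M) {η : Forms d M}
    (hη : formParity e η = η) :
    iota X * leftMul η = leftMul (iota X η) + sgn e • (leftMul η * iota X) := by
  refine LinearMap.ext fun ξ => forms_ext fun φ hφ y hy => ?_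
  rw [LinearMap.add_apply, map_add, LinearMap.smul_apply, map_smul, Module.End.mul_apply,
    Module.End.mul_apply, loc_iota hφ hy, loc_leftMul, loc_leftMul, loc_leftMul, loc_iota hφ hy,
    loc_iota hφ hy, extContract_extMul, extPar_loc hη, map_smul, LinearMap.smul_apply]

/-- The product rule for components is antisymmetrized. The term in which ξ is differentiated
acquires the sign of moving e^i past η. -/
theorem deRham_mul_leftMul {e : ZMod 2} {η : Forms d M} (hη : formParity e η = η) :
    deRham * leftMul η = leftMul (deRham η) + sgn e • (leftMul η * deRham) := by
  refine LinearMap.ext fun ξ => forms_ext fun φ hφ y hy => ?_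
  have h : locD φ y (leftMul η ξ) = (extMul.flip (loc φ y ξ)).comp (locD φ y η) +
      (extMul (loc φ y η)).comp (locD φ y ξ) := LinearMap.ext fun v => locD_leftMul hφ hy η ξ v
  rw [LinearMap.add_apply, map_add, LinearMap.smul_apply, map_smul, Module.End.mul_apply,
    Module.End.mul_apply, loc_deRham hφ hy, loc_leftMul, loc_leftMul, loc_deRham hφ hy,
    loc_deRham hφ hy, h, map_add, ← extMul_extAlt_left, ← extMul_extAlt_right, extPar_loc hη,
    map_smul, LinearMap.smul_apply]

/-- Both i_X and d are antiderivations, and in i_X d + d i_X the mixed terms with one operator on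
each factor cancel, for either parity of η. -/
theorem lieD_mul_leftMul {e : ZMod 2} (X : VField d M) {η : Forms d M}
    (hη : formParity e η = η) :
    lieD X * leftMul η = leftMul (lieD X η) + leftMul η * lieD X := by
  have h1 := iota_mul_leftMul X (deRham_formParity_fixed hη)
  have h2 := iota_mul_leftMul X hη
  have h3 := deRham_mul_leftMul (iota_formParity_fixed X hη)
  have h4 := deRham_mul_leftMul hη
  have h5 : leftMul (lieD X η) = leftMul (iota X (deRham η)) + leftMul (deRham (iota X η)) :=
    leftMulLin.map_add _ _
  have h6 : sgn (1 + 1 : ZMod 2) = 1 := by rw [sgn_add, sgn_one]; norm_num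
  rcases zmod2_cases e with rfl | rfl
  · rw [zero_add, sgn_one, neg_one_smul_operator] at h1 h3
    rw [sgn_zero, one_smul] at h2 h4
    rw [h5, lieD, add_mul, mul_assoc, mul_assoc, h4, h2, mul_add, mul_add, h1, h3, ← mul_assoc,
      ← mul_assoc, h2, h4, mul_add, add_mul, add_mul, mul_assoc, mul_assoc]
    abel
  · rw [h6, one_smul] at h1 h3
    rw [sgn_one, neg_one_smul_operator] at h2 h4
    rw [h5, lieD, add_mul, mul_assoc, mul_assoc, h4, h2, mul_add, mul_add, h1, h3, operator_mul_neg,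
      operator_mul_neg,
      ← mul_assoc, ← mul_assoc, h2, h4, mul_add, add_mul, add_mul, operator_neg_mul,
      operator_neg_mul, mul_assoc,
      mul_assoc]
    abel

/-- The bracket with a fixed element as a linear map. -/
def IsBilin.rightLin {A : Type*} [AddCommGroup A] [Module ℝ A] {br : A → A → A} (h : IsBilin br)
    (a : A) : A →ₗ[ℝ] A where
  toFun := br a
  map_add' := h.add_right a
  map_smul' r := h.smul_right r a

/-- The bracket with a fixed element as a linear map. -/
def IsBilin.leftLin {A : Type*} [AddCommGroup A] [Module ℝ A] {br : A → A → A} (h : IsBilin br)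
    (a : A) : A →ₗ[ℝ] A where
  toFun b := br b a
  map_add' b c := h.add_left b c a
  map_smul' r b := h.smul_left r b a

theorem superCommutator_leftMul_iota {e : ZMod 2} {η : Forms d M} (X : VField d M)
    (h : formParity e η = η) :
    superCommutator (leftMul η) (iota X) = -sgn e • leftMul (iota X η) := by
  rw [superCommutator_eq (homOp_leftMul h) (homOp_iota X), iota_mul_leftMul X h, mul_one, smul_add,
    smul_smul, sgn_mul_self, neg_smul_operator, one_smul]
  abel

theorem superCommutator_leftMul_leftMul (η ζ : Forms d M) :
    superCommutator (leftMul η) (leftMul ζ) = 0 := by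
  refine linearMap_ext_of_parity (K := (superCommutator_isBilin.leftLin (leftMul ζ)).comp leftMulLin)
    (L := 0) (fun e η hη => ?_) η
  refine linearMap_ext_of_parity (K := (superCommutator_isBilin.rightLin (leftMul η)).comp leftMulLin)
    (L := 0) (fun f ζ hζ => ?_) ζ
  change superCommutator (leftMul η) (leftMul ζ) = 0
  rw [superCommutator_eq (homOp_leftMul hη) (homOp_leftMul hζ), leftMul_mul_leftMul hη hζ, sub_self]

theorem homOp_lieD (X : VField d M) : HomOp 0 (lieD X) :=
  ((homOp_iota X).mul homOp_deRham).add (homOp_deRham.mul (homOp_iota X))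

theorem superCommutator_twisted_iota {H : Forms d M} (hH : formParity 1 H = H) (X : VField d M) :
    superCommutator (deRham + leftMul H) (iota X) = lieD X + leftMul (iota X H) := by
  rw [superCommutator_isBilin.add_left, superCommutator_leftMul_iota X hH,
    superCommutator_eq homOp_deRham (homOp_iota X), lieD]
  simp only [mul_one, sgn_one, neg_smul_operator, one_smul, neg_neg, sub_neg_eq_add]
  abel

theorem superCommutator_twisted_leftMul (H η : Forms d M) :
    superCommutator (deRham + leftMul H) (leftMul η) = leftMul (deRham η) := by
  refine linearMap_ext_of_parity
    (K := (superCommutator_isBilin.rightLin (deRham + leftMul H)).comp leftMulLin)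
    (L := leftMulLin.comp deRham) (fun e η hη => ?_) η
  change superCommutator (deRham + leftMul H) (leftMul η) = leftMul (deRham η)
  rw [superCommutator_isBilin.add_left, superCommutator_leftMul_leftMul, add_zero,
    superCommutator_eq homOp_deRham (homOp_leftMul hη), deRham_mul_leftMul hη, one_mul,
    add_sub_cancel_right]

theorem superCommutator_lieD_leftMul (X : VField d M) (η : Forms d M) :
    superCommutator (lieD X) (leftMul η) = leftMul (lieD X η) := by
  refine linearMap_ext_of_parity
    (K := (superCommutator_isBilin.rightLin (lieD X)).comp leftMulLin)
    (L := leftMulLin.comp (lieD X)) (fun e η hη => ?_) η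
  change superCommutator (lieD X) (leftMul η) = leftMul (lieD X η)
  rw [superCommutator_eq (homOp_lieD X) (homOp_leftMul hη), lieD_mul_leftMul X hη, zero_mul,
    sgn_zero, one_smul, add_sub_cancel_right]

theorem superCommutator_iota_leftMul (X : VField d M) (η : Forms d M) :
    superCommutator (iota X) (leftMul η) = leftMul (iota X η) := by
  refine linearMap_ext_of_parity
    (K := (superCommutator_isBilin.rightLin (iota X)).comp leftMulLin)
    (L := leftMulLin.comp (iota X)) (fun e η hη => ?_) η
  change superCommutator (iota X) (leftMul η) = leftMul (iota X η)
  rw [superCommutator_eq (homOp_iota X) (homOp_leftMul hη), iota_mul_leftMul X hη, one_mul,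
    add_sub_cancel_right]

theorem superCommutator_iota_iota (X Y : VField d M) :
    superCommutator (iota X) (iota Y) = 0 := by
  rw [superCommutator_eq (homOp_iota X) (homOp_iota Y), mul_one, sgn_one, neg_smul_operator,
    one_smul, iota_mul_iota X Y, sub_neg_eq_add, neg_add_cancel]

theorem superCommutator_lieD_iota (X Y : VField d M) :
    superCommutator (lieD X) (iota Y) = iota (vbracket X Y) := by
  rw [superCommutator_eq (homOp_lieD X) (homOp_iota Y), zero_mul, sgn_zero, one_smul]
  exact LinearMap.ext fun η => (iota_vbracket X Y η).symm

/-- The untwisted part is Cartan's formula. The twist `i_X H` is even, so its bracket with `i_Y` is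
`-i_Y i_X H`, which equals `i_X i_Y H`. -/
theorem superCommutator_twisted_iota_iota {H : Forms d M} (hH : formParity 1 H = H)
    (X Y : VField d M) :
    superCommutator (superCommutator (deRham + leftMul H) (iota X)) (iota Y) =
      iota (vbracket X Y) + leftMul (iota X (iota Y H)) := by
  have h : formParity 0 (iota X H) = iota X H := iota_formParity_fixed X hH
  have hn : leftMul (-iota Y (iota X H)) = -leftMul (iota Y (iota X H)) := map_neg leftMulLin _
  rw [superCommutator_twisted_iota hH, superCommutator_isBilin.add_left,
    superCommutator_leftMul_iota Y h, superCommutator_lieD_iota, sgn_zero, neg_smul_operator,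
    one_smul, iota_iota X Y, hn]

/-- The operators on forms realize the Cartan calculus. -/
theorem isCartanModel_operators {H : Forms d M} (hH : formParity 1 H = H) :
    IsCartanModel H 0 opParity superCommutator (deRham + leftMul H) iota leftMulLin where
  bilin := superCommutator_isBilin
  parity_H := by rwa [add_zero]
  v_zero := iota_zero
  par_m e η := opParity_leftMul e η
  par_v e X := by rw [opParity_eq (homOp_iota X), add_zero]
  br_m_m η ζ := superCommutator_leftMul_leftMul η ζ
  br_m_v e η X h := by
    rw [add_zero]
    exact superCommutator_leftMul_iota X h
  br_Q_m η := superCommutator_twisted_leftMul H η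
  br_Q_v_m X η := by
    rw [superCommutator_twisted_iota hH, superCommutator_isBilin.add_left]
    exact (congrArg₂ _ (superCommutator_lieD_leftMul X η)
      (superCommutator_leftMul_leftMul (iota X H) η)).trans (add_zero _)
  br_Q_v_v X Y := superCommutator_twisted_iota_iota hH X Y
  br_v_m X η := superCommutator_iota_leftMul X η
  br_v_v X Y := superCommutator_iota_iota X Y

end Operators

/-! ### The Grassmann algebra on the odd coordinates -/

section Grassmann
variable {d : ℕ}

/-- The Grassmann algebra on the odd coordinates, in the basis of ordered monomials. -/
abbrev Gr (d : ℕ) : Type := Finset (OddGen d) → ℝ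

/-- The ordered monomial `θ_I`. -/
def mono (I : Finset (OddGen d)) : Gr d := Pi.single I 1

theorem mono_apply (I J : Finset (OddGen d)) : mono I J = if J = I then 1 else 0 :=
  Pi.single_apply I 1 J

/-- The product of the Grassmann algebra. -/
def gmul : Gr d →ₗ[ℝ] Gr d →ₗ[ℝ] Gr d :=
  LinearMap.mk₂ ℝ (fun F G K => ∑ I ∈ K.powerset, SuperFun.prodSign I (K \ I) * F I * G (K \ I))
    (fun F F' G => by
      funext K
      simp only [Pi.add_apply, ← Finset.sum_add_distrib]
      exact Finset.sum_congr rfl fun I _ => by ring)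
    (fun c F G => by
      funext K
      simp only [Pi.smul_apply, smul_eq_mul, Finset.mul_sum]
      exact Finset.sum_congr rfl fun I _ => by ring)
    (fun F G G' => by
      funext K
      simp only [Pi.add_apply, ← Finset.sum_add_distrib]
      exact Finset.sum_congr rfl fun I _ => by ring)
    (fun c F G => by
      funext K
      simp only [Pi.smul_apply, smul_eq_mul, Finset.mul_sum]
      exact Finset.sum_congr rfl fun I _ => by ring)

theorem gmul_apply (F G : Gr d) (K : Finset (OddGen d)) :
    gmul F G K = ∑ I ∈ K.powerset, SuperFun.prodSign I (K \ I) * F I * G (K \ I) := rfl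

/-- The left derivative of the Grassmann algebra. -/
def gleft (a : OddGen d) : Gr d →ₗ[ℝ] Gr d where
  toFun F J := if a ∈ J then 0 else (-1) ^ (J.filter fun i => i < a).card * F (insert a J)
  map_add' F G := by
    funext J
    simp only [Pi.add_apply]
    split_ifs
    · rw [add_zero]
    · rw [mul_add]
  map_smul' c F := by
    funext J
    simp only [Pi.smul_apply, smul_eq_mul, RingHom.id_apply]
    split_ifs
    · exact (mul_zero c).symm
    · ring

theorem gleft_apply (a : OddGen d) (F : Gr d) (J : Finset (OddGen d)) :
    gleft a F J = if a ∈ J then 0 else (-1) ^ (J.filter fun i => i < a).card * F (insert a J) :=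
  rfl

/-- The right derivative of the Grassmann algebra. -/
def gright (a : OddGen d) : Gr d →ₗ[ℝ] Gr d where
  toFun F J := if a ∈ J then 0 else (-1) ^ (J.filter fun i => a < i).card * F (insert a J)
  map_add' F G := by
    funext J
    simp only [Pi.add_apply]
    split_ifs
    · rw [add_zero]
    · rw [mul_add]
  map_smul' c F := by
    funext J
    simp only [Pi.smul_apply, smul_eq_mul, RingHom.id_apply]
    split_ifs
    · exact (mul_zero c).symm
    · ring

theorem gright_apply (a : OddGen d) (F : Gr d) (J : Finset (OddGen d)) :
    gright a F J = if a ∈ J then 0 else (-1) ^ (J.filter fun i => a < i).card * F (insert a J) :=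
  rfl

/-- The generators of `J` before and after `a` together number |J|, so the signs for reaching `a`
from the two ends differ by (-1)^|J|. -/
theorem gright_eq_gleft (a : OddGen d) (F : Gr d) (J : Finset (OddGen d)) :
    gright a F J = (-1) ^ J.card * gleft a F J := by
  rw [gright_apply, gleft_apply]
  split_ifs with h
  · rw [mul_zero]
  · have hJ : J.card = (J.filter fun i => i < a).card + (J.filter fun i => a < i).card := by
      rw [← Finset.card_filter_add_card_filter_not (s := J) (fun i => i < a)]
      congr 2
      refine Finset.filter_congr fun i hi => ?_
      rw [not_lt]
      exact ⟨fun h1 => lt_of_le_of_ne h1 fun h2 => h (h2 ▸ hi), le_of_lt⟩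
    rw [hJ, pow_add, mul_comm ((-1 : ℝ) ^ _) ((-1 : ℝ) ^ (J.filter fun i => a < i).card), mul_assoc,
      ← mul_assoc ((-1 : ℝ) ^ (J.filter fun i => i < a).card), ← mul_pow]
    simp

theorem mono_empty_gmul (F : Gr d) : gmul (mono ∅) F = F := by
  funext K
  rw [gmul_apply, Finset.sum_eq_single ∅]
  · simp [mono_apply, SuperFun.prodSign]
  · intro I _ hI
    simp [mono_apply, hI]
  · simp

theorem gmul_mono_empty (F : Gr d) : gmul F (mono ∅) = F := by
  funext K
  rw [gmul_apply, Finset.sum_eq_single K]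
  · simp [mono_apply, SuperFun.prodSign]
  · intro I hI hne
    have : K \ I ≠ ∅ := fun h => hne ((Finset.mem_powerset.1 hI).antisymm
      (Finset.sdiff_eq_empty_iff_subset.1 h))
    simp [mono_apply, this]
  · simp

/-- Only the singleton contributes to the product, and the generator `a` has to pass the members of
`K` that precede it. -/
theorem mono_singleton_gmul (a : OddGen d) (F : Gr d) (K : Finset (OddGen d)) :
    gmul (mono {a}) F K =
      if a ∈ K then (-1) ^ (K.filter fun i => i < a).card * F (K.erase a) else 0 := by
  rw [gmul_apply]
  split_ifs with h
  · rw [Finset.sum_eq_single {a}]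
    · rw [mono_apply, if_pos rfl, mul_one, Finset.sdiff_singleton_eq_erase, SuperFun.prodSign]
      congr 2
      refine Finset.card_nbij' Prod.snd (fun i => (a, i)) ?_ ?_ ?_ ?_
      · rintro ⟨b, i⟩ hi
        simp only [Finset.coe_filter, Finset.mem_product, Finset.mem_singleton, Finset.mem_erase,
          Set.mem_ofPred_eq] at hi ⊢
        exact ⟨hi.1.2.2, hi.1.1 ▸ hi.2⟩
      · intro i hi
        simp only [Finset.coe_filter, Finset.mem_product, Finset.mem_singleton, Finset.mem_erase,
          Set.mem_ofPred_eq] at hi ⊢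
        exact ⟨⟨trivial, hi.2.ne, hi.1⟩, hi.2⟩
      · rintro ⟨b, i⟩ hi
        simp only [Finset.coe_filter, Finset.mem_product, Finset.mem_singleton,
          Set.mem_ofPred_eq] at hi
        rw [hi.1.1]
      · intro i _
        rfl
    · intro I _ hI
      simp [mono_apply, hI]
    · intro hK
      exact absurd (Finset.mem_powerset.2 (Finset.singleton_subset_iff.2 h)) hK
  · refine Finset.sum_eq_zero fun I hI => ?_
    have : I ≠ {a} := by
      rintro rfl
      exact h (Finset.singleton_subset_iff.1 (Finset.mem_powerset.1 hI))
    simp [mono_apply, this]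

theorem gleft_mono_of_notMem {a : OddGen d} {I : Finset (OddGen d)} (h : a ∉ I) :
    gleft a (mono I) = 0 := by
  funext J
  have hJ : insert a J ≠ I := fun hI => h (hI ▸ Finset.mem_insert_self a J)
  rw [gleft_apply, mono_apply, if_neg hJ, mul_zero, ite_self]
  rfl

theorem gleft_mono {a : OddGen d} {I : Finset (OddGen d)} (h : a ∉ I) :
    gleft a (mono (insert a I)) = (-1 : ℝ) ^ (I.filter fun i => i < a).card • mono I := by
  funext J
  rw [gleft_apply, Pi.smul_apply, mono_apply, mono_apply, smul_eq_mul]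
  by_cases hJ : J = I
  · subst hJ
    rw [if_neg h, if_pos rfl, if_pos rfl]
  · rw [if_neg hJ, mul_zero]
    split_ifs with h1 h2
    · rfl
    · refine absurd ?_ hJ
      rw [← Finset.erase_insert h1, h2, Finset.erase_insert h]
    · rw [mul_zero]

theorem gright_mono_of_notMem {a : OddGen d} {I : Finset (OddGen d)} (h : a ∉ I) :
    gright a (mono I) = 0 := by
  funext J
  rw [gright_eq_gleft, gleft_mono_of_notMem h]
  exact mul_zero _

theorem gright_mono {a : OddGen d} {I : Finset (OddGen d)} (h : a ∉ I) :
    gright a (mono (insert a I)) = (-1 : ℝ) ^ (I.filter fun i => a < i).card • mono I := by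
  funext J
  rw [gright_apply, Pi.smul_apply, mono_apply, mono_apply, smul_eq_mul]
  by_cases hJ : J = I
  · subst hJ
    rw [if_neg h, if_pos rfl, if_pos rfl]
  · rw [if_neg hJ, mul_zero]
    split_ifs with h1 h2
    · rfl
    · refine absurd ?_ hJ
      rw [← Finset.erase_insert h1, h2, Finset.erase_insert h]
    · rw [mul_zero]

theorem gleft_mono_singleton (a b : OddGen d) :
    gleft a (mono {b}) = if a = b then mono ∅ else 0 := by
  split_ifs with h
  · subst h
    have := gleft_mono (Finset.notMem_empty a)
    simpa using this
  · exact gleft_mono_of_notMem (by simpa using h)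

theorem gright_mono_singleton (a b : OddGen d) :
    gright a (mono {b}) = if a = b then mono ∅ else 0 := by
  split_ifs with h
  · subst h
    have := gright_mono (Finset.notMem_empty a)
    simpa using this
  · exact gright_mono_of_notMem (by simpa using h)

theorem gright_mono_empty (a : OddGen d) : gright a (mono ∅) = 0 :=
  gright_mono_of_notMem (Finset.notMem_empty a)

theorem gleft_mono_empty (a : OddGen d) : gleft a (mono ∅) = 0 :=
  gleft_mono_of_notMem (Finset.notMem_empty a)

theorem oc_lt_oc {i j : Fin d} : oc i < oc j ↔ i < j := Sum.Lex.inl_lt_inl_iff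

theorem oc_lt_ob (i j : Fin d) : oc i < ob j := Sum.Lex.inl_lt_inr i j

theorem oc_injective : Function.Injective (oc : Fin d → OddGen d) := fun _ _ h =>
  Sum.inl_injective (toLex.injective h)

theorem ob_injective : Function.Injective (ob : Fin d → OddGen d) := fun _ _ h =>
  Sum.inr_injective (toLex.injective h)

theorem oc_ne_ob (i j : Fin d) : oc i ≠ ob j := (oc_lt_ob i j).ne

theorem gright_ob_pair (i k j : Fin d) :
    gright (ob i) (mono {oc k, ob j}) = if i = j then mono {oc k} else 0 := by
  split_ifs with h
  · subst h
    have h1 : ob i ∉ ({oc k} : Finset (OddGen d)) := by simpa using (oc_ne_ob k i).symm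
    have h2 := gright_mono h1
    rw [Finset.filter_singleton, if_neg (oc_lt_ob k i).not_gt] at h2
    rw [Finset.pair_comm]
    simpa using h2
  · refine gright_mono_of_notMem ?_
    simp [(oc_ne_ob k i).symm, ob_injective.eq_iff, h]

theorem gright_oc_pair (i k j : Fin d) :
    gright (oc i) (mono {oc k, ob j}) = if i = k then -mono {ob j} else 0 := by
  split_ifs with h
  · subst h
    have h1 : oc i ∉ ({ob j} : Finset (OddGen d)) := by simpa using oc_ne_ob i j
    have h2 := gright_mono h1
    rw [Finset.filter_singleton, if_pos (oc_lt_ob i j)] at h2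
    simpa using h2
  · refine gright_mono_of_notMem ?_
    simp [oc_ne_ob, oc_injective.eq_iff, h]

theorem gmul_oc_ob (k j : Fin d) : gmul (mono {oc k}) (mono {ob j}) = mono {oc k, ob j} := by
  funext K
  rw [mono_singleton_gmul, mono_apply, mono_apply]
  have h1 : oc k ∉ ({ob j} : Finset (OddGen d)) := by simpa using oc_ne_ob k j
  by_cases hK : K = {oc k, ob j}
  · subst hK
    rw [if_pos rfl, if_pos (Finset.mem_insert_self _ _), Finset.erase_insert h1, if_pos rfl,
      Finset.filter_insert, if_neg (lt_irrefl _), Finset.filter_singleton,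
      if_neg (oc_lt_ob k j).not_gt]
    simp
  · rw [if_neg hK]
    split_ifs with h2 h3
    · refine absurd ?_ hK
      rw [← Finset.insert_erase h2, h3]
    · rw [mul_zero]
    · rfl

theorem sum_coord_smul {W : Type*} [AddCommGroup W] [Module ℝ W] (G : Euc d →ₗ[ℝ] W) (X : Euc d) :
    ∑ i, X i • G (EuclideanSpace.single i 1) = G X := by
  conv_rhs => rw [← (EuclideanSpace.basisFun (Fin d) ℝ).sum_repr X]
  simp [map_sum]

/-- The function `w^i b_i` of the odd coordinates. -/
def bvec : Euc d →ₗ[ℝ] Gr d where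
  toFun w := ∑ i, w i • mono {ob i}
  map_add' v w := by simp [add_smul, Finset.sum_add_distrib]
  map_smul' c w := by simp [mul_smul, Finset.smul_sum]

theorem bvec_apply (w : Euc d) : bvec w = ∑ i, w i • mono {ob i} := rfl

/-- The function `w_i c^i` of the odd coordinates. -/
def cvec : Euc d →ₗ[ℝ] Gr d where
  toFun w := ∑ i, w i • mono {oc i}
  map_add' v w := by simp [add_smul, Finset.sum_add_distrib]
  map_smul' c w := by simp [mul_smul, Finset.smul_sum]

theorem cvec_apply (w : Euc d) : cvec w = ∑ i, w i • mono {oc i} := rfl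

theorem cvec_single (i : Fin d) : cvec (EuclideanSpace.single i 1) = mono {oc i} := by
  rw [cvec_apply, Finset.sum_eq_single i]
  · simp
  · intro j _ hj
    simp [hj]
  · simp

theorem gleft_oc_bvec (i : Fin d) (w : Euc d) : gleft (oc i) (bvec w) = 0 := by
  simp [bvec_apply, gleft_mono_singleton, oc_ne_ob]

theorem gright_oc_bvec (i : Fin d) (w : Euc d) : gright (oc i) (bvec w) = 0 := by
  simp [bvec_apply, gright_mono_singleton, oc_ne_ob]

theorem gleft_ob_bvec (i : Fin d) (w : Euc d) : gleft (ob i) (bvec w) = w i • mono ∅ := by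
  simp [bvec_apply, gleft_mono_singleton, ob_injective.eq_iff]

theorem gright_ob_bvec (i : Fin d) (w : Euc d) : gright (ob i) (bvec w) = w i • mono ∅ := by
  simp [bvec_apply, gright_mono_singleton, ob_injective.eq_iff]

theorem gright_ob_cvec (i : Fin d) (w : Euc d) : gright (ob i) (cvec w) = 0 := by
  simp [cvec_apply, gright_mono_singleton, (oc_ne_ob _ _).symm]

theorem gright_oc_cvec (i : Fin d) (w : Euc d) : gright (oc i) (cvec w) = w i • mono ∅ := by
  simp [cvec_apply, gright_mono_singleton, oc_injective.eq_iff]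

theorem gright_ob_gmul_oc_bvec (i k : Fin d) (w : Euc d) :
    gright (ob i) (gmul (mono {oc k}) (bvec w)) = w i • mono {oc k} := by
  simp [bvec_apply, gmul_oc_ob, gright_ob_pair]

theorem gright_oc_gmul_oc_bvec (i k : Fin d) (w : Euc d) :
    gright (oc i) (gmul (mono {oc k}) (bvec w)) = if i = k then -bvec w else 0 := by
  split_ifs with h
  · simp [bvec_apply, gmul_oc_ob, gright_oc_pair, h]
  · simp [bvec_apply, gmul_oc_ob, gright_oc_pair, h]

end Grassmann

/-! ### Alternating forms as functions of the odd coordinates -/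

section Emb
variable {d : ℕ}

theorem cPart_image_oc (K : Finset (Fin d)) : cPart (K.image oc) = K := by
  ext i
  simp [cPart, oc_injective.eq_iff]

theorem eq_image_cPart_iff (I : Finset (OddGen d)) :
    I = (cPart I).image oc ↔ ∀ i, ob i ∉ I := by
  constructor
  · intro h i hi
    rw [h, Finset.mem_image] at hi
    obtain ⟨j, _, hj⟩ := hi
    exact oc_ne_ob j i hj
  · intro h
    ext a
    rw [Finset.mem_image]
    constructor
    · intro ha
      rcases a with i | i
      · exact ⟨i, Finset.mem_filter.2 ⟨Finset.mem_univ _, ha⟩, rfl⟩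
      · exact absurd ha (h i)
    · rintro ⟨i, hi, rfl⟩
      exact (Finset.mem_filter.1 hi).2

/-- The coefficient of an inhomogeneous form at `c^{i_1} ⋯ c^{i_k}`, where `i_1 < ⋯ < i_k` are the
elements of `K`. -/
def formCoeff (K : Finset (Fin d)) : Ext (Euc d) →ₗ[ℝ] ℝ where
  toFun α := α K.card fun j => EuclideanSpace.single (K.orderEmbOfFin rfl j) 1
  map_add' _ _ := rfl
  map_smul' _ _ := rfl

/-- A form on `ℝ^d` as a function of the odd coordinates `c^i`. -/
def emb : Ext (Euc d) →ₗ[ℝ] Gr d :=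
  LinearMap.pi fun I => if I = (cPart I).image oc then formCoeff (cPart I) else 0

theorem emb_apply (α : Ext (Euc d)) (I : Finset (OddGen d)) :
    emb α I = if I = (cPart I).image oc then formCoeff (cPart I) α else 0 := by
  rw [emb, LinearMap.pi_apply]
  split_ifs <;> rfl

theorem emb_image (α : Ext (Euc d)) (K : Finset (Fin d)) :
    emb α (K.image oc) = formCoeff K α := by
  rw [emb_apply, cPart_image_oc, if_pos rfl]

theorem emb_of_ob_mem (α : Ext (Euc d)) {I : Finset (OddGen d)} {i : Fin d} (h : ob i ∈ I) :
    emb α I = 0 := by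
  rw [emb_apply, if_neg fun hI => (eq_image_cPart_iff I).1 hI i h]

theorem formCoeff_eq (α : Ext (Euc d)) {K : Finset (Fin d)} {n : ℕ} (h : K.card = n)
    {f : Fin n → Fin d} (hf : StrictMono f) (hK : ∀ j, f j ∈ K) :
    formCoeff K α = α n fun j => EuclideanSpace.single (f j) 1 := by
  subst h
  rw [Finset.orderEmbOfFin_unique rfl hK hf]
  rfl

theorem formCoeff_orderEmb (α : Ext (Euc d)) {K : Finset (Fin d)} {n : ℕ} (h : K.card = n) :
    formCoeff K α = α n fun j => EuclideanSpace.single (K.orderEmbOfFin h j) 1 :=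
  formCoeff_eq α h (K.orderEmbOfFin h).strictMono (Finset.orderEmbOfFin_mem K h)

theorem card_filter_lt_orderEmb {K : Finset (Fin d)} {n : ℕ} (h : K.card = n) (l : Fin n) :
    (K.filter fun k => k < K.orderEmbOfFin h l).card = l := by
  have : K.filter (fun k => k < K.orderEmbOfFin h l) =
      (Finset.Iio l).image (K.orderEmbOfFin h) := by
    ext k
    simp only [Finset.mem_filter, Finset.mem_image, Finset.mem_Iio]
    constructor
    · rintro ⟨hk, hl⟩
      obtain ⟨j, rfl⟩ : k ∈ Set.range (K.orderEmbOfFin h) := by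
        rw [Finset.range_orderEmbOfFin]; exact hk
      exact ⟨j, (K.orderEmbOfFin h).lt_iff_lt.1 hl, rfl⟩
    · rintro ⟨j, hj, rfl⟩
      exact ⟨Finset.orderEmbOfFin_mem K h j, (K.orderEmbOfFin h).lt_iff_lt.2 hj⟩
  rw [this, Finset.card_image_of_injective _ (K.orderEmbOfFin h).injective, Fin.card_Iio]

theorem formCoeff_erase (α : Ext (Euc d)) {K : Finset (Fin d)} {n : ℕ} (h : K.card = n + 1)
    (l : Fin (n + 1)) :
    formCoeff (K.erase (K.orderEmbOfFin h l)) α =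
      α n fun j => EuclideanSpace.single (K.orderEmbOfFin h (l.succAbove j)) 1 := by
  refine formCoeff_eq (f := fun j => K.orderEmbOfFin h (l.succAbove j)) α ?_ ?_ fun j => ?_
  · rw [Finset.card_erase_of_mem (Finset.orderEmbOfFin_mem K h l), h, Nat.add_sub_cancel]
  · exact (K.orderEmbOfFin h).strictMono.comp (Fin.strictMono_succAbove l)
  · exact Finset.mem_erase.2 ⟨fun he => Fin.succAbove_ne l j ((K.orderEmbOfFin h).injective he),
      Finset.orderEmbOfFin_mem K h _⟩

theorem card_filter_image_lt (K : Finset (Fin d)) (i : Fin d) :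
    ((K.image oc).filter fun a => a < oc i).card = (K.filter fun k => k < i).card := by
  rw [Finset.filter_image, Finset.card_image_of_injective _ oc_injective]
  simp only [oc_lt_oc]

/-- The new index occupies the place given by the number of smaller elements. Moving its basis
vector from there to the front produces the sign. -/
theorem formCoeff_insert (α : Ext (Euc d)) {K : Finset (Fin d)} {i : Fin d} (h : i ∉ K) :
    (-1 : ℝ) ^ (K.filter fun k => k < i).card * formCoeff (insert i K) α =
      formCoeff K (extContract (EuclideanSpace.single i 1) α) := by
  have hc : (insert i K).card = K.card + 1 := Finset.card_insert_of_notMem h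
  obtain ⟨l, hl⟩ : i ∈ Set.range ((insert i K).orderEmbOfFin hc) := by
    rw [Finset.range_orderEmbOfFin]; exact Finset.mem_insert_self i K
  have h1 := card_filter_lt_orderEmb hc l
  rw [hl, Finset.filter_insert, if_neg (lt_irrefl i)] at h1
  have h2 := formCoeff_erase (extContract (EuclideanSpace.single i 1) α) hc l
  rw [hl, Finset.erase_insert h] at h2
  rw [h1, h2, formCoeff_orderEmb α hc, extContract_apply, ← continuousAlternating_insertNth _ l]
  congr 2
  funext j
  refine Fin.succAboveCases l ?_ (fun j => ?_) j
  · rw [Fin.insertNth_apply_same, hl]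
  · rw [Fin.insertNth_apply_succAbove]

theorem formCoeff_extContract_of_mem (α : Ext (Euc d)) {K : Finset (Fin d)} {i : Fin d}
    (h : i ∈ K) : formCoeff K (extContract (EuclideanSpace.single i 1) α) = 0 := by
  obtain ⟨l, hl⟩ : i ∈ Set.range (K.orderEmbOfFin rfl) := by
    rw [Finset.range_orderEmbOfFin]; exact h
  refine (α (K.card + 1)).map_eq_zero_of_eq _ (i := 0) (j := l.succ) ?_ (Fin.succ_ne_zero l).symm
  rw [Fin.cons_zero, Fin.cons_succ, hl]

/-- The sign of the left derivative counts the smaller generators, exactly as moving a basis vector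
to the front of an alternating form does. Monomials that involve some b contribute zero on both
sides. -/
theorem gleft_oc_emb (i : Fin d) (α : Ext (Euc d)) :
    gleft (oc i) (emb α) = emb (extContract (EuclideanSpace.single i 1) α) := by
  funext J
  rw [gleft_apply]
  by_cases hJ : ∀ k, ob k ∉ J
  · rw [(eq_image_cPart_iff J).2 hJ, emb_image, card_filter_image_lt, ← Finset.image_insert,
      emb_image]
    simp only [Finset.mem_image, oc_injective.eq_iff, exists_eq_right]
    split_ifs with h
    · exact (formCoeff_extContract_of_mem α h).symm
    · exact formCoeff_insert α h
  · push Not at hJ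
    obtain ⟨k, hk⟩ := hJ
    rw [emb_of_ob_mem _ hk, emb_of_ob_mem _ (Finset.mem_insert_of_mem hk), mul_zero, ite_self]

theorem emb_extPar (α : Ext (Euc d)) (I : Finset (OddGen d)) :
    emb (extPar α) I = (-1) ^ I.card * emb α I := by
  rw [emb_apply, emb_apply]
  split_ifs with h
  · rw [h, cPart_image_oc, Finset.card_image_of_injective _ oc_injective]
    rfl
  · rw [mul_zero]

theorem gright_oc_emb (i : Fin d) (α : Ext (Euc d)) :
    gright (oc i) (emb α) = emb (extPar (extContract (EuclideanSpace.single i 1) α)) := by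
  funext J
  rw [gright_eq_gleft, gleft_oc_emb, emb_extPar]

theorem gleft_ob_emb (i : Fin d) (α : Ext (Euc d)) : gleft (ob i) (emb α) = 0 := by
  funext J
  rw [gleft_apply, emb_of_ob_mem _ (Finset.mem_insert_self (ob i) J), mul_zero, ite_self]
  rfl

theorem gright_ob_emb (i : Fin d) (α : Ext (Euc d)) : gright (ob i) (emb α) = 0 := by
  funext J
  rw [gright_eq_gleft, gleft_ob_emb]
  exact mul_zero _

/-- The l-th basis vector of the increasing enumeration of `K` has l smaller elements, so the
alternating sum over positions becomes a sum over the elements of `K`. -/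
theorem formCoeff_extAlt (F : Euc d →ₗ[ℝ] Ext (Euc d)) (K : Finset (Fin d)) :
    formCoeff K (extAlt F) = ∑ i ∈ K, (-1 : ℝ) ^ (K.filter fun k => k < i).card *
      formCoeff (K.erase i) (F (EuclideanSpace.single i 1)) := by
  rcases hn : K.card with _ | n
  · rw [formCoeff_orderEmb _ hn, extAlt_apply_zero, Finset.sum_eq_zero fun i hi => by
      simp [Finset.card_eq_zero.1 hn] at hi]
    rfl
  · rw [formCoeff_orderEmb _ hn, extAlt_apply_succ]
    refine Finset.sum_bij (fun l _ => K.orderEmbOfFin hn l)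
      (fun l _ => Finset.orderEmbOfFin_mem K hn l)
      (fun l _ l' _ h => (K.orderEmbOfFin hn).injective h) (fun i hi => ?_) fun l _ => ?_
    · have : i ∈ Set.range (K.orderEmbOfFin hn) := by rw [Finset.range_orderEmbOfFin]; exact hi
      obtain ⟨l, hl⟩ := this
      exact ⟨l, Finset.mem_univ l, hl⟩
    · rw [card_filter_lt_orderEmb, formCoeff_erase]
      rfl

/-- Multiplication by c^i corresponds to the wedge product with e^i. Applied to partial derivatives,
this identifies c^i ∂_i with the exterior derivative. -/
theorem sum_gmul_oc_emb (F : Euc d →ₗ[ℝ] Ext (Euc d)) :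
    ∑ i, gmul (mono {oc i}) (emb (F (EuclideanSpace.single i 1))) = emb (extAlt F) := by
  funext I
  rw [Finset.sum_apply]
  simp only [mono_singleton_gmul]
  by_cases hI : ∀ k, ob k ∉ I
  · rw [(eq_image_cPart_iff I).2 hI, emb_image, formCoeff_extAlt, ← Finset.sum_filter]
    simp only [Finset.mem_image, oc_injective.eq_iff, exists_eq_right, Finset.filter_univ_mem]
    refine Finset.sum_congr rfl fun i _ => ?_
    rw [card_filter_image_lt, ← Finset.image_erase oc_injective, emb_image]
  · push Not at hI
    obtain ⟨k, hk⟩ := hI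
    rw [emb_of_ob_mem _ hk]
    refine Finset.sum_eq_zero fun i _ => ?_
    rw [emb_of_ob_mem _ (Finset.mem_erase.2 ⟨(oc_ne_ob i k).symm, hk⟩), mul_zero, ite_self]

end Emb

/-! ### Values of superfunctions -/

namespace SuperFun
variable {d : ℕ} {V : TopologicalSpace.Opens (Euc d × Euc d)} {z : Euc d × Euc d}

/-- The value of a superfunction at a point of the space of even coordinates. -/
def val (z : Euc d × Euc d) : SuperFun V →ₗ[ℝ] Gr d where
  toFun F I := F.1 I z
  map_add' _ _ := rfl
  map_smul' _ _ := rfl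

/-- Points outside `V` need not be checked, since all coefficients are extended by zero there. -/
theorem ext_val {F G : SuperFun V} (h : ∀ z ∈ V, val z F = val z G) : F = G := by
  refine Subtype.ext (funext fun I => funext fun z => ?_)
  by_cases hz : z ∈ V
  · exact congrFun (h z hz) I
  · rw [(F.2 I).2 z hz, (G.2 I).2 z hz]

theorem val_ofCoeff (hz : z ∈ V) (f : Finset (OddGen d) → Euc d × Euc d → ℝ)
    (hf : ∀ I, ContDiffOn ℝ ∞ (f I) V) : val z (ofCoeff f hf) = fun I => f I z :=
  funext fun _ => if_pos hz

theorem val_mul (hz : z ∈ V) (F G : SuperFun V) : val z (mul F G) = gmul (val z F) (val z G) :=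
  val_ofCoeff hz _ _

theorem val_leftDeriv (hz : z ∈ V) (a : OddGen d) (F : SuperFun V) :
    val z (leftDeriv a F) = gleft a (val z F) :=
  val_ofCoeff hz _ _

theorem val_rightDeriv (hz : z ∈ V) (F : SuperFun V) (a : OddGen d) :
    val z (rightDeriv F a) = gright a (val z F) :=
  val_ofCoeff hz _ _

theorem val_evenDeriv (hz : z ∈ V) (v : Euc d × Euc d) (F : SuperFun V)
    (I : Finset (OddGen d)) : val z (evenDeriv v F) I = fderiv ℝ (F.1 I) z v :=
  congrFun (val_ofCoeff hz _ _) I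

theorem differentiableAt_coeff (hz : z ∈ V) (F : SuperFun V) (I : Finset (OddGen d)) :
    DifferentiableAt ℝ (F.1 I) z :=
  ((F.2 I).1.contDiffAt (V.isOpen.mem_nhds hz)).differentiableAt (by simp)

/-- The coefficients of a superfunction are differentiable, so the derivative in a direction is
determined along a line. An explicit formula for the values then needs only a line derivative, not
full differentiability. -/
theorem val_evenDeriv_of_eventuallyEq (hz : z ∈ V) (v : Euc d × Euc d) {F : SuperFun V}
    {f : Finset (OddGen d) → Euc d × Euc d → ℝ} (h : ∀ I, ∀ᶠ w in 𝓝 z, F.1 I w = f I w)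
    {G : Gr d} (hG : ∀ I, HasLineDerivAt ℝ (f I) (G I) z v) : val z (evenDeriv v F) = G := by
  funext I
  have h0 : Tendsto (fun t : ℝ => z + t • v) (𝓝 0) (𝓝 z) := by
    have : Continuous fun t : ℝ => z + t • v := by fun_prop
    simpa using this.tendsto 0
  have h1 : HasLineDerivAt ℝ (F.1 I) (G I) z v :=
    HasDerivAt.congr_of_eventuallyEq (hG I) (h0.eventually (h I))
  rw [val_evenDeriv hz, ← (differentiableAt_coeff hz F I).lineDeriv_eq_fderiv, h1.lineDeriv]

theorem val_evenDeriv_of_forall (hz : z ∈ V) (v : Euc d × Euc d) {F : SuperFun V}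
    {f : Euc d × Euc d → Gr d} (h : ∀ w ∈ V, val w F = f w)
    {G : Gr d} (hG : ∀ I, HasLineDerivAt ℝ (fun w => f w I) (G I) z v) :
    val z (evenDeriv v F) = G :=
  val_evenDeriv_of_eventuallyEq hz v (f := fun I w => f w I)
    (fun I => by filter_upwards [V.isOpen.mem_nhds hz] with w hw using congrFun (h w hw) I) hG

theorem evenDeriv_add (v : Euc d × Euc d) (F G : SuperFun V) :
    evenDeriv v (F + G) = evenDeriv v F + evenDeriv v G :=
  ext_val fun z hz => funext fun I => by
    rw [map_add, Pi.add_apply, val_evenDeriv hz, val_evenDeriv hz, val_evenDeriv hz]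
    exact DFunLike.congr_fun
      (fderiv_add (differentiableAt_coeff hz F I) (differentiableAt_coeff hz G I)) v

theorem evenDeriv_smul (v : Euc d × Euc d) (c : ℝ) (F : SuperFun V) :
    evenDeriv v (c • F) = c • evenDeriv v F :=
  ext_val fun z hz => funext fun I => by
    rw [map_smul, Pi.smul_apply, val_evenDeriv hz, val_evenDeriv hz]
    exact DFunLike.congr_fun (fderiv_const_smul (differentiableAt_coeff hz F I) c) v

theorem val_poisson (hz : z ∈ V) (F G : SuperFun V) : val z (poisson F G) =
    ∑ i, (gmul (val z (dp i F)) (val z (dx i G)) - gmul (val z (dx i F)) (val z (dp i G))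
      + gmul (gright (ob i) (val z F)) (gleft (oc i) (val z G))
      + gmul (gright (oc i) (val z F)) (gleft (ob i) (val z G))) := by
  simp only [poisson, map_sum, map_add, map_sub, val_mul hz, val_leftDeriv hz, val_rightDeriv hz]

theorem val_antibracket (hz : z ∈ V) (F G : SuperFun V) : val z (antibracket F G) =
    ∑ i, (gmul (gright (ob i) (val z F)) (val z (dx i G))
      - gmul (val z (dx i F)) (gleft (ob i) (val z G))
      + gmul (val z (dp i F)) (gleft (oc i) (val z G))
      - gmul (gright (oc i) (val z F)) (val z (dp i G))) := by
  simp only [antibracket, map_sum, map_add, map_sub, val_mul hz, val_leftDeriv hz,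
    val_rightDeriv hz]

theorem poisson_isBilin : IsBilin (poisson : SuperFun V → SuperFun V → SuperFun V) where
  add_left F F' G := ext_val fun z hz => by
    rw [map_add, val_poisson hz, val_poisson hz, val_poisson hz, ← Finset.sum_add_distrib]
    refine Finset.sum_congr rfl fun i _ => ?_
    simp only [dx, dp, evenDeriv_add, map_add, LinearMap.add_apply]
    abel
  smul_left c F G := ext_val fun z hz => by
    rw [map_smul, val_poisson hz, val_poisson hz, Finset.smul_sum]
    refine Finset.sum_congr rfl fun i _ => ?_
    simp only [dx, dp, evenDeriv_smul, map_smul, LinearMap.smul_apply, smul_add, smul_sub]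
  add_right F G G' := ext_val fun z hz => by
    rw [map_add, val_poisson hz, val_poisson hz, val_poisson hz, ← Finset.sum_add_distrib]
    refine Finset.sum_congr rfl fun i _ => ?_
    simp only [dx, dp, evenDeriv_add, map_add]
    abel
  smul_right c F G := ext_val fun z hz => by
    rw [map_smul, val_poisson hz, val_poisson hz, Finset.smul_sum]
    refine Finset.sum_congr rfl fun i _ => ?_
    simp only [dx, dp, evenDeriv_smul, map_smul, smul_add, smul_sub]

theorem antibracket_isBilin : IsBilin (antibracket : SuperFun V → SuperFun V → SuperFun V) where
  add_left F F' G := ext_val fun z hz => by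
    rw [map_add, val_antibracket hz, val_antibracket hz, val_antibracket hz,
      ← Finset.sum_add_distrib]
    refine Finset.sum_congr rfl fun i _ => ?_
    simp only [dx, dp, evenDeriv_add, map_add, LinearMap.add_apply]
    abel
  smul_left c F G := ext_val fun z hz => by
    rw [map_smul, val_antibracket hz, val_antibracket hz, Finset.smul_sum]
    refine Finset.sum_congr rfl fun i _ => ?_
    simp only [dx, dp, evenDeriv_smul, map_smul, LinearMap.smul_apply, smul_add, smul_sub]
  add_right F G G' := ext_val fun z hz => by
    rw [map_add, val_antibracket hz, val_antibracket hz, val_antibracket hz,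
      ← Finset.sum_add_distrib]
    refine Finset.sum_congr rfl fun i _ => ?_
    simp only [dx, dp, evenDeriv_add, map_add]
    abel
  smul_right c F G := ext_val fun z hz => by
    rw [map_smul, val_antibracket hz, val_antibracket hz, Finset.smul_sum]
    refine Finset.sum_congr rfl fun i _ => ?_
    simp only [dx, dp, evenDeriv_smul, map_smul, smul_add, smul_sub]

theorem val_parity (hz : z ∈ V) (e : ZMod 2) (F : SuperFun V) (I : Finset (OddGen d)) :
    val z (parity e F) I = if (I.card : ZMod 2) = e then val z F I else 0 :=
  congrFun (val_ofCoeff hz _ _) I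

/-- A superfunction all of whose monomials have parity `f`. -/
theorem parity_eq {f : ZMod 2} {F : SuperFun V}
    (h : ∀ z ∈ V, ∀ I, (I.card : ZMod 2) ≠ f → val z F I = 0) (e : ZMod 2) :
    parity e F = if e = f then F else 0 := by
  refine ext_val fun z hz => funext fun I => ?_
  rw [val_parity hz]
  by_cases hI : (I.card : ZMod 2) = f
  · rw [hI]
    by_cases he : f = e
    · rw [if_pos he, if_pos he.symm]
    · rw [if_neg he, if_neg (Ne.symm he)]
      rfl
  · have h0 := h z hz I hI
    rw [h0, ite_self]
    split_ifs
    · exact h0.symm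
    · rfl

end SuperFun

/-! ### Values of forms and vector fields in a chart -/

section Values
variable {d : ℕ} {M : Type*} [TopologicalSpace M] [ChartedSpace (Euc d) M]
  {φ : Chart d M} {z : Euc d × Euc d}

open SuperFun

theorem val_formFun (hz : z ∈ evenDomain φ) (η : Forms d M) :
    val z (formFun φ η) = emb (loc φ.1 z.1 η) := by
  funext I
  rw [formFun, val_ofCoeff hz, emb_apply]
  rfl

/-- `formFun` as a linear map. -/
def formFunLin (φ : Chart d M) : Forms d M →ₗ[ℝ] LocalFun φ where
  toFun := formFun φ
  map_add' η ζ := ext_val fun z hz => by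
    rw [map_add, val_formFun hz, val_formFun hz, val_formFun hz, map_add, map_add]
  map_smul' c η := ext_val fun z hz => by
    rw [map_smul, val_formFun hz, val_formFun hz, map_smul, map_smul]
    rfl

theorem formFunLin_apply (η : Forms d M) : formFunLin φ η = formFun φ η := rfl

theorem evenDomain_mem (hz : z ∈ evenDomain φ) : z.1 ∈ φ.1.target := hz.1

theorem hasLineDerivAt_comp_fst {E : Type*} [NormedAddCommGroup E] [NormedSpace ℝ E]
    {f : Euc d → E} (hf : DifferentiableAt ℝ f z.1) (v : Euc d × Euc d) :
    HasLineDerivAt ℝ (fun w : Euc d × Euc d => f w.1) (fderiv ℝ f z.1 v.1) z v :=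
  (hf.hasFDerivAt.comp z hasFDerivAt_fst).hasLineDerivAt v

theorem val_evenDeriv_formFun (hz : z ∈ evenDomain φ) (v : Euc d × Euc d) (η : Forms d M) :
    val z (evenDeriv v (formFun φ η)) = emb (locD φ.1 z.1 η v.1) := by
  refine val_evenDeriv_of_forall hz v (fun w hw => val_formFun hw η) fun I => ?_
  simp only [emb_apply]
  split_ifs with hI
  · have h := differentiableAt_localForm φ.2 (evenDomain_mem hz) (η (cPart I).card)
    have h2 := ((ContinuousAlternatingMap.apply ℝ (Euc d) ℝ fun j =>
      (EuclideanSpace.single ((cPart I).orderEmbOfFin rfl j) 1 : Euc d)).hasFDerivAt.comp z.1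
        h.hasFDerivAt).comp z hasFDerivAt_fst
    exact h2.hasLineDerivAt v
  · exact (hasFDerivAt_const (0 : ℝ) z).hasLineDerivAt v

theorem val_dx_formFun (hz : z ∈ evenDomain φ) (i : Fin d) (η : Forms d M) :
    val z (dx i (formFun φ η)) = emb (locD φ.1 z.1 η (EuclideanSpace.single i 1)) :=
  val_evenDeriv_formFun hz _ η

theorem val_dp_formFun (hz : z ∈ evenDomain φ) (i : Fin d) (η : Forms d M) :
    val z (dp i (formFun φ η)) = 0 := by
  rw [dp, val_evenDeriv_formFun hz, map_zero, map_zero]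

theorem parity_formFun (e : ZMod 2) (η : Forms d M) :
    parity e (formFun φ η) = formFun φ (formParity e η) := by
  refine ext_val fun z hz => funext fun I => ?_
  rw [val_parity hz, val_formFun hz, val_formFun hz, emb_apply, emb_apply]
  by_cases hI : I = (cPart I).image oc
  · rw [if_pos hI, if_pos hI]
    have hc : I.card = (cPart I).card := by
      conv_lhs => rw [hI]
      exact Finset.card_image_of_injective _ oc_injective
    rw [hc]
    change _ = localForm φ.1 (formParity e η (cPart I).card).1 z.1 _
    rw [formParity_apply]
    split_ifs
    · rfl
    · exact (congrArg (fun α : Euc d [⋀^Fin (cPart I).card]→L[ℝ] ℝ => α fun j =>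
        EuclideanSpace.single ((cPart I).orderEmbOfFin rfl j) 1)
          (map_zero (locLin (M := M) φ.1 z.1 (cPart I).card))).symm
  · rw [if_neg hI, if_neg hI, ite_self]

variable [IsManifold (𝓡 d) ∞ M]

theorem val_oddField (hz : z ∈ evenDomain φ) (X : VField d M) :
    val z (oddField φ X) = bvec (localField φ.1 X z.1) := by
  funext I
  rw [oddField, val_ofCoeff hz, bvec_apply, Finset.sum_apply]
  refine Finset.sum_congr rfl fun i _ => ?_
  rw [Pi.smul_apply, mono_apply, smul_eq_mul, mul_ite, mul_one, mul_zero]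

/-- The Euclidean inner product serves as the pairing p_i X^i of momenta with vector components. -/
theorem val_evenField (hz : z ∈ evenDomain φ) (X : VField d M) :
    val z (evenField φ X) = inner ℝ z.2 (localField φ.1 X z.1) • mono ∅ := by
  funext I
  rw [evenField, val_ofCoeff hz, Pi.smul_apply, mono_apply, smul_eq_mul, mul_ite, mul_one,
    mul_zero, PiLp.inner_apply]
  rfl

theorem hasLineDerivAt_linear {E F : Type*} [NormedAddCommGroup E] [NormedSpace ℝ E]
    [FiniteDimensional ℝ E] [NormedAddCommGroup F] [NormedSpace ℝ F] (L : E →ₗ[ℝ] F)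
    {f : Euc d × Euc d → E} {f' : E} {v : Euc d × Euc d} (h : HasLineDerivAt ℝ f f' z v) :
    HasLineDerivAt ℝ (fun w => L (f w)) (L f') z v :=
  (LinearMap.toContinuousLinearMap L).hasFDerivAt.comp_hasDerivAt (0 : ℝ) h

theorem val_evenDeriv_oddField (hz : z ∈ evenDomain φ) (v : Euc d × Euc d) (X : VField d M) :
    val z (evenDeriv v (oddField φ X)) = bvec (fderiv ℝ (localField φ.1 X) z.1 v.1) :=
  val_evenDeriv_of_forall hz v (fun _ hw => val_oddField hw X) fun I =>
    hasLineDerivAt_linear ((LinearMap.proj I).comp bvec)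
      (hasLineDerivAt_comp_fst (differentiableAt_localField φ.2 (evenDomain_mem hz) X) v)

theorem val_dx_oddField (hz : z ∈ evenDomain φ) (i : Fin d) (X : VField d M) :
    val z (dx i (oddField φ X)) =
      bvec (fderiv ℝ (localField φ.1 X) z.1 (EuclideanSpace.single i 1)) :=
  val_evenDeriv_oddField hz _ X

theorem val_dp_oddField (hz : z ∈ evenDomain φ) (i : Fin d) (X : VField d M) :
    val z (dp i (oddField φ X)) = 0 := by
  rw [dp, val_evenDeriv_oddField hz, map_zero, map_zero]

theorem hasLineDerivAt_inner (X : VField d M) (hz : z ∈ evenDomain φ) (v : Euc d × Euc d) :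
    HasLineDerivAt ℝ (fun w : Euc d × Euc d => inner ℝ w.2 (localField φ.1 X w.1))
      (inner ℝ z.2 (fderiv ℝ (localField φ.1 X) z.1 v.1) +
        inner ℝ v.2 (localField φ.1 X z.1)) z v :=
  ((hasFDerivAt_snd (𝕜 := ℝ) (p := z)).inner ℝ
    ((differentiableAt_localField φ.2 (evenDomain_mem hz) X).hasFDerivAt.comp z
      hasFDerivAt_fst)).hasLineDerivAt v

theorem val_evenDeriv_evenField (hz : z ∈ evenDomain φ) (v : Euc d × Euc d) (X : VField d M) :
    val z (evenDeriv v (evenField φ X)) = (inner ℝ z.2 (fderiv ℝ (localField φ.1 X) z.1 v.1) +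
        inner ℝ v.2 (localField φ.1 X z.1)) • mono ∅ :=
  val_evenDeriv_of_forall hz v (fun _ hw => val_evenField hw X) fun I =>
    hasLineDerivAt_linear ((LinearMap.proj I).comp
      (LinearMap.toSpanSingleton ℝ (Gr d) (mono ∅))) (hasLineDerivAt_inner X hz v)

theorem val_dx_evenField (hz : z ∈ evenDomain φ) (i : Fin d) (X : VField d M) :
    val z (dx i (evenField φ X)) =
      inner ℝ z.2 (fderiv ℝ (localField φ.1 X) z.1 (EuclideanSpace.single i 1)) • mono ∅ := by
  rw [dx, val_evenDeriv_evenField hz, inner_zero_left, add_zero]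

theorem val_dp_evenField (hz : z ∈ evenDomain φ) (i : Fin d) (X : VField d M) :
    val z (dp i (evenField φ X)) = localField φ.1 X z.1 i • mono ∅ := by
  rw [dp, val_evenDeriv_evenField hz, map_zero, inner_zero_right, zero_add,
    EuclideanSpace.inner_single_left]
  simp

theorem parity_oddField (e : ZMod 2) (X : VField d M) :
    parity e (oddField φ X) = if e = 1 then oddField φ X else 0 := by
  refine parity_eq (fun z hz I hI => ?_) e
  rw [val_oddField hz, bvec_apply, Finset.sum_apply]
  refine Finset.sum_eq_zero fun i _ => ?_
  rw [Pi.smul_apply, mono_apply, if_neg, smul_zero]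
  rintro rfl
  simp at hI

theorem parity_evenField (e : ZMod 2) (X : VField d M) :
    parity e (evenField φ X) = if e = 0 then evenField φ X else 0 := by
  refine parity_eq (fun z hz I hI => ?_) e
  rw [val_evenField hz, Pi.smul_apply, mono_apply, if_neg, smul_zero]
  rintro rfl
  simp at hI

theorem localField_zero (y : Euc d) : localField φ.1 (0 : VField d M) y = 0 :=
  map_zero (coframe φ.1 (φ.1.symm y))

theorem oddField_zero : oddField φ (0 : VField d M) = 0 :=
  ext_val fun z hz => by rw [val_oddField hz, localField_zero, map_zero, map_zero]

theorem evenField_zero : evenField φ (0 : VField d M) = 0 :=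
  ext_val fun z hz => by
    rw [val_evenField hz, localField_zero, inner_zero_right, zero_smul, map_zero]

end Values

/-! ### The generators and their brackets with vector fields and forms. -/

section Momenta
variable {d : ℕ} {M : Type*} [TopologicalSpace M] [ChartedSpace (Euc d) M]
  {φ : Chart d M} {z : Euc d × Euc d}

open SuperFun

/-- The derivative with respect to the momenta of a superfunction which is affine in them. -/
theorem val_dp_of_affine (hz : z ∈ evenDomain φ) {F : LocalFun φ} (f : Euc d → Gr d)
    (g : Euc d → Euc d →ₗ[ℝ] Gr d) (h : ∀ w ∈ evenDomain φ, val w F = f w.1 + g w.1 w.2)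
    (i : Fin d) : val z (dp i F) = g z.1 (EuclideanSpace.single i 1) := by
  refine val_evenDeriv_of_forall hz _ h fun I => ?_
  -- Along a momentum direction the base point is fixed, so the function is affine in `t`, and no
  -- differentiability of `f` or `g` in the base variable is required.
  have h1 : (fun t : ℝ => (f (z + t • ((0 : Euc d), EuclideanSpace.single i (1 : ℝ))).1 +
      g (z + t • ((0 : Euc d), EuclideanSpace.single i (1 : ℝ))).1
        (z + t • ((0 : Euc d), EuclideanSpace.single i (1 : ℝ))).2) I) =
      fun t => (f z.1 I + g z.1 z.2 I) + t * g z.1 (EuclideanSpace.single i 1) I := by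
    funext t
    simp [add_assoc]
  change HasDerivAt (fun t : ℝ => (f (z + t • ((0 : Euc d), EuclideanSpace.single i (1 : ℝ))).1 +
      g (z + t • ((0 : Euc d), EuclideanSpace.single i (1 : ℝ))).1
        (z + t • ((0 : Euc d), EuclideanSpace.single i (1 : ℝ))).2) I) _ 0
  rw [h1]
  simpa using ((hasDerivAt_id (0 : ℝ)).mul_const
    (g z.1 (EuclideanSpace.single i 1) I)).const_add (f z.1 I + g z.1 z.2 I)

theorem inner_eq_sum (p X : Euc d) : inner ℝ p X = ∑ i, p i * X i := by
  rw [PiLp.inner_apply]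
  exact Finset.sum_congr rfl fun i _ => mul_comm _ _

theorem formFun_zero : formFun φ (0 : Forms d M) = 0 := map_zero (formFunLin φ)

/-- Separates the twist, so that the geometric part of the generator can be treated with `H = 0`. -/
theorem genQ_eq (H : Forms d M) : genQ φ H = genQ φ 0 + formFun φ H := by
  rw [genQ, genQ, formFun_zero, add_zero]

theorem genS_eq (H : Forms d M) : genS φ H = genS φ 0 + formFun φ H := by
  rw [genS, genS, formFun_zero, add_zero]

theorem val_genQ (hz : z ∈ evenDomain φ) : val z (genQ φ (0 : Forms d M)) = cvec z.2 := by
  funext I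
  rw [genQ, formFun_zero, add_zero, val_ofCoeff hz, cvec_apply, Finset.sum_apply]
  refine Finset.sum_congr rfl fun i _ => ?_
  rw [Pi.smul_apply, mono_apply, smul_eq_mul, mul_ite, mul_one, mul_zero]

theorem val_dp_genQ (hz : z ∈ evenDomain φ) (i : Fin d) :
    val z (dp i (genQ φ (0 : Forms d M))) = mono {oc i} := by
  rw [val_dp_of_affine hz (fun _ => 0) (fun _ => cvec)
    (fun w hw => by rw [val_genQ hw, zero_add]), cvec_single]

theorem val_genS (hz : z ∈ evenDomain φ) :
    val z (genS φ (0 : Forms d M)) = ∑ i, mono {oc i, ob i} := by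
  funext I
  rw [genS, formFun_zero, add_zero, val_ofCoeff hz, Finset.sum_apply]
  exact Finset.sum_congr rfl fun i _ => (mono_apply _ _).symm

theorem val_evenDeriv_genS (hz : z ∈ evenDomain φ) (v : Euc d × Euc d) :
    val z (evenDeriv v (genS φ (0 : Forms d M))) = 0 :=
  val_evenDeriv_of_forall hz v (fun _ hw => val_genS hw) fun _ =>
    (hasFDerivAt_const _ z).hasLineDerivAt v

theorem val_dx_genS (hz : z ∈ evenDomain φ) (i : Fin d) :
    val z (dx i (genS φ (0 : Forms d M))) = 0 := val_evenDeriv_genS hz _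

theorem val_dp_genS (hz : z ∈ evenDomain φ) (i : Fin d) :
    val z (dp i (genS φ (0 : Forms d M))) = 0 := val_evenDeriv_genS hz _

theorem gright_ob_genS (i : Fin d) :
    gright (ob i) (∑ k, mono {oc k, ob k}) = (mono {oc i} : Gr d) := by
  simp [gright_ob_pair]

theorem gright_oc_genS (i : Fin d) :
    gright (oc i) (∑ k, mono {oc k, ob k}) = (-mono {ob i} : Gr d) := by
  simp [gright_oc_pair]

theorem sum_smul_emb_contract (X : Euc d) (α : Ext (Euc d)) :
    ∑ i, X i • emb (extContract (EuclideanSpace.single i 1) α) = emb (extContract X α) :=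
  sum_coord_smul (emb.comp (extContract.flip α)) X

theorem sum_smul_emb_extPar_contract (X : Euc d) (α : Ext (Euc d)) :
    ∑ i, X i • emb (extPar (extContract (EuclideanSpace.single i 1) α)) =
      emb (extPar (extContract X α)) :=
  sum_coord_smul ((emb.comp extPar).comp (extContract.flip α)) X

/-- This is the term of the Lie derivative in which derivatives of the vector field contract the
form, written as ∂_k X^i c^k ∂/∂c^i. -/
theorem sum_gmul_oc_emb_contract (D : Euc d →ₗ[ℝ] Euc d) (α : Ext (Euc d)) :
    ∑ i, gmul (∑ k, D (EuclideanSpace.single k 1) i • mono {oc k})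
        (emb (extContract (EuclideanSpace.single i 1) α)) =
      emb (extAlt ((extContract.flip α).comp D)) := by
  rw [← sum_gmul_oc_emb]
  simp only [map_sum, LinearMap.sum_apply, map_smul, LinearMap.smul_apply]
  rw [Finset.sum_comm]
  refine Finset.sum_congr rfl fun k _ => ?_
  simp only [← map_smul]
  rw [← map_sum]
  refine congrArg _ ?_
  simp only [map_smul]
  exact sum_smul_emb_contract (D (EuclideanSpace.single k 1)) α

theorem poisson_formFun_formFun (η ζ : Forms d M) :
    poisson (formFun φ η) (formFun φ ζ) = 0 :=
  ext_val fun z hz => by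
    rw [val_poisson hz, val_formFun hz, val_formFun hz, map_zero]
    simp [val_dp_formFun hz, gright_ob_emb, gleft_ob_emb]

theorem antibracket_formFun_formFun (η ζ : Forms d M) :
    antibracket (formFun φ η) (formFun φ ζ) = 0 :=
  ext_val fun z hz => by
    rw [val_antibracket hz, val_formFun hz, val_formFun hz, map_zero]
    simp [val_dp_formFun hz, gright_ob_emb, gleft_ob_emb]

variable [IsManifold (𝓡 d) ∞ M]

theorem extPar_loc_iota {e : ZMod 2} {η : Forms d M} (X : VField d M) (h : formParity e η = η)
    (y : Euc d) : extPar (loc φ.1 y (iota X η)) = -sgn e • loc φ.1 y (iota X η) := by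
  rw [extPar_loc (iota_formParity_fixed X h), sgn_add, sgn_one, mul_neg_one]

/-! ### The realization on `T^*E` -/

/-- Only the right derivative in c^i paired with ∂/∂b_i contributes. It differs from the left
derivative, which is contraction, by the parity of `i_X η`, opposite to that of η. -/
theorem poisson_formFun_oddField {e : ZMod 2} {η : Forms d M} (X : VField d M)
    (h : formParity e η = η) :
    poisson (formFun φ η) (oddField φ X) = -sgn e • formFun φ (iota X η) :=
  ext_val fun z hz => by
    rw [val_poisson hz, map_smul, val_formFun hz, val_formFun hz, val_oddField hz]
    simp only [val_dp_formFun hz, val_dp_oddField hz, gright_ob_emb, gright_oc_emb, gleft_ob_bvec,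
      map_zero, LinearMap.zero_apply, sub_zero, zero_add, map_smul, gmul_mono_empty]
    rw [sum_smul_emb_extPar_contract, ← loc_iota φ.2 (evenDomain_mem hz), extPar_loc_iota X h,
      map_smul]

theorem poisson_oddField_formFun (X : VField d M) (η : Forms d M) :
    poisson (oddField φ X) (formFun φ η) = formFun φ (iota X η) :=
  ext_val fun z hz => by
    rw [val_poisson hz, val_formFun hz, val_formFun hz, val_oddField hz]
    simp only [val_dp_formFun hz, val_dp_oddField hz, gright_ob_bvec, gright_oc_bvec, gleft_oc_emb,
      map_zero, LinearMap.zero_apply, sub_zero, zero_add, add_zero, map_smul, LinearMap.smul_apply,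
      mono_empty_gmul]
    rw [sum_smul_emb_contract, ← loc_iota φ.2 (evenDomain_mem hz)]

theorem poisson_oddField_oddField (X Y : VField d M) :
    poisson (oddField φ X) (oddField φ Y) = 0 :=
  ext_val fun z hz => by
    rw [val_poisson hz, val_oddField hz, val_oddField hz, map_zero]
    simp [val_dp_oddField hz, gright_oc_bvec, gleft_oc_bvec]

theorem poisson_genQ_formFun (η : Forms d M) :
    poisson (genQ φ 0) (formFun φ η) = formFun φ (deRham η) :=
  ext_val fun z hz => by
    rw [val_poisson hz, val_formFun hz, val_formFun hz, val_genQ hz]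
    simp only [val_dp_formFun hz, val_dx_formFun hz, val_dp_genQ hz, gright_ob_cvec, gleft_ob_emb,
      map_zero, LinearMap.zero_apply, sub_zero, add_zero]
    rw [sum_gmul_oc_emb, ← loc_deRham φ.2 (evenDomain_mem hz)]

/-- This is the Hamiltonian c^k ∂_k X^j b_j + P_i X^i that generates the Lie derivative along X. -/
theorem val_poisson_genQ_oddField (hz : z ∈ evenDomain φ) (X : VField d M) :
    val z (poisson (genQ φ 0) (oddField φ X)) =
      ∑ k, gmul (mono {oc k})
        (bvec (fderiv ℝ (localField φ.1 X) z.1 (EuclideanSpace.single k 1))) +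
      inner ℝ z.2 (localField φ.1 X z.1) • mono ∅ := by
  rw [val_poisson hz, val_oddField hz, val_genQ hz]
  simp only [val_dp_genQ hz, val_dx_oddField hz, val_dp_oddField hz, gright_ob_cvec,
    gright_oc_cvec, gleft_ob_bvec, map_zero, LinearMap.zero_apply, sub_zero, add_zero, map_smul,
    LinearMap.smul_apply, gmul_mono_empty, smul_smul, Finset.sum_add_distrib]
  rw [inner_eq_sum, Finset.sum_smul]
  simp only [mul_comm]

theorem val_dp_poisson_genQ_oddField (hz : z ∈ evenDomain φ) (X : VField d M) (i : Fin d) :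
    val z (dp i (poisson (genQ φ 0) (oddField φ X))) = localField φ.1 X z.1 i • mono ∅ := by
  rw [val_dp_of_affine hz
    (fun x => ∑ k, gmul (mono {oc k})
      (bvec (fderiv ℝ (localField φ.1 X) x (EuclideanSpace.single k 1))))
    (fun x => (LinearMap.toSpanSingleton ℝ (Gr d) (mono ∅)).comp
      ((innerₗ (Euc d)).flip (localField φ.1 X x)))
    (fun w hw => val_poisson_genQ_oddField hw X)]
  simp [EuclideanSpace.inner_single_right]

theorem gright_ob_poisson_genQ_oddField (hz : z ∈ evenDomain φ) (X : VField d M) (i : Fin d) :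
    gright (ob i) (val z (poisson (genQ φ 0) (oddField φ X))) =
      ∑ k, fderiv ℝ (localField φ.1 X) z.1 (EuclideanSpace.single k 1) i • mono {oc k} := by
  rw [val_poisson_genQ_oddField hz, map_add, map_smul, gright_mono_empty, smul_zero, add_zero,
    map_sum]
  exact Finset.sum_congr rfl fun k _ => gright_ob_gmul_oc_bvec i k _

theorem gright_oc_poisson_genQ_oddField (hz : z ∈ evenDomain φ) (X : VField d M) (i : Fin d) :
    gright (oc i) (val z (poisson (genQ φ 0) (oddField φ X))) =
      -bvec (fderiv ℝ (localField φ.1 X) z.1 (EuclideanSpace.single i 1)) := by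
  rw [val_poisson_genQ_oddField hz, map_add, map_smul, gright_mono_empty, smul_zero, add_zero,
    map_sum]
  simp [gright_oc_gmul_oc_bvec]

/-- The momentum part of the Hamiltonian differentiates the coefficients along X and the b part acts
on the c^i. These are the two terms of `loc_lieD`. -/
theorem poisson_poisson_genQ_oddField_formFun (X : VField d M) (η : Forms d M) :
    poisson (poisson (genQ φ 0) (oddField φ X)) (formFun φ η) = formFun φ (lieD X η) :=
  ext_val fun z hz => by
    rw [val_poisson hz, val_formFun hz, val_formFun hz]
    simp only [val_dp_formFun hz, val_dx_formFun hz, val_dp_poisson_genQ_oddField hz,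
      gright_ob_poisson_genQ_oddField hz, gleft_ob_emb, gleft_oc_emb, map_zero, sub_zero, add_zero,
      Finset.sum_add_distrib, map_smul, LinearMap.smul_apply, mono_empty_gmul]
    rw [loc_lieD φ.2 (evenDomain_mem hz), map_add, ← sum_gmul_oc_emb_contract]
    exact congrArg₂ _ (sum_coord_smul (emb.comp (locD φ.1 z.1 η)) _) rfl

/-- The momentum part differentiates Y along X, and the right derivative in c contributes the
derivative of X along Y with a minus sign, since c must pass b. -/
theorem poisson_poisson_genQ_oddField_oddField (X Y : VField d M) :
    poisson (poisson (genQ φ 0) (oddField φ X)) (oddField φ Y) = oddField φ (vbracket X Y) :=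
  ext_val fun z hz => by
    rw [val_poisson hz, val_oddField hz, val_oddField hz]
    simp only [val_dp_oddField hz, val_dx_oddField hz, val_dp_poisson_genQ_oddField hz,
      gright_oc_poisson_genQ_oddField hz, gleft_ob_bvec, gleft_oc_bvec, map_zero, sub_zero,
      add_zero, Finset.sum_add_distrib, map_smul, LinearMap.smul_apply, mono_empty_gmul,
      gmul_mono_empty, smul_neg, Finset.sum_neg_distrib]
    rw [localField_vbracket φ.2 (evenDomain_mem hz), map_sub, sub_eq_add_neg]
    exact congrArg₂ _ (sum_coord_smul (bvec.comp (fderiv ℝ (localField φ.1 Y) z.1).toLinearMap) _)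
      (congrArg _ (sum_coord_smul (bvec.comp (fderiv ℝ (localField φ.1 X) z.1).toLinearMap) _))

/-- The functions on `T^*E` with the Poisson bracket realize the Cartan calculus. -/
theorem isCartanModel_poisson (φ : Chart d M) {H : Forms d M} (hH : formParity 1 H = H) :
    IsCartanModel H 0 parity poisson (genQ φ H) (oddField φ) (formFunLin φ) where
  bilin := poisson_isBilin
  parity_H := by rwa [add_zero]
  v_zero := oddField_zero
  par_m := parity_formFun
  par_v e X := by rw [parity_oddField, add_zero]
  br_m_m := poisson_formFun_formFun
  br_m_v e η X h := by
    rw [add_zero]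
    exact poisson_formFun_oddField X h
  br_Q_m η := by
    rw [genQ_eq, poisson_isBilin.add_left]
    exact (congrArg₂ _ (poisson_genQ_formFun η) (poisson_formFun_formFun H η)).trans (add_zero _)
  br_Q_v_m X η := by
    rw [genQ_eq, poisson_isBilin.add_left, poisson_isBilin.add_left, poisson_formFun_oddField X hH,
      poisson_isBilin.smul_left]
    refine (congrArg₂ _ (poisson_poisson_genQ_oddField_formFun X η) ?_).trans (add_zero _)
    rw [formFunLin_apply, poisson_formFun_formFun, smul_zero]
  br_Q_v_v X Y := by
    have h0 : formParity 0 (iota X H) = iota X H := iota_formParity_fixed X hH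
    rw [genQ_eq, poisson_isBilin.add_left, poisson_isBilin.add_left, poisson_formFun_oddField X hH,
      poisson_isBilin.smul_left, poisson_formFun_oddField Y h0,
      poisson_poisson_genQ_oddField_oddField, iota_iota X Y, map_neg, formFunLin_apply, sgn_zero,
      sgn_one, neg_neg, one_smul]
    exact congrArg _ (neg_one_smul ℝ (formFun φ (iota Y (iota X H))))
  br_v_m := poisson_oddField_formFun
  br_v_v := poisson_oddField_oddField

/-! ### The realization on `ΠT^*E` -/

/-- The minus sign of the pairing (c^i, p_j) offsets the one from passing to the right derivative.
This opposite sign, compared with the even bracket, is what the shift by ε in `br_m_v` encodes. -/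
theorem antibracket_formFun_evenField {e : ZMod 2} {η : Forms d M} (X : VField d M)
    (h : formParity e η = η) :
    antibracket (formFun φ η) (evenField φ X) = sgn e • formFun φ (iota X η) :=
  ext_val fun z hz => by
    rw [val_antibracket hz, map_smul, val_formFun hz, val_formFun hz, val_evenField hz]
    simp only [val_dp_formFun hz, val_dp_evenField hz, gright_ob_emb, gright_oc_emb,
      gleft_mono_empty, map_zero, LinearMap.zero_apply, sub_zero, zero_sub, zero_add, map_smul,
      smul_zero, gmul_mono_empty, Finset.sum_neg_distrib]
    rw [sum_smul_emb_extPar_contract, ← loc_iota φ.2 (evenDomain_mem hz), extPar_loc_iota X h,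
      map_smul, neg_smul, neg_neg]

theorem antibracket_evenField_formFun (X : VField d M) (η : Forms d M) :
    antibracket (evenField φ X) (formFun φ η) = formFun φ (iota X η) :=
  ext_val fun z hz => by
    rw [val_antibracket hz, val_formFun hz, val_formFun hz, val_evenField hz]
    simp only [val_dp_formFun hz, val_dp_evenField hz, gright_mono_empty, gleft_oc_emb,
      gleft_ob_emb, map_zero, LinearMap.zero_apply, sub_zero, zero_add, map_smul, smul_zero,
      LinearMap.smul_apply, mono_empty_gmul]
    rw [sum_smul_emb_contract, ← loc_iota φ.2 (evenDomain_mem hz)]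

theorem antibracket_evenField_evenField (X Y : VField d M) :
    antibracket (evenField φ X) (evenField φ Y) = 0 :=
  ext_val fun z hz => by
    rw [val_antibracket hz, val_evenField hz, val_evenField hz, map_zero]
    simp [gright_mono_empty, gleft_mono_empty]

theorem antibracket_genS_formFun (η : Forms d M) :
    antibracket (genS φ 0) (formFun φ η) = formFun φ (deRham η) :=
  ext_val fun z hz => by
    rw [val_antibracket hz, val_formFun hz, val_formFun hz, val_genS hz]
    simp only [val_dp_formFun hz, val_dx_formFun hz, val_dp_genS hz, gright_ob_genS, gleft_ob_emb,
      map_zero, LinearMap.zero_apply, sub_zero, add_zero]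
    rw [sum_gmul_oc_emb, ← loc_deRham φ.2 (evenDomain_mem hz)]

/-- This is X^i B_i + p_i ∂_k X^i c^k, the generator of the Lie derivative for the antibracket. The
roles of B and p are those of P and b in the even case. -/
theorem val_antibracket_genS_evenField (hz : z ∈ evenDomain φ) (X : VField d M) :
    val z (antibracket (genS φ 0) (evenField φ X)) =
      bvec (localField φ.1 X z.1) +
      ∑ k, inner ℝ z.2 (fderiv ℝ (localField φ.1 X) z.1 (EuclideanSpace.single k 1)) •
        mono {oc k} := by
  rw [val_antibracket hz, val_evenField hz, val_genS hz]
  simp only [val_dp_genS hz, val_dx_genS hz, val_dp_evenField hz, val_dx_evenField hz,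
    gright_ob_genS, gright_oc_genS, gleft_mono_empty, map_zero, sub_zero, add_zero, map_smul,
    smul_zero, gmul_mono_empty, smul_neg, sub_neg_eq_add, Finset.sum_add_distrib]
  rw [bvec_apply, add_comm]

theorem val_dp_antibracket_genS_evenField (hz : z ∈ evenDomain φ) (X : VField d M) (i : Fin d) :
    val z (dp i (antibracket (genS φ 0) (evenField φ X))) =
      ∑ k, fderiv ℝ (localField φ.1 X) z.1 (EuclideanSpace.single k 1) i • mono {oc k} := by
  rw [val_dp_of_affine hz (fun x => bvec (localField φ.1 X x))
    (fun x => ∑ k, (LinearMap.toSpanSingleton ℝ (Gr d) (mono {oc k})).comp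
      ((innerₗ (Euc d)).flip (fderiv ℝ (localField φ.1 X) x (EuclideanSpace.single k 1))))
    (fun w hw => by
      rw [val_antibracket_genS_evenField hw X, LinearMap.sum_apply]
      rfl)]
  simp [EuclideanSpace.inner_single_right]

theorem gright_ob_antibracket_genS_evenField (hz : z ∈ evenDomain φ) (X : VField d M)
    (i : Fin d) :
    gright (ob i) (val z (antibracket (genS φ 0) (evenField φ X))) =
      localField φ.1 X z.1 i • mono ∅ := by
  rw [val_antibracket_genS_evenField hz, map_add, gright_ob_bvec, map_sum]
  simp [gright_mono_singleton, (oc_ne_ob _ _).symm]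

theorem gright_oc_antibracket_genS_evenField (hz : z ∈ evenDomain φ) (X : VField d M)
    (i : Fin d) :
    gright (oc i) (val z (antibracket (genS φ 0) (evenField φ X))) =
      inner ℝ z.2 (fderiv ℝ (localField φ.1 X) z.1 (EuclideanSpace.single i 1)) • mono ∅ := by
  rw [val_antibracket_genS_evenField hz, map_add, gright_oc_bvec, zero_add, map_sum]
  simp [gright_mono_singleton, oc_injective.eq_iff]

theorem antibracket_antibracket_genS_evenField_formFun (X : VField d M) (η : Forms d M) :
    antibracket (antibracket (genS φ 0) (evenField φ X)) (formFun φ η) = formFun φ (lieD X η) :=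
  ext_val fun z hz => by
    rw [val_antibracket hz, val_formFun hz, val_formFun hz]
    simp only [val_dp_formFun hz, val_dx_formFun hz, val_dp_antibracket_genS_evenField hz,
      gright_ob_antibracket_genS_evenField hz, gleft_ob_emb, gleft_oc_emb, map_zero, sub_zero,
      Finset.sum_add_distrib, map_smul, LinearMap.smul_apply, mono_empty_gmul]
    rw [loc_lieD φ.2 (evenDomain_mem hz), map_add, ← sum_gmul_oc_emb_contract]
    exact congrArg₂ _ (sum_coord_smul (emb.comp (locD φ.1 z.1 η)) _) rfl

theorem antibracket_antibracket_genS_evenField_evenField (X Y : VField d M) :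
    antibracket (antibracket (genS φ 0) (evenField φ X)) (evenField φ Y) =
      evenField φ (vbracket X Y) :=
  ext_val fun z hz => by
    rw [val_antibracket hz, val_evenField hz, val_evenField hz]
    simp only [val_dp_evenField hz, val_dx_evenField hz, gright_ob_antibracket_genS_evenField hz,
      gright_oc_antibracket_genS_evenField hz, gleft_mono_empty, map_zero, sub_zero, add_zero,
      Finset.sum_sub_distrib, map_smul, smul_zero, gmul_mono_empty, LinearMap.smul_apply]
    rw [localField_vbracket φ.2 (evenDomain_mem hz), inner_sub_right, sub_smul]
    have h (Z : VField d M) (w : Euc d) := sum_coord_smul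
      ((LinearMap.toSpanSingleton ℝ (Gr d) (mono ∅)).comp
        ((innerₗ (Euc d) z.2).comp (fderiv ℝ (localField φ.1 Z) z.1).toLinearMap)) w
    refine congrArg₂ _ ?_ ?_
    · refine Eq.trans (Finset.sum_congr rfl fun i _ => ?_) (h Y (localField φ.1 X z.1))
      exact smul_comm _ _ _
    · exact h X (localField φ.1 Y z.1)

/-- The functions on `ΠT^*E` with the antibracket realize the Cartan calculus. -/
theorem isCartanModel_antibracket (φ : Chart d M) {H : Forms d M} (hH : formParity 0 H = H) :
    IsCartanModel H 1 parity antibracket (genS φ H) (evenField φ) (formFunLin φ) where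
  bilin := antibracket_isBilin
  parity_H := hH
  v_zero := evenField_zero
  par_m := parity_formFun
  par_v e X := parity_evenField e X
  br_m_m := antibracket_formFun_formFun
  br_m_v e η X h := by
    rw [sgn_add, sgn_one, mul_neg_one, neg_neg]
    exact antibracket_formFun_evenField X h
  br_Q_m η := by
    rw [genS_eq, antibracket_isBilin.add_left]
    exact (congrArg₂ _ (antibracket_genS_formFun η)
      (antibracket_formFun_formFun H η)).trans (add_zero _)
  br_Q_v_m X η := by
    rw [genS_eq, antibracket_isBilin.add_left, antibracket_isBilin.add_left,
      antibracket_formFun_evenField X hH, antibracket_isBilin.smul_left]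
    refine (congrArg₂ _ (antibracket_antibracket_genS_evenField_formFun X η) ?_).trans (add_zero _)
    rw [formFunLin_apply, antibracket_formFun_formFun, smul_zero]
  br_Q_v_v X Y := by
    have h0 : formParity 1 (iota X H) = iota X H := by
      simpa using iota_formParity_fixed X hH
    rw [genS_eq, antibracket_isBilin.add_left, antibracket_isBilin.add_left,
      antibracket_formFun_evenField X hH, antibracket_isBilin.smul_left,
      antibracket_formFun_evenField Y h0, antibracket_antibracket_genS_evenField_evenField,
      iota_iota X Y, map_neg, formFunLin_apply, sgn_zero, sgn_one, one_smul]
    exact congrArg _ (neg_one_smul ℝ (formFun φ (iota Y (iota X H))))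
  br_v_m := antibracket_evenField_formFun
  br_v_v := antibracket_evenField_evenField

end Momenta

/-! ### The three-bracket -/

section ThreeBracket
variable {d : ℕ} {M : Type*} [TopologicalSpace M] [ChartedSpace (Euc d) M]

theorem formParity_one_of_even_eq_zero {H : Forms d M} (h : ∀ k, Even k → H k = 0) :
    formParity 1 H = H := by
  funext k
  rw [formParity_apply]
  split_ifs with hk
  · rfl
  · refine (h k ?_).symm
    rw [← Nat.not_odd_iff_even, ← ZMod.natCast_eq_one_iff_odd]
    exact hk

theorem formParity_zero_of_odd_eq_zero {H : Forms d M} (h : ∀ k, Odd k → H k = 0) :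
    formParity 0 H = H := by
  funext k
  rw [formParity_apply]
  split_ifs with hk
  · rfl
  · refine (h k ?_).symm
    rw [← Nat.not_even_iff_odd, ← ZMod.natCast_eq_zero_iff_even]
    exact hk

variable [IsManifold (𝓡 d) ∞ M]

theorem iota_lieD (X Y : VField d M) (η : Forms d M) :
    iota X (lieD Y η) = iota X (iota Y (deRham η)) + iota X (deRham (iota Y η)) := by
  rw [lieD_apply, map_add]

theorem iota_vbracket_apply (X Y : VField d M) (η : Forms d M) :
    iota (vbracket X Y) η = iota X (deRham (iota Y η)) + deRham (iota X (iota Y η)) +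
      (iota X (iota Y (deRham η)) - iota Y (deRham (iota X η))) := by
  rw [iota_vbracket, lieD_apply, iota_lieD, iota_iota Y X (deRham η)]
  abel

/-- Cartan's formulas express every term through i_X i_Y dη, i_X d i_Y η, i_Y d i_X η and d i_X i_Y
η. In this normal form the three stated expressions can be compared by linear algebra. -/
theorem threeBracket_eq (X Y : VField d M) (η : Forms d M) :
    threeBracket X Y η = iota X (iota Y (deRham η)) +
      ((1 / 2 : ℝ) • (iota X (deRham (iota Y η)) - iota Y (deRham (iota X η))) +
        (1 / 3 : ℝ) • deRham (iota X (iota Y η))) := by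
  have h {W : Type _} [AddCommGroup W] [Module ℝ W] (a p q r : W) :
      (1 / 6 : ℝ) • (a + (a + p) - (-a + (-a + q)) + (p + r + (a - q) - (q + -r + (-a - p)))) =
        a + ((1 / 2 : ℝ) • (p - q) + (1 / 3 : ℝ) • r) := by module
  rw [threeBracket_apply, map_add, map_add, iota_lieD, iota_lieD, iota_vbracket_apply X Y,
    iota_vbracket_apply Y X, iota_iota Y X (deRham η), iota_iota Y X η, map_neg]
  exact h _ _ _ _

theorem threeBracket_eq_lieD_vbracket (X Y : VField d M) (η : Forms d M) :
    threeBracket X Y η = (1 / 3 : ℝ) • (iota (vbracket X Y) η +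
      (1 / 2 : ℝ) • (iota X (lieD Y η) - iota Y (lieD X η)) + iota X (iota Y (deRham η))) := by
  have h {W : Type _} [AddCommGroup W] [Module ℝ W] (a p q r : W) :
      a + ((1 / 2 : ℝ) • (p - q) + (1 / 3 : ℝ) • r) =
      (1 / 3 : ℝ) • (p + r + (a - q) + (1 / 2 : ℝ) • (a + p - (-a + q)) + a) := by module
  rw [threeBracket_eq, iota_lieD, iota_lieD, iota_vbracket_apply X Y, iota_iota Y X (deRham η)]
  exact h _ _ _ _

theorem threeBracket_eq_lieD (X Y : VField d M) (η : Forms d M) :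
    threeBracket X Y η = (1 / 2 : ℝ) • (iota X (lieD Y η) - iota Y (lieD X η)) +
      (1 / 3 : ℝ) • deRham (iota X (iota Y η)) := by
  have h {W : Type _} [AddCommGroup W] [Module ℝ W] (a p q r : W) :
      a + ((1 / 2 : ℝ) • (p - q) + (1 / 3 : ℝ) • r) =
      (1 / 2 : ℝ) • (a + p - (-a + q)) + (1 / 3 : ℝ) • r := by module
  rw [threeBracket_eq, iota_lieD, iota_lieD, iota_iota Y X (deRham η)]
  exact h _ _ _ _

theorem threeBracket_eq_vbracket (X Y : VField d M) (η : Forms d M) :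
    threeBracket X Y η = (1 / 2 : ℝ) • (iota X (iota Y (deRham η)) -
      (1 / 3 : ℝ) • deRham (iota X (iota Y η)) + iota (vbracket X Y) η) := by
  have h {W : Type _} [AddCommGroup W] [Module ℝ W] (a p q r : W) :
      a + ((1 / 2 : ℝ) • (p - q) + (1 / 3 : ℝ) • r) =
      (1 / 2 : ℝ) • (a - (1 / 3 : ℝ) • r + (p + r + (a - q))) := by module
  rw [threeBracket_eq, iota_vbracket_apply X Y]
  exact h _ _ _ _

theorem hier_succ_apply {n : ℕ} (hn : 2 ≤ n) (X : Fin (n + 1) → VField d M) (η : Forms d M) :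
    hier (n + 1) X η = (1 / ((n : ℝ) + 2)) • ∑ i : Fin (n + 1), (-1 : ℝ) ^ (i : ℕ) •
      iota (X i) (hier n (fun k => X (i.succAbove k)) η) := by
  rw [hier_succ hn, LinearMap.smul_apply, LinearMap.sum_apply]
  rfl

theorem hier_apply_eq_sum {n : ℕ} (hn : 2 ≤ n) (X : Fin n → VField d M) (η : Forms d M) :
    hier n X η = (6 / (((n : ℝ) + 1) * n * (n - 1))) •
      ∑ p ∈ (Finset.univ : Finset (Fin n × Fin n)).filter (fun p => p.1 < p.2),
        (-1 : ℝ) ^ ((n - 1 - ((p.1 : ℕ) + 1)) + (n - ((p.2 : ℕ) + 1))) •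
          (((List.finRange n).filter (fun k => k ≠ p.1 ∧ k ≠ p.2)).map
            (fun k => iota (X k))).prod (hier 2 ![X p.1, X p.2] η) := by
  rw [hier_eq_pairSum hn, LinearMap.smul_apply, pairSum, LinearMap.sum_apply]
  rfl

end ThreeBracket

end CourantHierarchy
end

/-! ### The proposition, from the three Cartan models. -/

theorem mainTheorem4 {d : ℕ} {M : Type*} [TopologicalSpace M]
    [ChartedSpace (CourantHierarchy.Euc d) M] [IsManifold (𝓡 d) ∞ M]
    (Hodd Heven : CourantHierarchy.Forms d M)
    (hodd : ∀ k, Even k → Hodd k = 0) (heven : ∀ k, Odd k → Heven k = 0)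
    (hoddClosed : CourantHierarchy.deRham Hodd = 0)
    (hevenClosed : CourantHierarchy.deRham Heven = 0) :
    -- brackets of at least three vector fields
    (∀ n : ℕ, 3 ≤ n → ∀ X : Fin n → CourantHierarchy.VField d M,
      CourantHierarchy.PhiD Hodd n (fun i => CourantHierarchy.iota (X i)) =
          CourantHierarchy.leftMul
            ((List.ofFn fun i => CourantHierarchy.iota (X i)).prod Hodd) ∧
      ∀ φ : CourantHierarchy.Chart d M,
        CourantHierarchy.PhiQ φ Hodd n (fun i => CourantHierarchy.oddField φ (X i)) =
            CourantHierarchy.formFun φ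
              ((List.ofFn fun i => CourantHierarchy.iota (X i)).prod Hodd) ∧
        CourantHierarchy.PhiS φ Heven n (fun i => CourantHierarchy.evenField φ (X i)) =
            CourantHierarchy.formFun φ
              ((List.ofFn fun i => CourantHierarchy.iota (X i)).prod Heven)) ∧
    -- brackets of at least two vector fields and one form: the three constructions give one and
    -- the same exterior form `B n X η`, which is determined as follows
    (∃ B : (n : ℕ) → (Fin n → CourantHierarchy.VField d M) →
        CourantHierarchy.Forms d M → CourantHierarchy.Forms d M,
      (∀ n : ℕ, 2 ≤ n → ∀ (X : Fin n → CourantHierarchy.VField d M)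
        (η : CourantHierarchy.Forms d M),
        CourantHierarchy.PhiD Hodd (n + 1)
            (Fin.snoc (α := fun _ => Module.End ℝ (CourantHierarchy.Forms d M))
              (fun i => CourantHierarchy.iota (X i)) (CourantHierarchy.leftMul η)) =
            CourantHierarchy.leftMul (B n X η) ∧
        ∀ φ : CourantHierarchy.Chart d M,
          CourantHierarchy.PhiQ φ Hodd (n + 1)
              (Fin.snoc (α := fun _ => CourantHierarchy.LocalFun φ)
                (fun i => CourantHierarchy.oddField φ (X i)) (CourantHierarchy.formFun φ η)) =
              CourantHierarchy.formFun φ (B n X η) ∧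
          CourantHierarchy.PhiS φ Heven (n + 1)
              (Fin.snoc (α := fun _ => CourantHierarchy.LocalFun φ)
                (fun i => CourantHierarchy.evenField φ (X i)) (CourantHierarchy.formFun φ η)) =
              CourantHierarchy.formFun φ (B n X η)) ∧
      -- the three-bracket
      (∀ (X Y : CourantHierarchy.VField d M) (η : CourantHierarchy.Forms d M),
        B 2 ![X, Y] η =
          (1 / 3 : ℝ) • (CourantHierarchy.iota (CourantHierarchy.vbracket X Y) η
            + (1 / 2 : ℝ) • (CourantHierarchy.iota X (CourantHierarchy.lieD Y η)
                - CourantHierarchy.iota Y (CourantHierarchy.lieD X η))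
            + CourantHierarchy.iota X (CourantHierarchy.iota Y (CourantHierarchy.deRham η))) ∧
        B 2 ![X, Y] η =
          (1 / 2 : ℝ) • (CourantHierarchy.iota X (CourantHierarchy.lieD Y η)
              - CourantHierarchy.iota Y (CourantHierarchy.lieD X η))
            + (1 / 3 : ℝ) • CourantHierarchy.deRham (CourantHierarchy.iota X (CourantHierarchy.iota Y η)) ∧
        B 2 ![X, Y] η =
          (1 / 2 : ℝ) • (CourantHierarchy.iota X (CourantHierarchy.iota Y (CourantHierarchy.deRham η))
            - (1 / 3 : ℝ) • CourantHierarchy.deRham (CourantHierarchy.iota X (CourantHierarchy.iota Y η))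
            + CourantHierarchy.iota (CourantHierarchy.vbracket X Y) η)) ∧
      -- the recursion for `n = m + 1 ≥ 3` vector fields
      (∀ m : ℕ, 2 ≤ m → ∀ (X : Fin (m + 1) → CourantHierarchy.VField d M)
        (η : CourantHierarchy.Forms d M),
        B (m + 1) X η = (1 / ((m : ℝ) + 2)) • ∑ i : Fin (m + 1),
          (-1 : ℝ) ^ (i : ℕ) •
            CourantHierarchy.iota (X i) (B m (fun k => X (i.succAbove k)) η)) ∧
      -- the explicit formula for `n ≥ 2` vector fields; the `i`-th vector field is `X (i - 1)`
      (∀ n : ℕ, 2 ≤ n → ∀ (X : Fin n → CourantHierarchy.VField d M)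
        (η : CourantHierarchy.Forms d M),
        B n X η = (6 / (((n : ℝ) + 1) * n * (n - 1))) •
          ∑ p ∈ (Finset.univ : Finset (Fin n × Fin n)).filter (fun p => p.1 < p.2),
            (-1 : ℝ) ^ ((n - 1 - ((p.1 : ℕ) + 1)) + (n - ((p.2 : ℕ) + 1))) •
              (((List.finRange n).filter (fun k => k ≠ p.1 ∧ k ≠ p.2)).map
                (fun k => CourantHierarchy.iota (X k))).prod (B 2 ![X p.1, X p.2] η))) ∧
    -- brackets of vector fields and forms with at least two forms among the arguments
    (∀ (n : ℕ) (z : Fin n → CourantHierarchy.VField d M ⊕ CourantHierarchy.Forms d M)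
      (i j : Fin n), i ≠ j → (z i).isRight = true → (z j).isRight = true →
      CourantHierarchy.PhiD Hodd n (fun k =>
          Sum.elim CourantHierarchy.iota CourantHierarchy.leftMul (z k)) = 0 ∧
      ∀ φ : CourantHierarchy.Chart d M,
        CourantHierarchy.PhiQ φ Hodd n (fun k =>
          Sum.elim (CourantHierarchy.oddField φ) (CourantHierarchy.formFun φ) (z k)) = 0 ∧
        CourantHierarchy.PhiS φ Heven n (fun k =>
          Sum.elim (CourantHierarchy.evenField φ) (CourantHierarchy.formFun φ) (z k)) = 0) := by
  have h1 := CourantHierarchy.formParity_one_of_even_eq_zero hodd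
  have h0 := CourantHierarchy.formParity_zero_of_odd_eq_zero heven
  have hD := CourantHierarchy.isCartanModel_operators h1
  have hQ (φ : CourantHierarchy.Chart d M) := CourantHierarchy.isCartanModel_poisson φ h1
  have hS (φ : CourantHierarchy.Chart d M) := CourantHierarchy.isCartanModel_antibracket φ h0
  refine ⟨fun n hn X => ⟨hD.derivedBracket_vectors hn X, fun φ =>
      ⟨(hQ φ).derivedBracket_vectors hn X, (hS φ).derivedBracket_vectors hn X⟩⟩,
    -- The common form is `hier`, whose definition refers neither to `H` nor to any of the three
    -- brackets.
    ⟨fun n X η => CourantHierarchy.hier n X η, fun n hn X η =>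
      ⟨hD.derivedBracket_form hn X η, fun φ =>
        ⟨(hQ φ).derivedBracket_form hn X η, (hS φ).derivedBracket_form hn X η⟩⟩,
      fun X Y η => ⟨CourantHierarchy.threeBracket_eq_lieD_vbracket X Y η,
        CourantHierarchy.threeBracket_eq_lieD X Y η,
        CourantHierarchy.threeBracket_eq_vbracket X Y η⟩,
      fun m hm X η => CourantHierarchy.hier_succ_apply hm X η,
      fun n hn X η => CourantHierarchy.hier_apply_eq_sum hn X η⟩,
    fun n z i j hij hi hj => ⟨hD.derivedBracket_two_forms n z hij hi hj, fun φ =>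
      ⟨(hQ φ).derivedBracket_two_forms n z hij hi hj,
        (hS φ).derivedBracket_two_forms n z hij hi hj⟩⟩⟩
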